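/- Let $(M,g)$ be a smooth Riemannian 3-manifold diffeomorphic to $\mathbb S^3$, and let $\Sigma\subset M$ be an embedded minimal 2-sphere with an open neighbourhood that is smoothly foliated by 2-spheres $\{\Sigma_s\}_{-1<s<1}$, $\Sigma_0=\Sigma$ (that is, there is a diffeomorphism $F$ from $\mathbb S^2\times(-1,1)$ onto this neighbourhood with $\Sigma_s=F(\mathbb S^2\times\{s\})$). Let $f$ be the smooth function with $f=s$ on $\Sigma_s$, and assume that the half $0<s<1$ is contracting: the mean curvature vector $\vec H(\Sigma_s)$ points towards $\Sigma$, i.e. $\langle\nabla f,\vec H(\Sigma_s)\rangle<0$ at every point of $\Sigma_s$, for $0<s<1$. Put $X=\nabla f/|\nabla f|^2$ and let $\phi:\Sigma\times[0,1)\to M$ be the flow of $X$ starting at $\Sigma$: $\partial_s\phi(x,s)=X(\phi(x,s))$, $\phi(x,0)=x$. (It exists and satisfies $\phi(\Sigma\times\{s\})=\Sigma_s$.) For $0<r\le 1$ let $\Omega_r=\phi(\Sigma\times[0,r))$, and for $0\le t\le 1$ let $P_t:\Omega_1\to\Omega_1$ be the (well-defined) map $P_t(\phi(x,s))=\phi(x,(1-t)s)$.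 Then there is $r_0\in(0,1]$ such that: (i) $P_0(p)=p$ for all $p\in\Omega_{r_0}$, and $P_t(p)=p$ for all $p\in\Sigma$ and $0\le t\le1$; (ii) $P_t(\Omega_r)\subset\Omega_r$ for $0\le t\le 1$ and $r\le r_0$, and $P_1(\Omega_{r_0})=\Sigma$; (iii) $P_t:\Omega_{r_0}\to\Omega_{r_0}$ is a smooth embedding for $0\le t<1$; (iv) for every smooth embedded surface $V\subset\Omega_{r_0}$ of finite area and every $0\le t<1$, the area $|P_t(V)|$ is finite and differentiable in $t$ (from the right at $t=0$), with $$\frac{d}{dt}|P_t(V)|\le 0,$$ and equality holds (at a given $t$) if and only if $V\subset\Sigma$. -/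

import Mathlib

open Set Metric MeasureTheory Topology
open scoped Manifold ContDiff

noncomputable section

namespace Squeezing

/-- The Euclidean plane. -/
abbrev E2 := EuclideanSpace ℝ (Fin 2)

/-- Euclidean 3-space. -/
abbrev E3 := EuclideanSpace ℝ (Fin 3)

/-- The standard smooth 2-sphere. -/
abbrev S2 := sphere (0 : EuclideanSpace ℝ (Fin 3)) 1

/-- The standard smooth 3-sphere. -/
abbrev S3 := sphere (0 : EuclideanSpace ℝ (Fin 4)) 1

/-- The `i`-th standard basis vector of the plane. -/
def basisVec (i : Fin 2) : E2 := EuclideanSpace.single i 1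

instance instFiniteDimensionalTangentSpace {M : Type*} [TopologicalSpace M] [ChartedSpace E3 M]
    (p : M) : FiniteDimensional ℝ (TangentSpace (𝓡 3) p) :=
  inferInstanceAs (FiniteDimensional ℝ E3)

/-- The Christoffel symbols of the first kind at `y` of a metric tensor `G` on an open set of `ℝ³`:
`w ↦ ½ (∂_u G(v, w) + ∂_v G(u, w) - ∂_w G(u, v))`. -/
def christoffel (G : E3 → E3 →L[ℝ] E3 →L[ℝ] ℝ) (y u v : E3) : E3 →L[ℝ] ℝ :=
  let DG : E3 →L[ℝ] E3 →L[ℝ] E3 →L[ℝ] ℝ := fderiv ℝ G y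
  (1 / 2 : ℝ) • (DG u v + DG v u - (DG.flip u).flip v)

section Geometry

open Bundle

variable {M : Type*} [TopologicalSpace M] [ChartedSpace E3 M]
  [RiemannianBundle (fun x : M ↦ TangentSpace (𝓡 3) x)]

instance instCompleteSpaceTangentSpace (p : M) : CompleteSpace (TangentSpace (𝓡 3) p) :=
  FiniteDimensional.complete ℝ _

/-- The Riemannian gradient `∇f`: `⟨∇f, v⟩ = df(v)`. -/
def gradient (f : M → ℝ) (p : M) : TangentSpace (𝓡 3) p :=
  (InnerProductSpace.toDual ℝ (TangentSpace (𝓡 3) p)).symm (mvfderiv (𝓡 3) f p)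

/-- The vector field `X = ∇f / |∇f|²`. -/
def normalField (f : M → ℝ) (p : M) : TangentSpace (𝓡 3) p :=
  (‖gradient f p‖ ^ 2)⁻¹ • gradient f p

/-- The derivative at `y` of the inverse of the preferred chart at `p`. -/
def chartSymmDeriv (p : M) (y : E3) :
    E3 →L[ℝ] TangentSpace (𝓡 3) ((extChartAt (𝓡 3) p).symm y) :=
  mfderiv 𝓘(ℝ, E3) (𝓡 3) (extChartAt (𝓡 3) p).symm y

/-- The metric tensor in the coordinates given by the preferred chart at `p`, as a function of the
coordinate `y`: the pull-back of the Riemannian metric under the inverse of the chart. -/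
def coordMetric (p : M) (y : E3) : E3 →L[ℝ] E3 →L[ℝ] ℝ :=
  (innerSL ℝ (E := TangentSpace (𝓡 3) ((extChartAt (𝓡 3) p).symm y))).bilinearComp
    (chartSymmDeriv p y) (chartSymmDeriv p y)

variable {S : Type*} [TopologicalSpace S] [ChartedSpace E2 S]

/-- The map `ι` near `x`, written in the preferred charts at `x` and at `ι x`. -/
def localRep (ι : S → M) (x : S) : E2 → E3 := writtenInExtChartAt (𝓡 2) (𝓡 3) x ι

/-- The coordinate tangent vector `∂_i ι` at `x`, in coordinates. -/
def coordDeriv (ι : S → M) (x : S) (i : Fin 2) : E3 :=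
  fderiv ℝ (localRep ι x) (extChartAt (𝓡 2) x x) (basisVec i)

/-- The second derivative `∂_i ∂_j ι` at `x` in coordinates, as a vector at `ι x` (the tangent space
at `ι x` is identified with `ℝ³` by the preferred chart at `ι x`). -/
def coordDeriv₂ (ι : S → M) (x : S) (i j : Fin 2) : TangentSpace (𝓡 3) (ι x) :=
  fderiv ℝ (fderiv ℝ (localRep ι x)) (extChartAt (𝓡 2) x x) (basisVec i) (basisVec j)

/-- The covector `w ↦ ⟨Γ(∂_i ι, ∂_j ι), w⟩` at `ι x` given by the Christoffel symbols. -/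
def christoffelTerm (ι : S → M) (x : S) (i j : Fin 2) : TangentSpace (𝓡 3) (ι x) →L[ℝ] ℝ :=
  christoffel (coordMetric (ι x)) (extChartAt (𝓡 3) (ι x) (ι x)) (coordDeriv ι x i)
    (coordDeriv ι x j)

/-- The Levi-Civita derivative `∇_{∂_i} ∂_j ι` at `x` of the coordinate fields (in the preferred
chart at `x`) along a parametrized surface `ι`: the sum of `∂_i ∂_j ι` and `Γ(∂_i ι, ∂_j ι)`. -/
def covDeriv (ι : S → M) (x : S) (i j : Fin 2) : TangentSpace (𝓡 3) (ι x) :=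
  coordDeriv₂ ι x i j +
    (InnerProductSpace.toDual ℝ (TangentSpace (𝓡 3) (ι x))).symm (christoffelTerm ι x i j)

/-- The matrix `⟨∂_i ι, ∂_j ι⟩` of the metric induced by `ι`. -/
def firstFund (ι : S → M) (x : S) : Matrix (Fin 2) (Fin 2) ℝ :=
  Matrix.of fun i j ↦
    inner ℝ (mfderiv (𝓡 2) (𝓡 3) ι x (basisVec i)) (mfderiv (𝓡 2) (𝓡 3) ι x (basisVec j))

/-- The mean curvature vector of an immersed surface `ι : S → M`: the trace, with respect to the
induced metric, of the normal part of `∇_{∂_i} ∂_j ι`. -/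
def meanCurvatureVector (ι : S → M) (x : S) : TangentSpace (𝓡 3) (ι x) :=
  ((mfderiv (𝓡 2) (𝓡 3) ι x).range)ᗮ.starProjection
    (∑ i, ∑ j, (firstFund ι x)⁻¹ i j • covDeriv ι x i j)

/-- `ψ` is an injectively immersed smooth parametrized patch, with open domain `U`, lying in
`V`. -/
structure IsPatch (V : Set M) (ψ : E2 → M) (U : Set E2) : Prop where
  isOpen : IsOpen U
  contMDiffOn : ContMDiffOn (𝓡 2) (𝓡 3) ∞ ψ U
  injOn : InjOn ψ U
  immersion : ∀ u ∈ U, Function.Injective (mfderiv (𝓡 2) (𝓡 3) ψ u)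
  mapsTo : MapsTo ψ U V

/-- `V` is a smooth embedded surface (without boundary, not necessarily closed as a subset): near
each of its points it is a patch that is a homeomorphism onto its image. -/
def IsSurface (V : Set M) : Prop :=
  ∀ p ∈ V, ∃ (W : Set M) (U : Set E2) (ψ : E2 → M), IsOpen W ∧ p ∈ W ∧
    IsPatch V ψ U ∧ ψ '' U = V ∩ W ∧ IsEmbedding (U.domRestrict ψ)

/-- A finite family of measurable pieces of patches of `V` with disjoint images. -/
def IsPacking (V : Set M) {n : ℕ} (ψ : Fin n → E2 → M) (U K : Fin n → Set E2) : Prop :=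
  (∀ i, IsPatch V (ψ i) (U i) ∧ K i ⊆ U i ∧ MeasurableSet (K i)) ∧
    Pairwise fun i j ↦ Disjoint (ψ i '' K i) (ψ j '' K j)

/-- The area `|V|` of a surface `V`: the supremum of the total areas
`∑ ∫_K √det ⟨∂_i ψ, ∂_j ψ⟩` of finite families of disjoint parametrized pieces of `V`. -/
def area (V : Set M) : ENNReal :=
  ⨆ (n : ℕ) (ψ : Fin n → E2 → M) (U : Fin n → Set E2) (K : Fin n → Set E2)
    (_ : IsPacking V ψ U K),
    ∑ i, ∫⁻ u in K i, ENNReal.ofReal (Real.sqrt (firstFund (ψ i) u).det)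

/-- The half `0 < s < 1` of a foliation by the level sets `Σ_s = F(S² × {s})` of `f` is contracting:
the mean curvature vector of `Σ_s` points towards `Σ_0`, that is, `⟨∇f, H(Σ_s)⟩ < 0`. -/
def IsContractingHalf (F : S2 × ℝ → M) (f : M → ℝ) : Prop :=
  ∀ s ∈ Ioo (0 : ℝ) 1, ∀ x : S2,
    inner ℝ (gradient f (F (x, s))) (meanCurvatureVector (fun x' ↦ F (x', s)) x) < 0

end Geometry

section Foliation

variable {M : Type*} [TopologicalSpace M] [ChartedSpace E3 M]

/-- `F` parametrizes a smooth foliation `Σ_s = F(S² × {s})`, `-1 < s < 1`, by 2-spheres of an open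
set of `M`: it is an injective local diffeomorphism on `S² × (-1, 1)`. -/
structure IsSphereFoliation (F : S2 × ℝ → M) : Prop where
  contMDiffOn : ContMDiffOn ((𝓡 2).prod 𝓘(ℝ, ℝ)) (𝓡 3) ∞ F (univ ×ˢ Ioo (-1) 1)
  injOn : InjOn F (univ ×ˢ Ioo (-1) 1)
  immersion : ∀ q ∈ (univ ×ˢ Ioo (-1) 1 : Set (S2 × ℝ)),
    Function.Injective (mfderiv ((𝓡 2).prod 𝓘(ℝ, ℝ)) (𝓡 3) F q)

/-- The leaf `Σ_s`. -/
def leaf (F : S2 × ℝ → M) (s : ℝ) : Set M := range fun x ↦ F (x, s)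

/-- `Ω_r = φ(Σ × [0, r))`. -/
def Omega (Sig : Set M) (φ : M → ℝ → M) (r : ℝ) : Set M :=
  {p | ∃ x ∈ Sig, ∃ s ∈ Ico 0 r, φ x s = p}

/-- `P` restricts to a smooth embedding of `A` (a subset with unique tangent spaces, such as a
3-dimensional submanifold with boundary) into `M`. -/
structure IsSmoothEmbeddingOn (P : M → M) (A : Set M) : Prop where
  contMDiffOn : ContMDiffOn (𝓡 3) (𝓡 3) ∞ P A
  immersion : ∀ p ∈ A, Function.Injective (mfderivWithin (𝓡 3) (𝓡 3) P A p)
  isEmbedding : IsEmbedding (A.domRestrict P)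

end Foliation

end Squeezing

end

open scoped Bundle

-- Use coordinates y = e^s x on an annulus in ℝ³, with Θ(e^s x) = φ(x, s). There f becomes log ‖y‖,
-- the radial vector y is mapped to X, and P_t becomes `squeeze t`, which multiplies log ‖y‖ by 1 -
-- t. Since X is normal to the leaves, the pulled-back metric H = `pullMetric Θ` makes y orthogonal
-- to the Euclidean complement of y.
--
-- Let a tangent plane at y be spanned by v + αy and w + βy with v, w orthogonal to y, and put s =
-- log ‖y‖, u = βv - αw. After squeezing, its squared area element is gram G_t(v, w) + (1 - t)²
-- G_t(y, y) G_t(u, u), where G_t is the rescaled metric at the squeezed point (`squeezedForm`). Its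
-- derivative in t is -s R_t, where R_t is the equally rescaled Lie derivative of H along the radial
-- field (`radialForm`).
--
-- The first term is the part coming from the leaf directions. Its derivative is -s times the mixed
-- discriminant of R_t and G_t at (v, w). By the first variation formula, mixed discriminant over
-- Gram determinant is -2⟨X, mean curvature vector⟩ of the leaf, so the contracting hypothesis makes
-- it positive for s > 0 (`mixedDisc_radialForm_pos`). In the second term the factor (1 - t)²
-- produces a definite decrease, and the variation of the metric perturbs it only by a multiple of
-- s, which is absorbed when r₀ is small (`squeezed_gram_bounds`). So the area element never
-- increases. It strictly decreases when s > 0: if v, w are independent the first term does it,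
-- otherwise u ≠ 0 and the second does (`exists_deriv_gram_squeeze`).
--
-- A countable atlas writes the area of the squeezed surface as an integral over a measure space
-- independent of t (`area_squeeze_eq_tsum`). The logarithmic derivative of the area element is
-- bounded as long as t stays away from 1, so dominated convergence applies
-- (`hasDerivWithinAt_area_squeeze`). If V is not contained in Σ, then s > 0 on a nonempty open
-- piece of V and the derivative is negative; if V ⊂ Σ, every P_t fixes V pointwise.
--
-- The coordinates themselves require a flow defined for all |s| < 1 but smooth only near Σ.
-- Smoothness near time zero comes from the implicit function theorem in a Banach space of curves
-- (`exists_flow`), and compactness of the sphere makes the time uniform (`exists_flow_foliation`).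

universe u

namespace Squeezing

open Bundle

section

/-! ### Smoothness of composition operators on spaces of continuous maps -/

section Nemytskii

variable {K : Type*} [TopologicalSpace K] [CompactSpace K]

set_option synthInstance.maxHeartbeats 400000 in
/-- Pointwise application of a continuous family of linear maps, as a bilinear map. -/
noncomputable def pointwiseApply (K : Type*) [TopologicalSpace K] [CompactSpace K]
    (E F : Type*) [NormedAddCommGroup E] [NormedSpace ℝ E] [NormedAddCommGroup F]
    [NormedSpace ℝ F] : C(K, E →L[ℝ] F) →L[ℝ] C(K, E) →L[ℝ] C(K, F) :=
  LinearMap.mkContinuous₂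
    (LinearMap.mk₂ ℝ (fun (A : C(K, E →L[ℝ] F)) (g : C(K, E)) ↦
        (⟨fun k ↦ A k (g k), by fun_prop⟩ : C(K, F)))
      (by intros; ext; simp) (by intros; ext; simp) (by intros; ext; simp)
      (by intros; ext; simp)) 1
    (by
      intro A g
      rw [ContinuousMap.norm_le _ (by positivity)]
      intro k
      calc ‖A k (g k)‖ ≤ ‖A k‖ * ‖g k‖ := (A k).le_opNorm _
        _ ≤ 1 * ‖A‖ * ‖g‖ := by
          rw [one_mul]
          gcongr
          · exact A.norm_coe_le_norm k
          · exact g.norm_coe_le_norm k)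

set_option synthInstance.maxHeartbeats 400000 in
-- The range of `g` is compact, so `f'` is uniformly continuous around it; the mean value inequality
-- then bounds the remainder by ε‖h‖ at all points of `K` at once.
lemma hasFDerivAt_comp_continuousMap {E F : Type*} [NormedAddCommGroup E] [NormedSpace ℝ E]
    [NormedAddCommGroup F] [NormedSpace ℝ F] (f : C(E, F)) (f' : C(E, E →L[ℝ] F))
    (hf : ∀ x, HasFDerivAt f (f' x) x) (g : C(K, E)) :
    HasFDerivAt (fun g : C(K, E) ↦ f.comp g) (pointwiseApply K E F (f'.comp g)) g := by
  rw [hasFDerivAt_iff_isLittleO_nhds_zero, Asymptotics.isLittleO_iff]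
  intro ε hε
  have huc := (isCompact_range g.continuous).uniformContinuousAt_of_continuousAt f'
    (fun x _ ↦ f'.continuous.continuousAt) (Metric.dist_mem_uniformity hε)
  obtain ⟨δ, hδ, hd⟩ := Metric.mem_uniformity_dist.1 huc
  filter_upwards [Metric.ball_mem_nhds (0 : C(K, E)) hδ] with h hh
  rw [ContinuousMap.norm_le _ (by positivity)]
  intro k
  have hk : ‖h k‖ < δ := (h.norm_coe_le_norm k).trans_lt (by simpa using hh)
  have key := (convex_ball (g k) δ).norm_image_sub_le_of_norm_hasFDerivWithin_le'
    (f := f) (f' := fun y ↦ f' y) (φ := f' (g k)) (C := ε) (x := g k) (y := g k + h k)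
    (fun y _ ↦ (hf y).hasFDerivWithinAt)
    (fun y hy ↦ by
      have : dist (f' (g k)) (f' y) < ε :=
        hd (by simpa [dist_comm] using hy) (mem_range_self k)
      rw [← dist_eq_norm, dist_comm]; exact this.le)
    (mem_ball_self hδ) (by simpa [dist_eq_norm] using hk)
  simp only [add_sub_cancel_left] at key
  calc _ = ‖f (g k + h k) - f (g k) - (f' (g k)) (h k)‖ := rfl
    _ ≤ ε * ‖h k‖ := key
    _ ≤ ε * ‖h‖ := by gcongr; exact h.norm_coe_le_norm k

set_option synthInstance.maxHeartbeats 400000 in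
lemma contDiff_pointwiseApply {E F : Type*} [NormedAddCommGroup E] [NormedSpace ℝ E]
    [NormedAddCommGroup F] [NormedSpace ℝ F] (n : ℕ) : ContDiff ℝ n (pointwiseApply K E F) :=
  ContinuousLinearMap.contDiff (𝕜 := ℝ) (n := n) (E := C(K, E →L[ℝ] F))
    (F := C(K, E) →L[ℝ] C(K, F)) (pointwiseApply K E F)

set_option synthInstance.maxHeartbeats 400000 in
-- The derivative is again a composition operator, for `fderiv ℝ f`, followed by the bounded
-- bilinear `pointwiseApply`. The induction therefore replaces `F` by `E →L[ℝ] F`, which is why `F`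
-- is quantified inside it and shares the universe of `E`.
lemma contDiff_comp_continuousMap_nat {E : Type u} [NormedAddCommGroup E] [NormedSpace ℝ E]
    (n : ℕ) : ∀ {F : Type u} [NormedAddCommGroup F] [NormedSpace ℝ F] (f : C(E, F)),
    ContDiff ℝ n f → ContDiff ℝ n (fun g : C(K, E) ↦ f.comp g) := by
  induction n with
  | zero =>
    intro F _ _ f _
    exact contDiff_zero.2 (ContinuousMap.continuous_postcomp f)
  | succ n ih =>
    intro F _ _ f hf
    have hf' : ContDiff ℝ ((n : WithTop ℕ∞) + 1) f := by exact_mod_cast hf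
    rw [contDiff_succ_iff_fderiv] at hf'
    let f' : C(E, E →L[ℝ] F) := ⟨fderiv ℝ f, hf'.2.2.continuous⟩
    have hd := hasFDerivAt_comp_continuousMap (K := K) f f'
      (fun x ↦ (hf'.1 x).hasFDerivAt)
    have : ContDiff ℝ ((n : WithTop ℕ∞) + 1) (fun g : C(K, E) ↦ f.comp g) := by
      rw [contDiff_succ_iff_hasFDerivAt]
      exact ⟨fun g ↦ pointwiseApply K E F (f'.comp g), (contDiff_pointwiseApply n).comp (ih f' hf'.2.2), hd⟩
    exact_mod_cast this

lemma contDiff_comp_continuousMap {E F : Type u} [NormedAddCommGroup E] [NormedSpace ℝ E]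
    [NormedAddCommGroup F] [NormedSpace ℝ F] (f : C(E, F)) (hf : ContDiff ℝ ∞ f) :
    ContDiff ℝ ∞ (fun g : C(K, E) ↦ f.comp g) :=
  contDiff_infty.2 fun n ↦ contDiff_comp_continuousMap_nat n f (contDiff_infty.1 hf n)

end Nemytskii

/-! ### Smooth dependence of a flow on the initial point, near time zero -/

section Flow

variable {E : Type*} [NormedAddCommGroup E] [NormedSpace ℝ E]

/-- The operator `γ ↦ ∫₀ᵗ γ`. -/
noncomputable def volterra (E : Type*) [NormedAddCommGroup E] [NormedSpace ℝ E] :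
    C(Icc (0 : ℝ) 1, E) →L[ℝ] C(Icc (0 : ℝ) 1, E) :=
  LinearMap.mkContinuous
    { toFun := fun g ↦ ⟨fun t ↦ ∫ s in (0 : ℝ)..t, IccExtend zero_le_one g s,
        ((intervalIntegral.continuous_primitive (fun a b ↦
          (g.continuous.Icc_extend' (h := zero_le_one)).intervalIntegrable a b) 0).comp
          continuous_subtype_val)⟩
      map_add' := by
        intro g h
        ext t
        simp only [ContinuousMap.coe_mk, ContinuousMap.add_apply]
        rw [← intervalIntegral.integral_add
          ((g.continuous.Icc_extend' (h := zero_le_one)).intervalIntegrable _ _)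
          ((h.continuous.Icc_extend' (h := zero_le_one)).intervalIntegrable _ _)]
        rfl
      map_smul' := by
        intro c g
        ext t
        simp only [ContinuousMap.coe_mk, ContinuousMap.smul_apply, RingHom.id_apply]
        rw [← intervalIntegral.integral_smul]
        rfl } 1
    (by
      intro g
      rw [ContinuousMap.norm_le _ (by positivity)]
      intro t
      refine (intervalIntegral.norm_integral_le_of_norm_le_const (C := ‖g‖)
        (fun s _ ↦ g.norm_coe_le_norm _)).trans ?_
      rw [sub_zero, abs_of_nonneg t.2.1, one_mul]
      exact mul_le_of_le_one_right (norm_nonneg _) t.2.2)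

/-- A bounded Lipschitz smooth vector field has a flow that is smooth near time zero. -/
theorem exists_flow {E : Type u} [NormedAddCommGroup E] [NormedSpace ℝ E] [CompleteSpace E]
    {f : E → E} {L K : NNReal} (hf : ContDiff ℝ ∞ f) (hL : ∀ x, ‖f x‖ ≤ L)
    (hK : LipschitzWith K f) :
    ∃ θ : E → ℝ → E, (∀ x, θ x 0 = x) ∧
      (∀ x, ∀ t ∈ Ioo (-2 : ℝ) 2, HasDerivAt (θ x) (f (θ x t)) t) ∧
      ∀ x, ∀ᶠ p in 𝓝 (x, (0 : ℝ)), ContDiffAt ℝ ∞ (fun p : E × ℝ ↦ θ p.1 p.2) p := by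
  have hex : ∀ x : E, ∃ α : ℝ → E, α 0 = x ∧
      ∀ t ∈ Ioo (-2 : ℝ) 2, HasDerivAt α (f (α t)) t := by
    intro x
    -- A curve of speed at most L stays within 2L during time 2. Time 2 is needed later, for
    -- differences of two times in (-1, 1).
    have hpl : IsPicardLindelof (fun _ : ℝ ↦ f) (tmin := -2) (tmax := 2)
        ⟨0, by norm_num, by norm_num⟩ x (2 * L) 0 L K :=
      { lipschitzOnWith := fun t _ ↦ hK.lipschitzOnWith
        continuousOn := fun x _ ↦ continuousOn_const
        norm_le := fun t _ x _ ↦ hL x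
        mul_max_le := by simp [mul_comm] }
    obtain ⟨α, h0, h1⟩ := hpl.exists_eq_forall_mem_Icc_hasDerivWithinAt₀
    exact ⟨α, h0, fun t ht ↦ (h1 t (Ioo_subset_Icc_self ht)).hasDerivAt
      (Icc_mem_nhds ht.1 ht.2)⟩
  choose θ h0 hθ using hex
  refine ⟨θ, h0, hθ, fun x₀ ↦ ?_⟩
  let I := Icc (0 : ℝ) 1
  let fc : C(E, E) := ⟨f, hf.continuous⟩
  let c : E →L[ℝ] C(I, E) := ContinuousLinearMap.const ℝ I
  -- The rescaled flow line σ ↦ θ x (tσ), 0 ≤ σ ≤ 1, is a zero γ of T((x, t), γ) = γ - x - t∫f(γ).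
  -- Rescaling puts all times t on one Banach space of curves.
  let T : (E × ℝ) × C(I, E) → C(I, E) := fun p ↦
    p.2 - c p.1.1 - p.1.2 • volterra E (fc.comp p.2)
  have hT : ContDiff ℝ ∞ T := by
    refine (contDiff_snd.sub (c.contDiff.comp (contDiff_fst.comp contDiff_fst))).sub
      ((contDiff_snd.comp contDiff_fst).smul ((volterra E).contDiff.comp
        ((contDiff_comp_continuousMap fc hf).comp contDiff_snd)))
  let u : (E × ℝ) × C(I, E) := ((x₀, 0), c x₀)
  have hTu : T u = 0 := by simp [T, u]
  -- At t = 0 the integral term vanishes, so the partial derivative in the curve is the identity.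
  have hinv : (fderiv ℝ T u ∘L .inr ℝ (E × ℝ) C(I, E)).IsInvertible := by
    have h1 : HasFDerivAt (fun g ↦ T ((x₀, 0), g))
        (fderiv ℝ T u ∘L .inr ℝ (E × ℝ) C(I, E)) (c x₀) :=
      ((hT.differentiable (by simp)).differentiableAt.hasFDerivAt).comp (c x₀)
        (hasFDerivAt_prodMk_right (x₀, (0 : ℝ)) (c x₀))
    have h2 : HasFDerivAt (fun g ↦ T ((x₀, 0), g)) (ContinuousLinearMap.id ℝ C(I, E)) (c x₀) := by
      simpa [T] using (hasFDerivAt_id (𝕜 := ℝ) (c x₀)).sub_const (c x₀)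
    rw [h1.unique h2]
    exact ⟨ContinuousLinearEquiv.refl ℝ _, rfl⟩
  have hTa : ContDiffAt ℝ ∞ T u := hT.contDiffAt
  set ψ := hTa.implicitFunction (by simp) hinv
  have hψ : ContDiffAt ℝ ∞ ψ (x₀, 0) := hTa.contDiffAt_implicitFunction (by simp) hinv
  have hev : ∀ᶠ p in 𝓝 (x₀, (0 : ℝ)), T (p, ψ p) = T u :=
    hTa.eventually_apply_implicitFunction (by simp) hinv
  -- `ContDiffAt` of order ∞ at one point only gives, for each finite order, some neighbourhood. So
  -- the implicit function theorem is applied again at every nearby p, where invertibility persists,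
  -- and local uniqueness identifies the new implicit function with ψ.
  have hψ' : ∀ᶠ p in 𝓝 (x₀, (0 : ℝ)), ContDiffAt ℝ ∞ ψ p := by
    have hψ0 : ψ (x₀, 0) = c x₀ := hTa.implicitFunction_apply_self (by simp) hinv
    have hψ1 : ∀ᶠ p in 𝓝 (x₀, (0 : ℝ)), ContDiffAt ℝ 1 ψ p :=
      (hψ.of_le (by exact_mod_cast le_top)).eventually (by simp)
    have hinv' : ∀ᶠ p in 𝓝 (x₀, (0 : ℝ)),
        (fderiv ℝ T (p, ψ p) ∘L .inr ℝ (E × ℝ) C(I, E)).IsInvertible := by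
      have h1 : ContinuousAt (fun p ↦ fderiv ℝ T (p, ψ p) ∘L .inr ℝ (E × ℝ) C(I, E))
          (x₀, (0 : ℝ)) := by
        refine ContinuousAt.clm_comp ?_ continuousAt_const
        exact (hT.continuous_fderiv (by simp)).continuousAt.comp
          (continuousAt_id.prodMk hψ.continuousAt)
      obtain ⟨e, he⟩ := hinv
      refine h1.eventually_mem (s := {A : C(I, E) →L[ℝ] C(I, E) | A.IsInvertible}) ?_
      rw [hψ0, show fderiv ℝ T ((x₀, 0), c x₀) ∘L .inr ℝ (E × ℝ) C(I, E) = e from he.symm]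
      exact e.nhds
    filter_upwards [hev.eventually_nhds, hψ1, hinv'] with p hp1 hp2 hp3
    have hTp : ContDiffAt ℝ ∞ T (p, ψ p) := hT.contDiffAt
    refine (hTp.contDiffAt_implicitFunction (by simp) hp3).congr_of_eventuallyEq ?_
    have h1 := (continuousAt_id.prodMk hp2.continuousAt).eventually
      (hTp.eventually_apply_eq_iff_implicitFunction (by simp) hp3)
    filter_upwards [h1, hp1] with q hq hq'
    exact (hq.1 (hq'.trans hp1.self_of_nhds.symm)).symm
  clear_value ψ
  let ev : C(I, E) →L[ℝ] E := ContinuousMap.evalCLM ℝ ⟨1, by norm_num, le_rfl⟩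
  suffices heq : ∀ᶠ p in 𝓝 (x₀, (0 : ℝ)), θ p.1 p.2 = ev (ψ p) by
    filter_upwards [heq.eventually_nhds, hψ'] with p hp hp'
    exact (ev.contDiff.contDiffAt.comp p hp').congr_of_eventuallyEq hp
  have hsmall : ∀ᶠ p : E × ℝ in 𝓝 (x₀, 0), p.2 ∈ Ioo (-2 : ℝ) 2 :=
    continuous_snd.continuousAt.eventually_mem (Ioo_mem_nhds (by norm_num) (by norm_num))
  filter_upwards [hev, hsmall] with p hp hp2
  have hγ : ∀ t : I, ψ p t = p.1 + p.2 • ∫ s in (0 : ℝ)..t,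
      IccExtend zero_le_one (fc.comp (ψ p)) s := by
    intro t
    have := congrArg (fun g : C(I, E) ↦ g t) (hp.trans hTu)
    simp only [T, ContinuousMap.sub_apply, ContinuousMap.zero_apply, sub_sub, sub_eq_zero] at this
    exact this.trans rfl
  let α : ℝ → E := IccExtend zero_le_one (ψ p)
  have hcont : Continuous (IccExtend zero_le_one (fc.comp (ψ p)) : ℝ → E) :=
    (fc.comp (ψ p)).continuous.Icc_extend'
  have hα : ∀ t ∈ Icc (0 : ℝ) 1, α t = p.1 + p.2 • ∫ s in (0 : ℝ)..t,
      IccExtend zero_le_one (fc.comp (ψ p)) s := by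
    intro t ht
    rw [← hγ ⟨t, ht⟩]
    exact IccExtend_of_mem _ _ ht
  have hα' : ∀ t ∈ Icc (0 : ℝ) 1, HasDerivWithinAt α (p.2 • f (α t)) (Icc 0 1) t := by
    intro t ht
    have h1 : HasDerivAt (fun t ↦ p.1 + p.2 • ∫ s in (0 : ℝ)..t,
        IccExtend zero_le_one (fc.comp (ψ p)) s) (p.2 • f (α t)) t := by
      have := (intervalIntegral.integral_hasDerivAt_right (hcont.intervalIntegrable 0 t)
        hcont.stronglyMeasurable.stronglyMeasurableAtFilter hcont.continuousAt)
      exact (this.const_smul p.2).const_add p.1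
    exact h1.hasDerivWithinAt.congr hα (hα t ht)
  have hβ' : ∀ t ∈ Icc (0 : ℝ) 1, HasDerivAt (fun t ↦ θ p.1 (p.2 * t))
      (p.2 • f (θ p.1 (p.2 * t))) t := by
    intro t ht
    have hmem : p.2 * t ∈ Ioo (-2 : ℝ) 2 := by
      rw [mem_Ioo, ← abs_lt] at hp2 ⊢
      rw [abs_mul, abs_of_nonneg ht.1]
      exact (mul_le_of_le_one_right (abs_nonneg _) ht.2).trans_lt hp2
    have h2 : HasDerivAt (fun t ↦ p.2 * t) p.2 t := by
      simpa using (hasDerivAt_id t).const_mul p.2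
    exact (hθ p.1 _ hmem).scomp t h2
  -- The curve given by ψ and the rescaled flow line solve the same Lipschitz equation from the same
  -- point; comparing them at σ = 1 gives θ x t.
  have huniq := ODE_solution_unique (v := fun _ x ↦ p.2 • f x) (K := ‖p.2‖₊ * K) (a := 0) (b := 1)
    (f := α) (g := fun t ↦ θ p.1 (p.2 * t))
    (fun _ ↦ (lipschitzWith_smul p.2).comp hK)
    (fun t ht ↦ (hα' t ht).continuousWithinAt)
    (fun t ht ↦ (hα' t (Ico_subset_Icc_self ht)).mono_of_mem_nhdsWithin
      (Icc_mem_nhdsGE_of_mem ht))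
    (fun t ht ↦ (hβ' t ht).continuousAt.continuousWithinAt)
    (fun t ht ↦ (hβ' t (Ico_subset_Icc_self ht)).hasDerivWithinAt)
    (by simp [hα 0 (by simp), h0])
  have := huniq (right_mem_Icc.2 zero_le_one)
  simp only [mul_one] at this
  rw [← this]
  exact IccExtend_of_mem _ _ _

end Flow

end

/-! ### Radial flows on an annulus -/

section

/-- The annulus `e^{-δ} < ‖y‖ < e^δ`. -/
def annulus (E : Type*) [NormedAddCommGroup E] (δ : ℝ) : Set E :=
  {y | Real.exp (-δ) < ‖y‖ ∧ ‖y‖ < Real.exp δ}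

section Annulus

variable {E : Type*} [NormedAddCommGroup E] {δ δ' : ℝ} {y : E}

lemma isOpen_annulus (δ : ℝ) : IsOpen (annulus E δ) :=
  (isOpen_lt continuous_const continuous_norm).inter (isOpen_lt continuous_norm continuous_const)

lemma annulus_mono (h : δ ≤ δ') : annulus E δ ⊆ annulus E δ' := fun _ hy ↦
  ⟨(Real.exp_le_exp.2 (neg_le_neg h)).trans_lt hy.1, hy.2.trans_le (Real.exp_le_exp.2 h)⟩

lemma norm_pos_of_mem_annulus (hy : y ∈ annulus E δ) : 0 < ‖y‖ := (Real.exp_pos _).trans hy.1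

lemma ne_zero_of_mem_annulus (hy : y ∈ annulus E δ) : y ≠ 0 :=
  norm_pos_iff.1 (norm_pos_of_mem_annulus hy)

lemma mem_annulus_iff : y ∈ annulus E δ ↔ y ≠ 0 ∧ Real.log ‖y‖ ∈ Ioo (-δ) δ := by
  constructor
  · intro hy
    have := norm_pos_of_mem_annulus hy
    exact ⟨ne_zero_of_mem_annulus hy, (Real.lt_log_iff_exp_lt this).2 hy.1,
      (Real.log_lt_iff_lt_exp this).2 hy.2⟩
  · rintro ⟨h0, h1, h2⟩
    have := norm_pos_iff.2 h0
    exact ⟨(Real.lt_log_iff_exp_lt this).1 h1, (Real.log_lt_iff_lt_exp this).1 h2⟩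

end Annulus

section AnnulusFlow

variable {E : Type u} [NormedAddCommGroup E] [InnerProductSpace ℝ E]

/-- The derivative of `log ‖γ‖` along a curve. -/
lemma hasDerivAt_log_norm {γ : ℝ → E} {v : E} {s : ℝ} (h : HasDerivAt γ v s) (h0 : γ s ≠ 0) :
    HasDerivAt (fun s ↦ Real.log ‖γ s‖) (inner ℝ (γ s) v / ‖γ s‖ ^ 2) s := by
  have h1 : HasDerivAt (fun s ↦ ‖γ s‖ ^ 2) (2 * inner ℝ (γ s) v) s := h.norm_sq
  have h2 := (h1.log (by simpa using h0)).const_mul (1 / 2 : ℝ)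
  have h3 : (fun s ↦ 1 / 2 * Real.log (‖γ s‖ ^ 2)) = fun s ↦ Real.log ‖γ s‖ := by
    ext s
    rw [Real.log_pow]; push_cast; ring
  rw [h3] at h2
  exact h2.congr_deriv (by ring)

/-- An integral curve in the annulus, parametrized by the logarithm of the radius, on the time
interval `(-T, T)`. -/
def IsRadialCurve (Y : E → E) (γ : ℝ → E) (T : ℝ) : Prop :=
  ∀ s ∈ Ioo (-T) T, HasDerivAt γ (Y (γ s)) s ∧ γ s ≠ 0 ∧ Real.log ‖γ s‖ = s

lemma IsRadialCurve.mem_annulus {Y : E → E} {γ : ℝ → E} {T s : ℝ} (h : IsRadialCurve Y γ T)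
    (hs : s ∈ Ioo (-T) T) : γ s ∈ annulus E T :=
  mem_annulus_iff.2 ⟨(h s hs).2.1, by rwa [(h s hs).2.2]⟩

lemma IsRadialCurve.mono {Y : E → E} {γ : ℝ → E} {T T' : ℝ} (h : IsRadialCurve Y γ T)
    (hT : T' ≤ T) : IsRadialCurve Y γ T' :=
  fun s hs ↦ h s ⟨by linarith [hs.1], by linarith [hs.2]⟩

variable [FiniteDimensional ℝ E]

/-- A vector field on an annulus with unit logarithmic radial speed can be cut off to a bounded
Lipschitz smooth field. -/
lemma exists_cutoff {Y : E → E} (hY : ContDiffOn ℝ ∞ Y (annulus E 1))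
    {T : ℝ} (hT0 : 0 < T) (hT : T < 1) :
    ∃ (Z : E → E) (β : ℝ → ℝ) (L K K' : NNReal), ContDiff ℝ ∞ Z ∧ (∀ y, ‖Z y‖ ≤ L) ∧
      LipschitzWith K Z ∧ LipschitzWith K' β ∧ (∀ s ∈ Ioo (-T) T, β s = 1) ∧ Z 0 = 0 ∧
      (∀ y ∈ annulus E 1, Z y = β (Real.log ‖y‖) • Y y) ∧
      (∀ y, y ∉ annulus E 1 → y ≠ 0 → Z y = 0 ∧ β (Real.log ‖y‖) = 0) := by
  classical
  -- Equal to 1 for |s| ≤ T and supported in |s| ≤ (1 + T)/2 < 1, so the cut-off field has compact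
  -- support inside the annulus of parameter 1.
  let b : ContDiffBump (0 : ℝ) := ⟨T, (1 + T) / 2, hT0, by linarith⟩
  let ρ := (1 + T) / 2
  have hρ : ρ < 1 := by simp only [ρ]; linarith
  have hb0 : ∀ s, s ∉ Ioo (-ρ) ρ → b s = 0 := by
    intro s hs
    refine b.zero_of_le_dist ?_
    rw [Real.dist_eq, sub_zero]
    by_contra h
    exact hs (abs_lt.1 (not_le.1 h))
  let Z : E → E := (annulus E 1).indicator fun y ↦ b (Real.log ‖y‖) • Y y
  have hZ1 : ∀ y ∈ annulus E 1, Z y = b (Real.log ‖y‖) • Y y := fun y hy ↦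
    indicator_of_mem hy _
  have hZ0 : ∀ y, y ∉ annulus E ρ → Z y = 0 := by
    intro y hy
    by_cases h1 : y ∈ annulus E 1
    · have : Real.log ‖y‖ ∉ Ioo (-ρ) ρ := fun h ↦
        hy (mem_annulus_iff.2 ⟨ne_zero_of_mem_annulus h1, h⟩)
      rw [hZ1 y h1, hb0 _ this, zero_smul]
    · exact indicator_of_notMem h1 _
  let C : Set E := {y | Real.exp (-ρ) ≤ ‖y‖ ∧ ‖y‖ ≤ Real.exp ρ}
  have hCclosed : IsClosed C := (isClosed_le continuous_const continuous_norm).inter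
    (isClosed_le continuous_norm continuous_const)
  have hCcompact : IsCompact C := (isCompact_closedBall (0 : E) (Real.exp ρ)).of_isClosed_subset
    hCclosed (fun y hy ↦ by simpa using hy.2)
  have hZC : ∀ y, y ∉ C → Z y = 0 := fun y hy ↦ hZ0 y fun h ↦ hy ⟨h.1.le, h.2.le⟩
  have hC1 : C ⊆ annulus E 1 := fun y hy ↦
    ⟨(Real.exp_lt_exp.2 (by linarith)).trans_le hy.1, hy.2.trans_lt (Real.exp_lt_exp.2 hρ)⟩
  have hsm : ContDiff ℝ ∞ Z := by
    rw [contDiff_iff_contDiffAt]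
    intro y
    by_cases hy : y ∈ C
    · have hy1 := hC1 hy
      have hn := (isOpen_annulus (E := E) 1).mem_nhds hy1
      refine ContDiffAt.congr_of_eventuallyEq ?_ (Filter.eventually_of_mem hn hZ1)
      refine ContDiffAt.smul ?_ (hY.contDiffAt hn)
      refine (b.contDiff (n := ⊤)).contDiffAt.comp y (ContDiffAt.log ?_ ?_)
      · exact contDiffAt_norm ℝ (ne_zero_of_mem_annulus hy1)
      · exact (norm_pos_of_mem_annulus hy1).ne'
    · refine (contDiffAt_const (c := (0 : E))).congr_of_eventuallyEq ?_
      exact Filter.eventually_of_mem (hCclosed.isOpen_compl.mem_nhds hy) hZC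
  have hcs : HasCompactSupport Z := HasCompactSupport.intro hCcompact hZC
  obtain ⟨L, hL⟩ := hcs.exists_bound_of_continuous hsm.continuous
  obtain ⟨K, hK⟩ := hsm.lipschitzWith_of_hasCompactSupport hcs (by simp)
  obtain ⟨K', hK'⟩ := (b.contDiff (n := ⊤)).lipschitzWith_of_hasCompactSupport
    b.hasCompactSupport (by simp)
  refine ⟨Z, b, L.toNNReal, K, K', hsm, fun y ↦ (hL y).trans (Real.le_coe_toNNReal L), hK, hK',
    ?_, ?_, hZ1, ?_⟩
  · intro s hs
    refine b.one_of_mem_closedBall ?_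
    rw [mem_closedBall, Real.dist_eq, sub_zero]
    exact (abs_lt.2 hs).le
  · exact hZ0 0 fun h ↦ ne_zero_of_mem_annulus h rfl
  · intro y hy h0
    refine ⟨indicator_of_notMem hy _, hb0 _ fun h ↦ hy ?_⟩
    exact annulus_mono hρ.le (mem_annulus_iff.2 ⟨h0, h⟩)

/-- While log ‖γ‖ stays in (-T, T) the cut-off is inactive, so both curves solve the equation of one
globally Lipschitz field. -/
lemma IsRadialCurve.eqOn {Y : E → E} (hY : ContDiffOn ℝ ∞ Y (annulus E 1)) {γ γ' : ℝ → E}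
    {T s₀ : ℝ} (hT : T < 1) (h : IsRadialCurve Y γ T) (h' : IsRadialCurve Y γ' T)
    (hs₀ : s₀ ∈ Ioo (-T) T) (heq : γ s₀ = γ' s₀) : EqOn γ γ' (Ioo (-T) T) := by
  have hT0 : 0 < T := by linarith [hs₀.1, hs₀.2]
  obtain ⟨Z, β, L, K, K', -, -, hK, -, hβ, -, hZ, -⟩ := exists_cutoff hY hT0 hT
  have key : ∀ {γ : ℝ → E}, IsRadialCurve Y γ T →
      ∀ s ∈ Ioo (-T) T, HasDerivAt γ (Z (γ s)) s ∧ γ s ∈ (univ : Set E) := by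
    intro γ h s hs
    refine ⟨?_, mem_univ _⟩
    rw [hZ _ (annulus_mono hT.le (h.mem_annulus hs)), (h s hs).2.2, hβ s hs, one_smul]
    exact (h s hs).1
  exact ODE_solution_unique_of_mem_Ioo (v := fun _ ↦ Z) (s := fun _ ↦ univ)
    (fun _ _ ↦ hK.lipschitzOnWith) hs₀ (key h) (key h') heq

/-- The flow, for logarithmic times less than `T`, of a vector field on the annulus with unit
logarithmic radial speed. -/
lemma exists_radial_flow {Y : E → E} (hY : ContDiffOn ℝ ∞ Y (annulus E 1))
    (hrad : ∀ y ∈ annulus E 1, inner ℝ y (Y y) = ‖y‖ ^ 2) {T : ℝ} (hT0 : 0 < T) (hT : T < 1) :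
    ∃ θ : E → ℝ → E, (∀ x, θ x 0 = x) ∧ (∀ x, ‖x‖ = 1 → IsRadialCurve Y (θ x) T) ∧
      (∀ z ∈ annulus E T, ∃ x, ‖x‖ = 1 ∧ θ x (Real.log ‖z‖) = z) ∧
      ∀ x, ∀ᶠ p in 𝓝 (x, (0 : ℝ)), ContDiffAt ℝ ∞ (fun p : E × ℝ ↦ θ p.1 p.2) p := by
  obtain ⟨Z, β, L, K, K', hZs, hL, hK, hK', hβ, hZ0, hZ, hZ'⟩ := exists_cutoff hY hT0 hT
  obtain ⟨θ, h0, hθ, hsm⟩ := exists_flow hZs hL hK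
  have huniq : ∀ {γ γ' : ℝ → E} {a b s₀ : ℝ}, s₀ ∈ Ioo a b →
      (∀ s ∈ Ioo a b, HasDerivAt γ (Z (γ s)) s) → (∀ s ∈ Ioo a b, HasDerivAt γ' (Z (γ' s)) s) →
      γ s₀ = γ' s₀ → EqOn γ γ' (Ioo a b) := fun hs h h' heq ↦
    ODE_solution_unique_of_mem_Ioo (v := fun _ ↦ Z) (s := fun _ ↦ univ)
      (fun _ _ ↦ hK.lipschitzOnWith) hs (fun s hs ↦ ⟨h s hs, mem_univ _⟩)
      (fun s hs ↦ ⟨h' s hs, mem_univ _⟩) heq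
  have hZrad : ∀ y, y ≠ 0 → inner ℝ y (Z y) / ‖y‖ ^ 2 = β (Real.log ‖y‖) := by
    intro y hy
    by_cases h1 : y ∈ annulus E 1
    · have : ‖y‖ ≠ 0 := by simpa using hy
      rw [hZ y h1, inner_smul_right, hrad y h1]
      field_simp
    · obtain ⟨h2, h3⟩ := hZ' y h1 hy
      rw [h2, h3]; simp
  -- The origin is an equilibrium of Z, so γ never reaches it. Then log ‖γ‖ solves σ' = β(σ); so
  -- does the identity, because β = 1 on (-T, T), and the two agree at s₀.
  have hcurve : ∀ {γ : ℝ → E} {s₀ : ℝ}, s₀ ∈ Ioo (-T) T → γ s₀ ≠ 0 → Real.log ‖γ s₀‖ = s₀ →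
      (∀ s ∈ Ioo (-T) T, HasDerivAt γ (Z (γ s)) s) → IsRadialCurve Y γ T := by
    intro γ s₀ hs₀ hne hlog hγ
    have hne' : ∀ s ∈ Ioo (-T) T, γ s ≠ 0 := by
      intro s hs h
      have := huniq (γ' := fun _ ↦ 0) hs hγ (fun s _ ↦ by simpa [hZ0] using hasDerivAt_const s (0 : E)) h
      exact hne (this hs₀)
    have hlog' : EqOn (fun s ↦ Real.log ‖γ s‖) id (Ioo (-T) T) := by
      refine ODE_solution_unique_of_mem_Ioo (v := fun _ ↦ β) (s := fun _ ↦ univ)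
        (fun _ _ ↦ hK'.lipschitzOnWith) hs₀ (fun s hs ↦ ⟨?_, mem_univ _⟩)
        (fun s hs ↦ ⟨?_, mem_univ _⟩) hlog
      · rw [← hZrad _ (hne' s hs)]
        exact hasDerivAt_log_norm (hγ s hs) (hne' s hs)
      · rw [id, hβ s hs]
        exact hasDerivAt_id s
    intro s hs
    refine ⟨?_, hne' s hs, hlog' hs⟩
    have hmem : γ s ∈ annulus E 1 := annulus_mono hT.le
      (mem_annulus_iff.2 ⟨hne' s hs, by rwa [show Real.log ‖γ s‖ = s from hlog' hs]⟩)
    have h2 := hγ s hs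
    rwa [hZ _ hmem, show Real.log ‖γ s‖ = s from hlog' hs, hβ s hs, one_smul] at h2
  have hT2 : ∀ s ∈ Ioo (-T) T, s ∈ Ioo (-2 : ℝ) 2 := fun s hs ↦
    ⟨by linarith [hs.1], by linarith [hs.2]⟩
  have h0T : (0 : ℝ) ∈ Ioo (-T) T := ⟨by linarith, hT0⟩
  refine ⟨θ, h0, fun x hx ↦ ?_, fun z hz ↦ ?_, hsm⟩
  · refine hcurve h0T ?_ ?_ fun s hs ↦ hθ x s (hT2 s hs)
    · rw [h0]; exact norm_pos_iff.1 (by rw [hx]; norm_num)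
    · rw [h0, hx, Real.log_one]
  -- Flow z backwards by its logarithmic radius s₀ to reach the unit sphere.
  · obtain ⟨hz0, hzT⟩ := mem_annulus_iff.1 hz
    set s₀ := Real.log ‖z‖ with hs₀
    have hγ : ∀ s ∈ Ioo (-T) T,
        HasDerivAt (fun s ↦ θ z (s - s₀)) (Z (θ z (s - s₀))) s := by
      intro s hs
      have := hθ z (s - s₀) ⟨by linarith [hs.1, hzT.2], by linarith [hs.2, hzT.1]⟩
      exact this.comp_sub_const s s₀
    have hr := hcurve (γ := fun s ↦ θ z (s - s₀)) hzT (by simpa [h0] using hz0)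
      (by simp [h0, hs₀]) hγ
    refine ⟨θ z (0 - s₀), ?_, ?_⟩
    · have h1 := hr 0 h0T
      rw [← Real.exp_log (norm_pos_iff.2 h1.2.1), h1.2.2, Real.exp_zero]
    · have := huniq (γ := θ (θ z (0 - s₀))) (γ' := fun s ↦ θ z (s - s₀)) h0T
        (fun s hs ↦ hθ _ s (hT2 s hs)) hγ (by simp [h0])
      simpa [h0] using this hzT

/-- The flow, starting at the unit sphere, of a vector field on the annulus with unit logarithmic
radial speed. -/
theorem exists_annulus_flow {Y : E → E} (hY : ContDiffOn ℝ ∞ Y (annulus E 1))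
    (hrad : ∀ y ∈ annulus E 1, inner ℝ y (Y y) = ‖y‖ ^ 2) :
    ∃ Γ : E → ℝ → E, (∀ x, Γ x 0 = x) ∧ (∀ x, ‖x‖ = 1 → IsRadialCurve Y (Γ x) 1) ∧
      (∀ z ∈ annulus E 1, ∃ x, ‖x‖ = 1 ∧ Γ x (Real.log ‖z‖) = z) ∧
      (∀ x x', ‖x‖ = 1 → ‖x'‖ = 1 → ∀ s ∈ Ioo (-1 : ℝ) 1, Γ x s = Γ x' s → x = x') ∧
      ∀ x, ∀ᶠ p in 𝓝 (x, (0 : ℝ)), ContDiffAt ℝ ∞ (fun p : E × ℝ ↦ Γ p.1 p.2) p := by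
  have hex : ∀ T ∈ Ioo (0 : ℝ) 1, _ := fun T hT ↦ exists_radial_flow hY hrad hT.1 hT.2
  choose! θ h0 hcurve hsurj hsm using hex
  -- Any cut-off level in (|s|, 1) would define the curves. Keeping it constant for |s| < 1/2 makes
  -- Γ equal to a single smooth flow near time zero.
  let τ : ℝ → ℝ := fun s ↦ if |s| < 1 / 2 then 1 / 2 else (1 + |s|) / 2
  have hτ : ∀ s ∈ Ioo (-1 : ℝ) 1, τ s ∈ Ioo (0 : ℝ) 1 ∧ |s| < τ s := by
    intro s hs
    have := abs_lt.2 hs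
    simp only [τ, mem_Ioo]
    have := abs_nonneg s
    split_ifs <;> refine ⟨⟨?_, ?_⟩, ?_⟩ <;> linarith
  let Γ : E → ℝ → E := fun x s ↦ θ (τ s) x s
  have hΓ : ∀ T ∈ Ioo (0 : ℝ) 1, ∀ x, ‖x‖ = 1 → ∀ s ∈ Ioo (-T) T, Γ x s = θ T x s := by
    intro T hT x hx s hs
    have hs1 : s ∈ Ioo (-1 : ℝ) 1 := ⟨by linarith [hs.1, hT.2], by linarith [hs.2, hT.2]⟩
    obtain ⟨h1, h2⟩ := hτ s hs1
    set T' := min T (τ s)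
    have hT' : T' ∈ Ioo (0 : ℝ) 1 := ⟨lt_min hT.1 h1.1, (min_le_left _ _).trans_lt hT.2⟩
    refine IsRadialCurve.eqOn hY hT'.2 ((hcurve _ h1 x hx).mono (min_le_right _ _))
      ((hcurve _ hT x hx).mono (min_le_left _ _)) (s₀ := 0) ⟨by linarith [hT'.1], hT'.1⟩ ?_ ?_
    · rw [h0 _ h1, h0 _ hT]
    · rw [mem_Ioo, ← abs_lt] at hs ⊢
      exact lt_min hs h2
  have hΓcurve : ∀ x, ‖x‖ = 1 → IsRadialCurve Y (Γ x) 1 := by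
    intro x hx s hs
    obtain ⟨h1, h2⟩ := hτ s hs
    have hs' : s ∈ Ioo (-τ s) (τ s) := abs_lt.1 h2
    obtain ⟨h3, h4, h5⟩ := hcurve _ h1 x hx s hs'
    refine ⟨?_, h4, h5⟩
    exact h3.congr_of_eventuallyEq (Filter.eventually_of_mem (isOpen_Ioo.mem_nhds hs')
      fun s' hs' ↦ hΓ _ h1 x hx s' hs')
  refine ⟨Γ, fun x ↦ ?_, hΓcurve, fun z hz ↦ ?_, fun x x' hx hx' s hs heq ↦ ?_, fun x ↦ ?_⟩
  · exact h0 _ (hτ 0 (by simp)).1 x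
  · obtain ⟨hz0, hz1⟩ := mem_annulus_iff.1 hz
    obtain ⟨h1, h2⟩ := hτ _ hz1
    exact hsurj _ h1 z (mem_annulus_iff.2 ⟨hz0, abs_lt.1 h2⟩)
  · obtain ⟨h1, h2⟩ := hτ s hs
    have := ((hΓcurve x hx).mono h1.2.le).eqOn hY h1.2 ((hΓcurve x' hx').mono h1.2.le)
      (abs_lt.1 h2) heq (x := 0) ⟨by linarith [h1.1], h1.1⟩
    have hz := (hτ 0 (by simp)).1
    simpa only [Γ, h0 _ hz] using this
  · have : ∀ᶠ p : E × ℝ in 𝓝 (x, 0), |p.2| < 1 / 2 :=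
      (continuous_abs.comp continuous_snd).continuousAt.eventually_lt continuousAt_const (by simp)
    filter_upwards [hsm (1 / 2) ⟨by norm_num, by norm_num⟩ x, this.eventually_nhds] with p hp hp'
    refine hp.congr_of_eventuallyEq ?_
    filter_upwards [hp'] with q hq
    simp only [Γ, τ, if_pos hq]

end AnnulusFlow

end

/-! ### Parametrized open subsets of M and the pulled-back metric -/

section

section Param

variable {M : Type*} [TopologicalSpace M] [ChartedSpace E3 M]

/-- `Θ` is a smooth parametrization of an open subset of `M` by the open set `N`: an injective local
diffeomorphism. -/
structure IsParam (Θ : E3 → M) (N : Set E3) : Prop where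
  isOpen : IsOpen N
  contMDiffOn : ContMDiffOn (𝓡 3) (𝓡 3) ∞ Θ N
  injOn : InjOn Θ N
  immersion : ∀ y ∈ N, Function.Injective (mfderiv (𝓡 3) (𝓡 3) Θ y)

/-- The derivative of a map from a vector space to `M`, with the tangent space of `M` identified with
`ℝ³` by the preferred chart. -/
noncomputable def chartDeriv {E : Type*} [NormedAddCommGroup E] [NormedSpace ℝ E]
    (Θ : E → M) (y : E) : E →L[ℝ] E3 := mfderiv 𝓘(ℝ, E) (𝓡 3) Θ y

lemma hasFDerivAt_extChartAt_comp {E : Type*} [NormedAddCommGroup E] [NormedSpace ℝ E]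
    {Θ : E → M} {y : E} (h : MDifferentiableAt 𝓘(ℝ, E) (𝓡 3) Θ y) :
    HasFDerivAt (fun z ↦ extChartAt (𝓡 3) (Θ y) (Θ z)) (chartDeriv Θ y) y := by
  have : HasFDerivWithinAt (fun z ↦ extChartAt (𝓡 3) (Θ y) (Θ z)) (chartDeriv Θ y)
      univ y := by
    have h1 := h.hasMFDerivAt.2
    rw [modelWithCornersSelf_coe, range_id] at h1
    exact h1
  exact hasFDerivWithinAt_univ.1 this

namespace IsParam

variable {Θ : E3 → M} {N : Set E3}

lemma contMDiffAt (h : IsParam Θ N) {y : E3} (hy : y ∈ N) : ContMDiffAt (𝓡 3) (𝓡 3) ∞ Θ y :=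
  h.contMDiffOn.contMDiffAt (h.isOpen.mem_nhds hy)

lemma mdifferentiableAt (h : IsParam Θ N) {y : E3} (hy : y ∈ N) :
    MDifferentiableAt (𝓡 3) (𝓡 3) Θ y :=
  (h.contMDiffAt hy).mdifferentiableAt (by simp)

/-- The derivative of a parametrization as an equivalence. -/
lemma exists_equiv (h : IsParam Θ N) {y : E3} (hy : y ∈ N) :
    ∃ e : E3 ≃L[ℝ] E3, (e : E3 →L[ℝ] E3) = chartDeriv Θ y := by
  let e : E3 ≃ₗ[ℝ] E3 := LinearEquiv.ofInjectiveEndo (chartDeriv Θ y).toLinearMap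
    (h.immersion y hy)
  exact ⟨e.toContinuousLinearEquiv, by ext; rfl⟩

lemma surjective_mfderiv (h : IsParam Θ N) {y : E3} (hy : y ∈ N) :
    Function.Surjective (mfderiv (𝓡 3) (𝓡 3) Θ y) := by
  obtain ⟨e, he⟩ := h.exists_equiv hy
  intro w
  obtain ⟨v, hv⟩ := e.surjective w
  exact ⟨v, by rw [← hv]; exact (DFunLike.congr_fun he v).symm⟩

lemma contDiffAt_extChartAt_comp (h : IsParam Θ N) {y : E3} (hy : y ∈ N) :
    ContDiffAt ℝ ∞ (fun z ↦ extChartAt (𝓡 3) (Θ y) (Θ z)) y :=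
  ((contMDiffAt_extChartAt (I := 𝓡 3) (n := ∞) (x := Θ y)).comp y (h.contMDiffAt hy)).contDiffAt

/-- This is the inverse function theorem read in the chart at `Θ y`. It makes images of open sets
open and transfers local statements between `N` and `M`. -/
lemma map_nhds (h : IsParam Θ N) {y : E3} (hy : y ∈ N) : Filter.map Θ (𝓝 y) = 𝓝 (Θ y) := by
  obtain ⟨e, he⟩ := h.exists_equiv hy
  have h1 : HasFDerivAt (fun z ↦ extChartAt (𝓡 3) (Θ y) (Θ z))
      (e : E3 →L[ℝ] E3) y := by
    have := hasFDerivAt_extChartAt_comp (h.mdifferentiableAt hy)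
    rwa [← he] at this
  have h2 := ((h.contDiffAt_extChartAt_comp hy).hasStrictFDerivAt' h1 (by simp)).map_nhds_eq_of_equiv
  have h3 : Filter.map (extChartAt (𝓡 3) (Θ y)).symm (𝓝 (extChartAt (𝓡 3) (Θ y) (Θ y))) =
      𝓝 (Θ y) := by
    simpa using map_extChartAt_symm_nhdsWithin_range (I := 𝓡 3) (Θ y)
  rw [← h3, ← h2, Filter.map_map]
  refine Filter.map_congr ?_
  have : ∀ᶠ z in 𝓝 y, Θ z ∈ (extChartAt (𝓡 3) (Θ y)).source :=
    (h.contMDiffAt hy).continuousAt.eventually_mem (extChartAt_source_mem_nhds _)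
  filter_upwards [this] with z hz
  exact ((extChartAt (𝓡 3) (Θ y)).left_inv hz).symm

lemma isOpen_image (h : IsParam Θ N) {U : Set E3} (hU : IsOpen U) (hUN : U ⊆ N) :
    IsOpen (Θ '' U) := by
  rw [isOpen_iff_mem_nhds]
  rintro _ ⟨y, hy, rfl⟩
  rw [← h.map_nhds (hUN hy)]
  exact Filter.image_mem_map (hU.mem_nhds hy)

/-- A parametrization has a smooth inverse. -/
lemma exists_inverse (h : IsParam Θ N) : ∃ Ξ : M → E3, LeftInvOn Ξ Θ N ∧
    ContMDiffOn (𝓡 3) (𝓡 3) ∞ Ξ (Θ '' N) := by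
  classical
  refine ⟨Function.invFunOn Θ N, h.injOn.leftInvOn_invFunOn, ?_⟩
  rintro _ ⟨y, hy, rfl⟩
  refine ContMDiffAt.contMDiffWithinAt ?_
  obtain ⟨e, he⟩ := h.exists_equiv hy
  have h1 : HasFDerivAt (fun z ↦ extChartAt (𝓡 3) (Θ y) (Θ z))
      (e : E3 →L[ℝ] E3) y := by
    have := hasFDerivAt_extChartAt_comp (h.mdifferentiableAt hy)
    rwa [← he] at this
  have hc := h.contDiffAt_extChartAt_comp hy
  have h2 := hc.to_localInverse h1 (by simp)
  have h3 : ContMDiffAt (𝓡 3) (𝓡 3) ∞ (fun p ↦ hc.localInverse h1 (by simp)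
      (extChartAt (𝓡 3) (Θ y) p)) (Θ y) :=
    (h2.contMDiffAt).comp (Θ y) (contMDiffAt_extChartAt (I := 𝓡 3) (n := ∞) (x := Θ y))
  refine h3.congr_of_eventuallyEq ?_
  rw [Filter.EventuallyEq, ← h.map_nhds hy, Filter.eventually_map]
  filter_upwards [(hc.hasStrictFDerivAt' h1 (by simp)).eventually_left_inverse,
    h.isOpen.mem_nhds hy] with z hz hzN
  rw [h.injOn.leftInvOn_invFunOn hzN]
  exact hz.symm

end IsParam

end Param

section Metric

variable {M : Type*} [TopologicalSpace M] [ChartedSpace E3 M]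
  [Bundle.RiemannianBundle (fun x : M ↦ TangentSpace (𝓡 3) x)]

/-- The pull-back of the Riemannian metric. -/
noncomputable def pullMetric (Θ : E3 → M) (y : E3) : E3 →L[ℝ] E3 →L[ℝ] ℝ :=
  (innerSL ℝ (E := TangentSpace (𝓡 3) (Θ y))).bilinearComp
    (mfderiv (𝓡 3) (𝓡 3) Θ y : E3 →L[ℝ] TangentSpace (𝓡 3) (Θ y))
    (mfderiv (𝓡 3) (𝓡 3) Θ y : E3 →L[ℝ] TangentSpace (𝓡 3) (Θ y))

lemma pullMetric_apply (Θ : E3 → M) (y v w : E3) :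
    pullMetric Θ y v w =
      inner ℝ (mfderiv (𝓡 3) (𝓡 3) Θ y v) (mfderiv (𝓡 3) (𝓡 3) Θ y w) := rfl

lemma pullMetric_comm (Θ : E3 → M) (y v w : E3) : pullMetric Θ y v w = pullMetric Θ y w v :=
  real_inner_comm (F := TangentSpace (𝓡 3) (Θ y)) _ _

lemma pullMetric_pos {Θ : E3 → M} {N : Set E3} (h : IsParam Θ N) {y : E3} (hy : y ∈ N) {w : E3}
    (hw : w ≠ 0) : 0 < pullMetric Θ y w w := by
  rw [pullMetric_apply]
  refine real_inner_self_pos.2 fun h0 ↦ hw (h.immersion y hy ?_)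
  rw [h0]
  exact (map_zero (mfderiv (𝓡 3) (𝓡 3) Θ y)).symm

lemma coordMetric_eq (p : M) : coordMetric p = pullMetric (extChartAt (𝓡 3) p).symm := rfl

variable [IsManifold (𝓡 3) ∞ M]
  [IsContMDiffRiemannianBundle (𝓡 3) ∞ E3 (fun x : M ↦ TangentSpace (𝓡 3) x)]

/-- For constant v, w the entries are inner products of the sections y ↦ dΘ_y(v) and y ↦ dΘ_y(w),
which are smooth along Θ; a form on a finite-dimensional space is smooth when all its entries are.
-/
lemma contDiffOn_pullMetric {Θ : E3 → M} {N : Set E3} (hN : IsOpen N)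
    (h : ContMDiffOn (𝓡 3) (𝓡 3) ∞ Θ N) : ContDiffOn ℝ ∞ (pullMetric Θ) N := by
  have hsec : ∀ v : E3, ContMDiffOn (𝓡 3) ((𝓡 3).prod 𝓘(ℝ, E3)) ∞
      (fun y ↦ (⟨Θ y, mfderiv (𝓡 3) (𝓡 3) Θ y v⟩ : TotalSpace E3 (TangentSpace (𝓡 3) : M → Type _)))
      N := by
    intro v
    have h1 := h.contMDiffOn_tangentMapWithin (m := ∞) (by simp) hN.uniqueMDiffOn
    have h2 : ContMDiff (𝓡 3) (𝓡 3).tangent ∞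
        (fun y : E3 ↦ (⟨y, v⟩ : TangentBundle (𝓡 3) E3)) := by
      exact fun y ↦ contMDiffAt_vectorSpace_iff_contDiffAt.2 (contDiffAt_const (c := v))
    refine ((h1.comp (h2.contMDiffOn (s := N)) ?_).congr ?_)
    · exact fun y hy ↦ hy
    · intro y hy
      simp only [Function.comp, tangentMapWithin]
      rw [mfderivWithin_of_isOpen hN hy]
  rw [contDiffOn_clm_apply]
  intro v
  rw [contDiffOn_clm_apply]
  intro w
  exact ((hsec v).inner_bundle (hsec w)).contDiffOn

end Metric

end

/-! ### Polar coordinates, and the gradient field in coordinates -/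

section

section Polar

/-- Radial projection to the unit sphere. -/
noncomputable def toSphere (y : E3) : S2 :=
  if h : y = 0 then ⟨EuclideanSpace.single 0 1, by simp⟩
  else ⟨‖y‖⁻¹ • y, by simp [norm_smul, norm_ne_zero_iff.2 h]⟩

lemma coe_toSphere {y : E3} (hy : y ≠ 0) : (toSphere y : E3) = ‖y‖⁻¹ • y := by
  simp [toSphere, hy]

lemma exp_log_norm_smul_toSphere {y : E3} (hy : y ≠ 0) :
    Real.exp (Real.log ‖y‖) • (toSphere y : E3) = y := by
  rw [Real.exp_log (norm_pos_iff.2 hy), coe_toSphere hy, smul_smul,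
    mul_inv_cancel₀ (norm_ne_zero_iff.2 hy), one_smul]

lemma norm_exp_smul_sphere (x : S2) (s : ℝ) : ‖Real.exp s • (x : E3)‖ = Real.exp s := by
  rw [norm_smul, norm_eq_of_mem_sphere x, mul_one, Real.norm_eq_abs, Real.abs_exp]

lemma exp_smul_sphere_ne_zero (x : S2) (s : ℝ) : Real.exp s • (x : E3) ≠ 0 :=
  norm_pos_iff.1 (by rw [norm_exp_smul_sphere]; exact Real.exp_pos s)

lemma toSphere_exp_smul (x : S2) (s : ℝ) : toSphere (Real.exp s • (x : E3)) = x := by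
  ext1
  rw [coe_toSphere (exp_smul_sphere_ne_zero x s), norm_exp_smul_sphere, smul_smul,
    inv_mul_cancel₀ (Real.exp_pos s).ne', one_smul]

lemma exp_smul_sphere_mem_annulus (x : S2) {s δ : ℝ} (hs : s ∈ Ioo (-δ) δ) :
    Real.exp s • (x : E3) ∈ annulus E3 δ :=
  mem_annulus_iff.2 ⟨exp_smul_sphere_ne_zero x s, by rwa [norm_exp_smul_sphere, Real.log_exp]⟩

lemma contMDiff_coe_S2 : ContMDiff (𝓡 2) (𝓡 3) ∞ (fun x : S2 ↦ (x : E3)) := by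
  have : Fact (Module.finrank ℝ E3 = 2 + 1) := ⟨finrank_euclideanSpace_fin⟩
  exact contMDiff_coe_sphere

lemma contMDiffAt_toSphere {y : E3} (hy : y ≠ 0) :
    ContMDiffAt (𝓡 3) (𝓡 2) ∞ toSphere y := by
  let U : TopologicalSpace.Opens E3 := ⟨{0}ᶜ, isOpen_compl_singleton⟩
  have hU : ∀ z : U, (z : E3) ≠ 0 := fun z ↦ z.2
  have h1 : ContMDiff (𝓡 3) 𝓘(ℝ, E3) ∞ (fun z : U ↦ ‖(z : E3)‖⁻¹ • (z : E3)) := by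
    intro z
    rw [contMDiffAt_subtype_iff (f := fun z : E3 ↦ ‖z‖⁻¹ • z)]
    exact (((contDiffAt_norm ℝ (hU z)).inv (norm_ne_zero_iff.2 (hU z))).smul
      contDiffAt_id).contMDiffAt
  have hmem : ∀ z : U, ‖(z : E3)‖⁻¹ • (z : E3) ∈ sphere (0 : E3) 1 :=
    fun z ↦ by simp [norm_smul, norm_ne_zero_iff.2 (hU z)]
  have h2 : ContMDiff (𝓡 3) (𝓡 2) ∞ (codRestrict _ _ hmem : U → S2) := by
    have : Fact (Module.finrank ℝ E3 = 2 + 1) := ⟨finrank_euclideanSpace_fin⟩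
    exact ContMDiff.codRestrict_sphere (n := 2) h1 hmem
  have h3 : ContMDiffAt (𝓡 3) (𝓡 2) ∞ (fun z : U ↦ toSphere z) ⟨y, hy⟩ := by
    refine (h2 ⟨y, hy⟩).congr_of_eventuallyEq (Filter.Eventually.of_forall fun z ↦ ?_)
    ext1
    rw [coe_toSphere (hU z)]
    rfl
  exact contMDiffAt_subtype_iff.1 h3

/-- Polar coordinates. -/
noncomputable def polar (y : E3) : S2 × ℝ := (toSphere y, Real.log ‖y‖)

lemma contMDiffAt_polar {y : E3} (hy : y ≠ 0) :
    ContMDiffAt (𝓡 3) ((𝓡 2).prod 𝓘(ℝ, ℝ)) ∞ polar y :=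
  (contMDiffAt_toSphere hy).prodMk
    ((contDiffAt_norm ℝ hy).log (norm_ne_zero_iff.2 hy)).contMDiffAt

/-- Near y the map (x, s) ↦ e^s x is a smooth left inverse. -/
lemma injective_mfderiv_polar {y : E3} (hy : y ≠ 0) :
    Function.Injective (mfderiv (𝓡 3) ((𝓡 2).prod 𝓘(ℝ, ℝ)) polar y) := by
  let p : S2 × ℝ → E3 := fun q ↦ Real.exp q.2 • (q.1 : E3)
  have hp : ContMDiff ((𝓡 2).prod 𝓘(ℝ, ℝ)) (𝓡 3) ∞ p :=
    (Real.contDiff_exp.contMDiff.comp contMDiff_snd).smul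
      (contMDiff_coe_S2.comp contMDiff_fst)
  have h1 : MDifferentiableAt (𝓡 3) ((𝓡 2).prod 𝓘(ℝ, ℝ)) polar y :=
    (contMDiffAt_polar hy).mdifferentiableAt (by simp)
  have h2 : MDifferentiableAt ((𝓡 2).prod 𝓘(ℝ, ℝ)) (𝓡 3) p (polar y) :=
    (hp _).mdifferentiableAt (by simp)
  have h3 := mfderiv_comp y h2 h1
  have h4 : p ∘ polar =ᶠ[𝓝 y] id :=
    Filter.eventually_of_mem (isOpen_compl_singleton.mem_nhds hy)
      fun z hz ↦ exp_log_norm_smul_toSphere hz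
  rw [h4.mfderiv_eq, mfderiv_id] at h3
  intro v w hvw
  have h5 := fun v ↦ DFunLike.congr_fun h3 v
  have h6 : v = mfderiv ((𝓡 2).prod 𝓘(ℝ, ℝ)) (𝓡 3) p (polar y)
      (mfderiv (𝓡 3) ((𝓡 2).prod 𝓘(ℝ, ℝ)) polar y v) := h5 v
  have h7 : w = mfderiv ((𝓡 2).prod 𝓘(ℝ, ℝ)) (𝓡 3) p (polar y)
      (mfderiv (𝓡 3) ((𝓡 2).prod 𝓘(ℝ, ℝ)) polar y w) := h5 w
  rw [h6, h7, hvw]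

variable {M : Type*} [TopologicalSpace M] [ChartedSpace E3 M]

lemma polar_mem {y : E3} (hy : y ∈ annulus E3 1) :
    polar y ∈ (univ ×ˢ Ioo (-1) 1 : Set (S2 × ℝ)) :=
  ⟨mem_univ _, (mem_annulus_iff.1 hy).2⟩

lemma isParam_comp_polar {F : S2 × ℝ → M} (hF : IsSphereFoliation F) :
    IsParam (fun y ↦ F (polar y)) (annulus E3 1) := by
  have hFat : ∀ y ∈ annulus E3 1, ContMDiffAt ((𝓡 2).prod 𝓘(ℝ, ℝ)) (𝓡 3) ∞ F (polar y) :=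
    fun y hy ↦ hF.contMDiffOn.contMDiffAt
      ((isOpen_univ.prod isOpen_Ioo).mem_nhds (polar_mem hy))
  refine ⟨isOpen_annulus 1, fun y hy ↦ ?_, fun y hy z hz h ↦ ?_, fun y hy ↦ ?_⟩
  · exact ((hFat y hy).comp y (contMDiffAt_polar (ne_zero_of_mem_annulus hy))).contMDiffWithinAt
  · have h1 := hF.injOn (polar_mem hy) (polar_mem hz) h
    rw [polar, polar, Prod.mk.injEq] at h1
    rw [← exp_log_norm_smul_toSphere (ne_zero_of_mem_annulus hy),
      ← exp_log_norm_smul_toSphere (ne_zero_of_mem_annulus hz), h1.1, h1.2]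
  · have h1 := mfderiv_comp y ((hFat y hy).mdifferentiableAt (by simp))
      ((contMDiffAt_polar (ne_zero_of_mem_annulus hy)).mdifferentiableAt (by simp))
    have h2 := (hF.immersion _ (polar_mem hy)).comp
      (injective_mfderiv_polar (ne_zero_of_mem_annulus hy))
    intro v w hvw
    refine h2 ?_
    have h3 := fun v ↦ DFunLike.congr_fun h1 v
    exact (h3 v).symm.trans (hvw.trans (h3 w))

end Polar

section Gradient

variable {M : Type*} [TopologicalSpace M] [ChartedSpace E3 M]
  [Bundle.RiemannianBundle (fun x : M ↦ TangentSpace (𝓡 3) x)]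

/-- The differential of `log ‖y‖`. -/
noncomputable def logNormDeriv (y : E3) : E3 →L[ℝ] ℝ := (‖y‖ ^ 2)⁻¹ • innerSL ℝ y

lemma logNormDeriv_apply (y w : E3) : logNormDeriv y w = (‖y‖ ^ 2)⁻¹ * inner ℝ y w := rfl

lemma hasFDerivAt_log_norm {y : E3} (hy : y ≠ 0) :
    HasFDerivAt (fun y : E3 ↦ Real.log ‖y‖) (logNormDeriv y) y := by
  have h1 : HasFDerivAt (fun z : E3 ↦ ‖z‖ ^ 2) (2 • innerSL ℝ y) y := by
    simpa using (hasStrictFDerivAt_norm_sq y).hasFDerivAt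
  have h2 := (h1.log (by simpa using hy)).const_mul (1 / 2 : ℝ)
  have h3 : (fun z : E3 ↦ 1 / 2 * Real.log (‖z‖ ^ 2)) = fun z ↦ Real.log ‖z‖ := by
    ext s
    rw [Real.log_pow]; push_cast; ring
  rw [h3] at h2
  refine h2.congr_fderiv ?_
  ext w
  simp [logNormDeriv_apply]
  ring

lemma inner_gradient (f : M → ℝ) (p : M) (v : TangentSpace (𝓡 3) p) :
    inner ℝ (gradient f p) v = mvfderiv (𝓡 3) f p v := by
  rw [gradient, InnerProductSpace.toDual_symm_apply]

/-- In a parametrization in which `f` is `log ‖y‖`. -/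
lemma IsParam.inner_gradient {Θ : E3 → M} {N : Set E3} (h : IsParam Θ N) {f : M → ℝ}
    (hN : ∀ y ∈ N, y ≠ 0) (hf : ∀ y ∈ N, f (Θ y) = Real.log ‖y‖) {y : E3} (hy : y ∈ N) (w : E3) :
    inner ℝ (gradient f (Θ y)) (mfderiv (𝓡 3) (𝓡 3) Θ y w) = logNormDeriv y w := by
  rw [Squeezing.inner_gradient]
  obtain ⟨Ξ, hΞ, hΞs⟩ := h.exists_inverse
  have hΞat : ContMDiffAt (𝓡 3) (𝓡 3) ∞ Ξ (Θ y) :=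
    hΞs.contMDiffAt ((h.isOpen_image h.isOpen subset_rfl).mem_nhds (mem_image_of_mem _ hy))
  -- Smoothness of f is not assumed: it follows from f = log ‖Ξ ·‖ near `Θ y`.
  have hfd : MDifferentiableAt (𝓡 3) 𝓘(ℝ, ℝ) f (Θ y) := by
    have h1 : ContMDiffAt (𝓡 3) 𝓘(ℝ, ℝ) ∞ (fun p ↦ Real.log ‖Ξ p‖) (Θ y) := by
      have hne : Ξ (Θ y) ≠ 0 := by rw [hΞ hy]; exact hN y hy
      exact (((contDiffAt_norm ℝ hne).log (norm_ne_zero_iff.2 hne)).contMDiffAt).comp _ hΞat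
    refine (h1.congr_of_eventuallyEq ?_).mdifferentiableAt (by simp)
    rw [Filter.EventuallyEq, ← h.map_nhds hy, Filter.eventually_map]
    filter_upwards [h.isOpen.mem_nhds hy] with z hz
    rw [hf z hz, hΞ hz]
  have h2 := mfderiv_comp y hfd (h.mdifferentiableAt hy)
  have h3 : f ∘ Θ =ᶠ[𝓝 y] fun y ↦ Real.log ‖y‖ :=
    Filter.eventually_of_mem (h.isOpen.mem_nhds hy) hf
  rw [h3.mfderiv_eq, mfderiv_eq_fderiv, (hasFDerivAt_log_norm (hN y hy)).fderiv] at h2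
  exact (DFunLike.congr_fun h2 w).symm

/-- The field `∇f / |∇f|²`, in a parametrization in which `f` is `log ‖y‖`. -/
lemma IsParam.exists_field [IsManifold (𝓡 3) ∞ M]
    [IsContMDiffRiemannianBundle (𝓡 3) ∞ E3 (fun x : M ↦ TangentSpace (𝓡 3) x)]
    {Θ : E3 → M} {N : Set E3} (h : IsParam Θ N) {f : M → ℝ}
    (hN : ∀ y ∈ N, y ≠ 0) (hf : ∀ y ∈ N, f (Θ y) = Real.log ‖y‖) :
    ∃ Y : E3 → E3, ContDiffOn ℝ ∞ Y N ∧ ∀ y ∈ N, inner ℝ y (Y y) = ‖y‖ ^ 2 ∧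
      mfderiv (𝓡 3) (𝓡 3) Θ y (Y y) = normalField f (Θ y) := by
  -- The gradient in coordinates: the metric, as a map into the dual space, is inverted on the
  -- differential of log ‖y‖.
  let g : E3 → E3 := fun y ↦ (pullMetric Θ y).inverse (logNormDeriv y)
  have hinv : ∀ y ∈ N, ∃ e : E3 ≃L[ℝ] (E3 →L[ℝ] ℝ), (e : E3 →L[ℝ] E3 →L[ℝ] ℝ) = pullMetric Θ y := by
    intro y hy
    have hinj : Function.Injective (pullMetric Θ y) := by
      rw [injective_iff_map_eq_zero]
      intro v hv
      by_contra hv0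
      have := pullMetric_pos h hy hv0
      rw [hv] at this
      exact lt_irrefl _ this
    let e : E3 ≃ₗ[ℝ] (E3 →L[ℝ] ℝ) := LinearEquiv.ofInjectiveOfFinrankEq
      (pullMetric Θ y).toLinearMap hinj
      (InnerProductSpace.toDual ℝ E3).toLinearEquiv.finrank_eq
    exact ⟨e.toContinuousLinearEquiv, by ext; rfl⟩
  have hg : ∀ y ∈ N, ∀ w, pullMetric Θ y (g y) w = logNormDeriv y w := by
    intro y hy w
    obtain ⟨e, he⟩ := hinv y hy
    simp only [g, ← he, ContinuousLinearMap.inverse_equiv]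
    simp
  have hgs : ContDiffOn ℝ ∞ g N := by
    intro y hy
    obtain ⟨e, he⟩ := hinv y hy
    refine ContDiffWithinAt.clm_apply ?_ ?_
    · have h1 := contDiffAt_map_inverse (n := ∞) e
      rw [he] at h1
      exact h1.comp_contDiffWithinAt y (contDiffOn_pullMetric h.isOpen h.contMDiffOn y hy)
    · refine ContDiffAt.contDiffWithinAt ?_
      exact ContDiffAt.smul ((contDiff_norm_sq ℝ).contDiffAt.inv (by simpa using hN y hy))
        (innerSL ℝ (E := E3)).contDiff.contDiffAt
  have hgrad : ∀ y ∈ N, mfderiv (𝓡 3) (𝓡 3) Θ y (g y) = gradient f (Θ y) := by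
    intro y hy
    refine ext_inner_right (E := TangentSpace (𝓡 3) (Θ y)) ℝ fun v ↦ ?_
    obtain ⟨w, rfl⟩ := h.surjective_mfderiv hy v
    exact (hg y hy w).trans (h.inner_gradient hN hf hy w).symm
  have hnorm : ∀ y ∈ N, ‖gradient f (Θ y)‖ ^ 2 = logNormDeriv y (g y) := by
    intro y hy
    rw [← real_inner_self_eq_norm_sq]
    nth_rewrite 2 [← hgrad y hy]
    exact h.inner_gradient hN hf hy _
  have hgpos : ∀ y ∈ N, 0 < logNormDeriv y (g y) := by
    intro y hy
    rw [← hg y hy]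
    refine pullMetric_pos h hy fun h0 ↦ ?_
    have h1 := hg y hy y
    rw [h0, map_zero, logNormDeriv_apply, real_inner_self_eq_norm_sq] at h1
    have : ‖y‖ ^ 2 ≠ 0 := by simpa using hN y hy
    rw [inv_mul_cancel₀ this] at h1
    simp at h1
  -- Since |∇f|² = df(∇f), dividing by this number gives X; it also normalizes the logarithmic
  -- radial speed to 1.
  refine ⟨fun y ↦ (logNormDeriv y (g y))⁻¹ • g y, ?_, fun y hy ↦ ⟨?_, ?_⟩⟩
  · refine ContDiffOn.smul (ContDiffOn.inv ?_ fun y hy ↦ (hgpos y hy).ne') hgs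
    refine ContDiffOn.clm_apply ?_ hgs
    exact ContDiffOn.smul ((contDiff_norm_sq ℝ).contDiffOn.inv fun y hy ↦ by simpa using hN y hy)
      (innerSL ℝ (E := E3)).contDiff.contDiffOn
  · have h1 : ‖y‖ ^ 2 ≠ 0 := by simpa using hN y hy
    have h2 := hgpos y hy
    rw [inner_smul_right]
    rw [logNormDeriv_apply] at h2 ⊢
    have h3 : inner ℝ y (g y) ≠ 0 := fun h ↦ by rw [h] at h2; simp at h2
    field_simp
  · rw [normalField, hnorm y hy, ← hgrad y hy]
    exact map_smul (mfderiv (𝓡 3) (𝓡 3) Θ y) _ _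

end Gradient

end

/-! ### Flow coordinates around the central leaf -/

section

lemma toSphere_smul {y : E3} {c : ℝ} (hc : 0 < c) (hy : y ≠ 0) :
    toSphere (c • y) = toSphere y := by
  ext1
  rw [coe_toSphere hy, coe_toSphere (smul_ne_zero hc.ne' hy), norm_smul, Real.norm_eq_abs,
    abs_of_pos hc, smul_smul]
  congr 1
  field_simp

lemma log_norm_smul {y : E3} {c : ℝ} (hc : 0 < c) (hy : y ≠ 0) :
    Real.log ‖c • y‖ = Real.log c + Real.log ‖y‖ := by
  rw [norm_smul, Real.norm_eq_abs, abs_of_pos hc, Real.log_mul hc.ne' (norm_ne_zero_iff.2 hy)]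

/-- Neighbourhoods of the unit sphere contain annuli. -/
lemma exists_annulus_subset {O : Set E3} (hO : ∀ y : E3, ‖y‖ = 1 → O ∈ 𝓝 y) :
    ∃ δ : ℝ, 0 < δ ∧ δ < 1 ∧ annulus E3 δ ⊆ O := by
  have h1 : sphere (0 : E3) 1 ⊆ interior O := fun y hy ↦
    mem_interior_iff_mem_nhds.2 (hO y (by simpa using hy))
  obtain ⟨ε, hε, hsub⟩ := (isCompact_sphere (0 : E3) 1).exists_thickening_subset_open
    isOpen_interior h1
  have hlog : 0 < Real.log (1 + ε) := Real.log_pos (by linarith)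
  -- With e^δ ≤ 1 + ε both bounds on ‖y‖ put y within ε of its radial projection; the lower one uses
  -- 1/(1 + ε) ≥ 1 - ε.
  refine ⟨min (1 / 2) (Real.log (1 + ε)), lt_min (by norm_num) hlog,
    (min_le_left _ _).trans_lt (by norm_num), fun y hy ↦ interior_subset (hsub ?_)⟩
  have hy0 := ne_zero_of_mem_annulus hy
  obtain ⟨h2, h3⟩ := annulus_mono (min_le_right _ _) hy
  rw [Real.exp_neg, Real.exp_log (by linarith)] at h2
  rw [Real.exp_log (by linarith)] at h3
  rw [mem_thickening_iff]
  refine ⟨toSphere y, (toSphere y).2, ?_⟩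
  have h4 : y - (toSphere y : E3) = (‖y‖ - 1) • (toSphere y : E3) := by
    rw [sub_smul, one_smul, coe_toSphere hy0, smul_smul, mul_inv_cancel₀ (norm_ne_zero_iff.2 hy0),
      one_smul]
  rw [dist_eq_norm, h4, norm_smul, norm_eq_of_mem_sphere, mul_one, Real.norm_eq_abs, abs_lt]
  have h5 : 1 - ε ≤ (1 + ε)⁻¹ := by
    rw [← one_div, le_div_iff₀ (by linarith)]
    nlinarith
  constructor <;> linarith

/-- The flow of a field on the annulus, in polar coordinates: `e^s x ↦ Γ x s`. -/
noncomputable def flowMap (Γ : E3 → ℝ → E3) (y : E3) : E3 := Γ (toSphere y) (Real.log ‖y‖)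

section FlowMap

variable {Γ : E3 → ℝ → E3} {Y : E3 → E3}

lemma log_norm_flowMap (hcurve : ∀ x, ‖x‖ = 1 → IsRadialCurve Y (Γ x) 1) {y : E3}
    (hy : y ∈ annulus E3 1) : Real.log ‖flowMap Γ y‖ = Real.log ‖y‖ :=
  (hcurve _ (norm_eq_of_mem_sphere (toSphere y)) _ (mem_annulus_iff.1 hy).2).2.2

lemma flowMap_mem (hcurve : ∀ x, ‖x‖ = 1 → IsRadialCurve Y (Γ x) 1) {y : E3}
    (hy : y ∈ annulus E3 1) : flowMap Γ y ∈ annulus E3 1 :=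
  (hcurve _ (norm_eq_of_mem_sphere (toSphere y))).mem_annulus (mem_annulus_iff.1 hy).2

lemma flowMap_of_norm_eq_one (h0 : ∀ x, Γ x 0 = x) {y : E3} (hy : ‖y‖ = 1) :
    flowMap Γ y = y := by
  have hy0 : y ≠ 0 := norm_pos_iff.1 (by rw [hy]; norm_num)
  rw [flowMap, hy, Real.log_one, h0, coe_toSphere hy0, hy, inv_one, one_smul]

/-- `flowMap` preserves the radius, so a vector in the kernel has no radial component. It fixes the
unit sphere pointwise, so its derivative is the identity on tangential vectors. -/
lemma injective_fderiv_flowMap (h0 : ∀ x, Γ x 0 = x)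
    (hcurve : ∀ x, ‖x‖ = 1 → IsRadialCurve Y (Γ x) 1) {y : E3} (hy : ‖y‖ = 1)
    (hd : DifferentiableAt ℝ (flowMap Γ) y) : Function.Injective (fderiv ℝ (flowMap Γ) y) := by
  have hy0 : y ≠ 0 := norm_pos_iff.1 (by rw [hy]; norm_num)
  have hyA : y ∈ annulus E3 1 := mem_annulus_iff.2 ⟨hy0, by simp [hy]⟩
  rw [injective_iff_map_eq_zero]
  intro v hv
  have hline : HasDerivAt (fun t : ℝ ↦ y + t • v) v 0 := by
    simpa using ((hasDerivAt_id (0 : ℝ)).smul_const v).const_add y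
  have hline0 : y + (0 : ℝ) • v = y := by simp
  have hyv : inner ℝ y v = 0 := by
    have h1 : HasDerivAt (fun t : ℝ ↦ flowMap Γ (y + t • v)) (fderiv ℝ (flowMap Γ) y v) 0 := by
      have h2 : HasFDerivAt (flowMap Γ) (fderiv ℝ (flowMap Γ) y) (y + (0 : ℝ) • v) := by
        rw [hline0]; exact hd.hasFDerivAt
      exact h2.comp_hasDerivAt 0 hline
    rw [hv] at h1
    have h2 := hasDerivAt_log_norm h1 (by
      rw [hline0, flowMap_of_norm_eq_one h0 hy]; exact hy0)
    have h3 := hasDerivAt_log_norm hline (by rwa [hline0])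
    have h4 : (fun t : ℝ ↦ Real.log ‖flowMap Γ (y + t • v)‖) =ᶠ[𝓝 0]
        fun t ↦ Real.log ‖y + t • v‖ := by
      have : ∀ᶠ t : ℝ in 𝓝 0, y + t • v ∈ annulus E3 1 :=
        hline.continuousAt.eventually_mem
          ((isOpen_annulus 1).mem_nhds (by rwa [hline0]))
      filter_upwards [this] with t ht using log_norm_flowMap hcurve ht
    have h5 := (h3.congr_of_eventuallyEq h4).unique h2
    simpa [hy] using h5
  -- The line y + tv projected to the sphere; its velocity at 0 is still v, because v is orthogonal
  -- to y.
  let n : ℝ → E3 := fun t ↦ Real.exp (-Real.log ‖y + t • v‖) • (y + t • v)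
  have hn : HasDerivAt n v 0 := by
    have h1 := hasDerivAt_log_norm hline (by rwa [hline0])
    have h2 := h1.neg.exp.smul hline
    refine h2.congr_deriv ?_
    simp [hy, hyv]
  have hn0 : n 0 = y := by simp [n, hy]
  have h1 : HasDerivAt (fun t ↦ flowMap Γ (n t)) (fderiv ℝ (flowMap Γ) y v) 0 := by
    have h2 : HasFDerivAt (flowMap Γ) (fderiv ℝ (flowMap Γ) y) (n 0) := by
      rw [hn0]; exact hd.hasFDerivAt
    exact h2.comp_hasDerivAt 0 hn
  have h2 : (fun t ↦ flowMap Γ (n t)) =ᶠ[𝓝 0] n := by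
    have : ∀ᶠ t : ℝ in 𝓝 0, y + t • v ≠ 0 :=
      hline.continuousAt.eventually_ne (by rwa [hline0])
    filter_upwards [this] with t ht
    refine flowMap_of_norm_eq_one h0 ?_
    rw [norm_smul, Real.norm_eq_abs, Real.abs_exp, Real.exp_neg,
      Real.exp_log (norm_pos_iff.2 ht), inv_mul_cancel₀ (norm_ne_zero_iff.2 ht)]
  rw [← (hn.congr_of_eventuallyEq h2).unique h1] at hv
  exact hv

/-- Smoothness and injectivity of the derivative hold near every point of the unit sphere, hence on
a thin annulus by compactness. Global injectivity needs no thinness: equal images have equal radii,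
and flow lines do not meet. -/
lemma exists_isParam_flowMap (h0 : ∀ x, Γ x 0 = x)
    (hcurve : ∀ x, ‖x‖ = 1 → IsRadialCurve Y (Γ x) 1)
    (hinj : ∀ x x', ‖x‖ = 1 → ‖x'‖ = 1 → ∀ s ∈ Ioo (-1 : ℝ) 1, Γ x s = Γ x' s → x = x')
    (hsm : ∀ x, ∀ᶠ p in 𝓝 (x, (0 : ℝ)), ContDiffAt ℝ ∞ (fun p : E3 × ℝ ↦ Γ p.1 p.2) p) :
    ∃ δ : ℝ, 0 < δ ∧ δ < 1 ∧ ContDiffOn ℝ ∞ (flowMap Γ) (annulus E3 δ) ∧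
      InjOn (flowMap Γ) (annulus E3 1) ∧
      ∀ y ∈ annulus E3 δ, Function.Injective (fderiv ℝ (flowMap Γ) y) := by
  have hsphere : ∀ y : E3, y ≠ 0 → ContDiffAt ℝ ∞ (fun y ↦ (toSphere y : E3)) y := fun y hy ↦
    (contMDiff_coe_S2.contMDiffAt.comp y (contMDiffAt_toSphere hy)).contDiffAt
  have hsm' : ∀ y : E3, ‖y‖ = 1 → ∀ᶠ z in 𝓝 y, ContDiffAt ℝ ∞ (flowMap Γ) z := by
    intro y hy
    have hy0 : y ≠ 0 := norm_pos_iff.1 (by rw [hy]; norm_num)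
    have hpol : ∀ z : E3, z ≠ 0 →
        ContDiffAt ℝ ∞ (fun z ↦ ((toSphere z : E3), Real.log ‖z‖)) z := fun z hz ↦
      (hsphere z hz).prodMk ((contDiffAt_norm ℝ hz).log (norm_ne_zero_iff.2 hz))
    have h1 := hsm y
    have h2 : ((toSphere y : E3), Real.log ‖y‖) = (y, (0 : ℝ)) := by
      rw [coe_toSphere hy0, hy, inv_one, one_smul, Real.log_one]
    have h3 := (hpol y hy0).continuousAt.tendsto
    rw [h2] at h3
    filter_upwards [h3.eventually h1, isOpen_compl_singleton.mem_nhds hy0] with z hz hz0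
    exact hz.comp z (hpol z hz0)
  have hder : ∀ y : E3, ‖y‖ = 1 → ∀ᶠ z in 𝓝 y, Function.Injective (fderiv ℝ (flowMap Γ) z) := by
    intro y hy
    have h1 := (hsm' y hy).self_of_nhds
    have h2 := injective_fderiv_flowMap h0 hcurve hy (h1.differentiableAt (by simp))
    let e : E3 ≃L[ℝ] E3 := (LinearEquiv.ofInjectiveEndo
      (fderiv ℝ (flowMap Γ) y).toLinearMap h2).toContinuousLinearEquiv
    have he : (e : E3 →L[ℝ] E3) = fderiv ℝ (flowMap Γ) y := by ext; rfl
    have h3 : ContinuousAt (fderiv ℝ (flowMap Γ)) y :=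
      (h1.fderiv_right (m := 0) (by simp)).continuousAt
    have h4 := h3.eventually_mem (he ▸ e.nhds)
    filter_upwards [h4] with z hz
    obtain ⟨e', he'⟩ := hz
    rw [← he']
    exact e'.injective
  obtain ⟨δ, hδ0, hδ1, hδ⟩ := exists_annulus_subset
    (O := {z | ContDiffAt ℝ ∞ (flowMap Γ) z ∧ Function.Injective (fderiv ℝ (flowMap Γ) z)})
    fun y hy ↦ (hsm' y hy).and (hder y hy)
  refine ⟨δ, hδ0, hδ1, fun y hy ↦ (hδ hy).1.contDiffWithinAt, fun y hy z hz h ↦ ?_,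
    fun y hy ↦ (hδ hy).2⟩
  have h1 : Real.log ‖y‖ = Real.log ‖z‖ := by
    rw [← log_norm_flowMap hcurve hy, ← log_norm_flowMap hcurve hz, h]
  rw [flowMap, flowMap, ← h1] at h
  have h2 := hinj _ _ (norm_eq_of_mem_sphere (toSphere y)) (norm_eq_of_mem_sphere (toSphere z)) _
    (mem_annulus_iff.1 hy).2 h
  rw [← exp_log_norm_smul_toSphere (ne_zero_of_mem_annulus hy),
    ← exp_log_norm_smul_toSphere (ne_zero_of_mem_annulus hz), h1, h2]

/-- Scaling y by e^t advances the flow time by t. -/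
lemma fderiv_flowMap_self (hcurve : ∀ x, ‖x‖ = 1 → IsRadialCurve Y (Γ x) 1) {y : E3}
    (hy : y ∈ annulus E3 1) (hd : DifferentiableAt ℝ (flowMap Γ) y) :
    fderiv ℝ (flowMap Γ) y y = Y (flowMap Γ y) := by
  have hy0 := ne_zero_of_mem_annulus hy
  have h1 : HasDerivAt (fun t : ℝ ↦ Real.exp t • y) y 0 := by
    simpa using (Real.hasDerivAt_exp 0).smul_const y
  have h2 : HasDerivAt (fun t : ℝ ↦ flowMap Γ (Real.exp t • y)) (fderiv ℝ (flowMap Γ) y y) 0 := by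
    have h3 : HasFDerivAt (flowMap Γ) (fderiv ℝ (flowMap Γ) y) (Real.exp 0 • y) := by
      simpa using hd.hasFDerivAt
    exact h3.comp_hasDerivAt 0 h1
  have h3 : (fun t : ℝ ↦ flowMap Γ (Real.exp t • y)) =
      fun t ↦ Γ (toSphere y) (t + Real.log ‖y‖) := by
    ext1 t
    rw [flowMap, toSphere_smul (Real.exp_pos t) hy0, log_norm_smul (Real.exp_pos t) hy0,
      Real.log_exp]
  rw [h3] at h2
  have h4 : HasDerivAt (Γ (toSphere y)) (Y (flowMap Γ y)) (0 + Real.log ‖y‖) := by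
    rw [zero_add]
    exact (hcurve _ (norm_eq_of_mem_sphere (toSphere y)) _ (mem_annulus_iff.1 hy).2).1
  exact h2.unique (h4.comp_add_const 0 _)

end FlowMap

variable {M : Type*} [TopologicalSpace M] [ChartedSpace E3 M] [IsManifold (𝓡 3) ∞ M]
  [Bundle.RiemannianBundle (fun x : M ↦ TangentSpace (𝓡 3) x)]
  [IsContMDiffRiemannianBundle (𝓡 3) ∞ E3 (fun x : M ↦ TangentSpace (𝓡 3) x)]

/-- The flow `ϕ` of `∇f / |∇f|²` starting at the central leaf of a foliation by level sets of `f`: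
its flow lines are defined for logarithmic times in `(-1, 1)`, and near the central leaf it defines
a smooth parametrization. -/
theorem exists_flow_foliation {F : S2 × ℝ → M} (hF : IsSphereFoliation F) {f : M → ℝ}
    (hf : ∀ x, ∀ s ∈ Ioo (-1 : ℝ) 1, f (F (x, s)) = s) :
    ∃ (ϕ : S2 → ℝ → M) (δ : ℝ), 0 < δ ∧ δ < 1 ∧ (∀ x, ϕ x 0 = F (x, 0)) ∧
      (∀ x, IsMIntegralCurveOn (I := 𝓡 3) (ϕ x) (normalField f) (Ioo (-1) 1)) ∧
      (∀ s ∈ Ioo (-1 : ℝ) 1, range (fun x ↦ ϕ x s) = leaf F s) ∧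
      (∀ x x', ∀ s ∈ Ioo (-1 : ℝ) 1, ϕ x s = ϕ x' s → x = x') ∧
      IsParam (fun y ↦ ϕ (toSphere y) (Real.log ‖y‖)) (annulus E3 δ) ∧
      ∀ y ∈ annulus E3 δ, mfderiv (𝓡 3) (𝓡 3) (fun y ↦ ϕ (toSphere y) (Real.log ‖y‖)) y y =
        normalField f (ϕ (toSphere y) (Real.log ‖y‖)) := by
  set Ψ : E3 → M := fun y ↦ F (polar y) with hΨdef
  have hΨ : IsParam Ψ (annulus E3 1) := isParam_comp_polar hF
  obtain ⟨Y, hYs, hY⟩ := hΨ.exists_field (f := f) (fun y hy ↦ ne_zero_of_mem_annulus hy)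
    (fun y hy ↦ hf _ _ (mem_annulus_iff.1 hy).2)
  obtain ⟨Γ, h0, hcurve, hsurj, hinj, hsm⟩ := exists_annulus_flow hYs fun y hy ↦ (hY y hy).1
  obtain ⟨δ, hδ0, hδ1, hs, hi, hd⟩ := exists_isParam_flowMap h0 hcurve hinj hsm
  have hcurve' : ∀ x : S2, IsRadialCurve Y (Γ x) 1 := fun x ↦
    hcurve x (norm_eq_of_mem_sphere x)
  have hsub := annulus_mono (E := E3) hδ1.le
  have hdiff : ∀ y ∈ annulus E3 δ, DifferentiableAt ℝ (flowMap Γ) y := fun y hy ↦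
    (hs.contDiffAt ((isOpen_annulus δ).mem_nhds hy)).differentiableAt (by simp)
  have hcomp : ∀ y ∈ annulus E3 δ, ∀ v, mfderiv (𝓡 3) (𝓡 3) (fun y ↦ Ψ (flowMap Γ y)) y v =
      mfderiv (𝓡 3) (𝓡 3) Ψ (flowMap Γ y) (fderiv ℝ (flowMap Γ) y v) := by
    intro y hy v
    have h1 := mfderiv_comp y (hΨ.mdifferentiableAt (flowMap_mem hcurve (hsub hy)))
      (hdiff y hy).mdifferentiableAt
    rw [mfderiv_eq_fderiv] at h1
    exact DFunLike.congr_fun h1 v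
  refine ⟨fun x s ↦ Ψ (Γ x s), δ, hδ0, hδ1, fun x ↦ ?_, fun x s hs ↦ ?_, fun s hs ↦ ?_,
    fun x x' s hs h ↦ ?_, ⟨isOpen_annulus δ, ?_, ?_, fun y hy ↦ ?_⟩, fun y hy ↦ ?_⟩
  · have h1 := toSphere_exp_smul x 0
    rw [Real.exp_zero, one_smul] at h1
    simp only [h0, Ψ, polar, h1]
    rw [norm_eq_of_mem_sphere x, Real.log_one]
  · have hmem := (hcurve' x).mem_annulus hs
    have h1 := (hΨ.mdifferentiableAt hmem).hasMFDerivAt.comp s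
      (hcurve' x s hs).1.hasFDerivAt.hasMFDerivAt
    refine HasMFDerivAt.hasMFDerivWithinAt ?_
    refine h1.congr_mfderiv ?_
    ext
    have h2 : mfderiv (𝓡 3) (𝓡 3) Ψ (Γ x s) ((1 : ℝ) • Y (Γ x s)) = normalField f (Ψ (Γ x s)) := by
      rw [one_smul]; exact (hY _ hmem).2
    have h3 : (1 : ℝ) • normalField f (Ψ (Γ x s)) = normalField f (Ψ (Γ x s)) := one_smul _ _
    exact h2.trans h3.symm
  -- Along a flow line the logarithmic radius equals the time, so time s is mapped into the leaf of
  -- height s; every point of that leaf is reached because each point of the annulus lies on a flow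
  -- line from the sphere.
  · ext p
    constructor
    · rintro ⟨x, rfl⟩
      refine ⟨toSphere (Γ x s), ?_⟩
      simp only [Ψ, polar, (hcurve' x s hs).2.2]
    · rintro ⟨x, rfl⟩
      obtain ⟨x', hx', h⟩ := hsurj _ (exp_smul_sphere_mem_annulus x hs)
      refine ⟨⟨x', by simpa using hx'⟩, ?_⟩
      rw [norm_exp_smul_sphere, Real.log_exp] at h
      simp only [h, Ψ, polar, toSphere_exp_smul, norm_exp_smul_sphere, Real.log_exp]
  · have h1 := hΨ.injOn ((hcurve' x).mem_annulus hs) ((hcurve' x').mem_annulus hs) h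
    exact Subtype.ext (hinj x x' (norm_eq_of_mem_sphere x) (norm_eq_of_mem_sphere x') s hs h1)
  · exact hΨ.contMDiffOn.comp hs.contMDiffOn fun y hy ↦ flowMap_mem hcurve (hsub hy)
  · intro y hy z hz h
    exact hi (hsub hy) (hsub hz) (hΨ.injOn (flowMap_mem hcurve (hsub hy))
      (flowMap_mem hcurve (hsub hz)) h)
  · intro v w hvw
    refine hd y hy (hΨ.immersion _ (flowMap_mem hcurve (hsub hy)) ?_)
    exact (hcomp y hy v).symm.trans (hvw.trans (hcomp y hy w))
  · refine (hcomp y hy y).trans ?_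
    rw [fderiv_flowMap_self hcurve (hsub hy) (hdiff y hy)]
    exact (hY _ (flowMap_mem hcurve (hsub hy))).2

end

/-! ### Christoffel symbols under coordinate changes; mixed discriminants -/

section

section Christoffel

variable {G H : E3 → E3 →L[ℝ] E3 →L[ℝ] ℝ}

lemma christoffel_apply (G : E3 → E3 →L[ℝ] E3 →L[ℝ] ℝ) (y u v w : E3) :
    christoffel G y u v w =
      1 / 2 * (fderiv ℝ G y u v w + fderiv ℝ G y v u w - fderiv ℝ G y w u v) := rfl

lemma fderiv_metric_apply {E : Type*} [NormedAddCommGroup E] [NormedSpace ℝ E]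
    {G : E → E3 →L[ℝ] E3 →L[ℝ] ℝ} {y : E} (hG : DifferentiableAt ℝ G y) (a : E) (u v : E3) :
    fderiv ℝ G y a u v = fderiv ℝ (fun z ↦ G z u v) y a := by
  have h1 := (hG.hasFDerivAt.clm_apply (hasFDerivAt_const u y)).clm_apply (hasFDerivAt_const v y)
  rw [h1.fderiv]
  simp

set_option synthInstance.maxHeartbeats 400000 in
/-- The transformation law of the Christoffel symbols of the first kind. -/
lemma christoffel_pullback {g : E3 → E3} {y : E3} (hg : ContDiffAt ℝ 2 g y)
    (hG : DifferentiableAt ℝ G (g y)) (hsymm : ∀ a b, G (g y) a b = G (g y) b a)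
    (hHd : DifferentiableAt ℝ H y)
    (hH : ∀ᶠ z in 𝓝 y, ∀ u v, H z u v = G (g z) (fderiv ℝ g z u) (fderiv ℝ g z v)) (u v w : E3) :
    christoffel H y u v w =
      christoffel G (g y) (fderiv ℝ g y u) (fderiv ℝ g y v) (fderiv ℝ g y w) +
        G (g y) (fderiv ℝ (fderiv ℝ g) y u v) (fderiv ℝ g y w) := by
  have hg1 : HasFDerivAt g (fderiv ℝ g y) y := (hg.differentiableAt (by simp)).hasFDerivAt
  have hg2 : HasFDerivAt (fderiv ℝ g) (fderiv ℝ (fderiv ℝ g) y) y :=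
    ((hg.fderiv_right (m := 1) (by norm_num)).differentiableAt (by simp)).hasFDerivAt
  have key : ∀ a u v : E3, fderiv ℝ H y a u v =
      fderiv ℝ G (g y) (fderiv ℝ g y a) (fderiv ℝ g y u) (fderiv ℝ g y v) +
      G (g y) (fderiv ℝ (fderiv ℝ g) y a u) (fderiv ℝ g y v) +
      G (g y) (fderiv ℝ g y u) (fderiv ℝ (fderiv ℝ g) y a v) := by
    intro a u v
    rw [fderiv_metric_apply hHd]
    have h1 : HasFDerivAt (fun z ↦ G (g z) (fderiv ℝ g z u) (fderiv ℝ g z v)) _ y :=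
      ((hG.hasFDerivAt.comp y hg1).clm_apply (hg2.clm_apply (hasFDerivAt_const u y))).clm_apply
        (hg2.clm_apply (hasFDerivAt_const v y))
    have h2 : (fun z ↦ H z u v) =ᶠ[𝓝 y]
        fun z ↦ G (g z) (fderiv ℝ g z u) (fderiv ℝ g z v) := hH.mono fun z hz ↦ hz u v
    rw [h2.fderiv_eq, h1.fderiv]
    simp
    ring
  have hs : ∀ a b, fderiv ℝ (fderiv ℝ g) y a b = fderiv ℝ (fderiv ℝ g) y b a :=
    fun a b ↦ hg.isSymmSndFDerivAt (by simp) a b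
  -- In the alternating combination the second-derivative terms cancel in pairs, except G(D²g(u, v),
  -- Dg w), which appears twice and meets the factor 1/2.
  rw [christoffel_apply, christoffel_apply, key, key, key, hs v u, hs w u, hs w v,
    hsymm (fderiv ℝ g y v) (fderiv ℝ (fderiv ℝ g) y u w),
    hsymm (fderiv ℝ g y u) (fderiv ℝ (fderiv ℝ g) y v w)]
  ring

set_option synthInstance.maxHeartbeats 400000 in
lemma fderiv_fderiv_comp {E : Type*} [NormedAddCommGroup E] [NormedSpace ℝ E] {g : E3 → E3}
    {κ : E → E3} {x : E} (hg : ContDiffAt ℝ 2 g (κ x)) (hκ : ContDiffAt ℝ 2 κ x) (a b : E) :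
    fderiv ℝ (fderiv ℝ (fun z ↦ g (κ z))) x a b =
      fderiv ℝ (fderiv ℝ g) (κ x) (fderiv ℝ κ x a) (fderiv ℝ κ x b) +
        fderiv ℝ g (κ x) (fderiv ℝ (fderiv ℝ κ) x a b) := by
  have hg2 : HasFDerivAt (fderiv ℝ g) (fderiv ℝ (fderiv ℝ g) (κ x)) (κ x) :=
    ((hg.fderiv_right (m := 1) (by norm_num)).differentiableAt (by simp)).hasFDerivAt
  have hκ2 : HasFDerivAt (fderiv ℝ κ) (fderiv ℝ (fderiv ℝ κ) x) x :=
    ((hκ.fderiv_right (m := 1) (by norm_num)).differentiableAt (by simp)).hasFDerivAt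
  have hκ1 : HasFDerivAt κ (fderiv ℝ κ x) x := (hκ.differentiableAt (by simp)).hasFDerivAt
  have h1 : fderiv ℝ (fun z ↦ g (κ z)) =ᶠ[𝓝 x] fun z ↦ (fderiv ℝ g (κ z)).comp (fderiv ℝ κ z) := by
    filter_upwards [hκ.eventually (by simp),
      hκ.continuousAt.eventually (hg.eventually (by simp))] with z h2 h3
    exact fderiv_comp z (h3.differentiableAt (by simp)) (h2.differentiableAt (by simp))
  have h2 : HasFDerivAt (fun z ↦ (fderiv ℝ g (κ z)).comp (fderiv ℝ κ z)) _ x :=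
    (hg2.comp x hκ1).clm_comp hκ2
  rw [h1.fderiv_eq, h2.fderiv]
  simp [add_comm]

set_option synthInstance.maxHeartbeats 400000 in
/-- The radial component of the covariant derivatives of the coordinate fields of a surface that is
everywhere orthogonal to the radial direction. -/
lemma covariant_radial {E : Type*} [NormedAddCommGroup E] [NormedSpace ℝ E] {κ : E → E3} {x : E}
    (hκ : ContDiffAt ℝ 2 κ x) (hHd : DifferentiableAt ℝ H (κ x))
    (hsymm : ∀ y a b, H y a b = H y b a)
    (hrad : ∀ᶠ z in 𝓝 x, ∀ a, H (κ z) (κ z) (fderiv ℝ κ z a) = 0) (a b : E) :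
    H (κ x) (fderiv ℝ (fderiv ℝ κ) x a b) (κ x) +
        christoffel H (κ x) (fderiv ℝ κ x a) (fderiv ℝ κ x b) (κ x) =
      -(1 / 2) * (2 * H (κ x) (fderiv ℝ κ x a) (fderiv ℝ κ x b) +
        fderiv ℝ H (κ x) (κ x) (fderiv ℝ κ x a) (fderiv ℝ κ x b)) := by
  have hκ2 : HasFDerivAt (fderiv ℝ κ) (fderiv ℝ (fderiv ℝ κ) x) x :=
    ((hκ.fderiv_right (m := 1) (by norm_num)).differentiableAt (by simp)).hasFDerivAt
  have hκ1 : HasFDerivAt κ (fderiv ℝ κ x) x := (hκ.differentiableAt (by simp)).hasFDerivAt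
  have hsymm' : ∀ a u v, fderiv ℝ H (κ x) a u v = fderiv ℝ H (κ x) a v u := by
    intro a u v
    rw [fderiv_metric_apply hHd, fderiv_metric_apply hHd]
    simp_rw [hsymm _ u v]
  -- Differentiate the orthogonality H(κ, ∂_b κ) = 0 in the direction a. Adding this to its mirror
  -- image in a, b expresses D²κ through first derivatives: the second fundamental form is -1/2 of
  -- the Lie derivative of the metric.
  have key : ∀ a b : E, fderiv ℝ H (κ x) (fderiv ℝ κ x a) (κ x) (fderiv ℝ κ x b) +
      H (κ x) (fderiv ℝ κ x a) (fderiv ℝ κ x b) +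
      H (κ x) (κ x) (fderiv ℝ (fderiv ℝ κ) x a b) = 0 := by
    intro a b
    have h1 : HasFDerivAt (fun z ↦ H (κ z) (κ z) (fderiv ℝ κ z b)) _ x :=
      ((hHd.hasFDerivAt.comp x hκ1).clm_apply hκ1).clm_apply
        (hκ2.clm_apply (hasFDerivAt_const b x))
    have h2 : (fun z ↦ H (κ z) (κ z) (fderiv ℝ κ z b)) =ᶠ[𝓝 x] fun _ ↦ 0 :=
      hrad.mono fun z hz ↦ hz b
    have h3 := h1.congr_of_eventuallyEq h2.symm
    have h4 := DFunLike.congr_fun (h3.unique (hasFDerivAt_const (0 : ℝ) x)) a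
    simp at h4
    linarith
  have hs : fderiv ℝ (fderiv ℝ κ) x b a = fderiv ℝ (fderiv ℝ κ) x a b :=
    hκ.isSymmSndFDerivAt (by simp) b a
  have h1 := key a b
  have h2 := key b a
  rw [hs, hsymm _ (fderiv ℝ κ x b) (fderiv ℝ κ x a)] at h2
  rw [christoffel_apply, hsymm' _ (fderiv ℝ κ x b) (κ x), hsymm' _ (fderiv ℝ κ x a) (κ x),
    hsymm _ _ (κ x)]
  linarith

end Christoffel

section MixedDiscriminant

/-- The mixed discriminant of two bilinear forms on a pair of vectors. -/
noncomputable def mixedDisc (B H : E3 →L[ℝ] E3 →L[ℝ] ℝ) (v w : E3) : ℝ :=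
  B v v * H w w + B w w * H v v - 2 * (B v w * H v w)

/-- The mixed discriminant polarizes the Gram determinant, so it also scales by the square of the
determinant. Its sign therefore depends only on the plane spanned. -/
lemma mixedDisc_basis_change {B H : E3 →L[ℝ] E3 →L[ℝ] ℝ} (hB : ∀ a b, B a b = B b a)
    (hH : ∀ a b, H a b = H b a) (a b : E3) (p q r s : ℝ) :
    mixedDisc B H (p • a + q • b) (r • a + s • b) = (p * s - q * r) ^ 2 * mixedDisc B H a b := by
  simp only [mixedDisc, map_add, map_smul, add_apply, smul_apply, smul_eq_mul, hB b a, hH b a]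
  ring

end MixedDiscriminant

end

/-! ### Mean curvature of the leaves as radial growth of area -/

section

section

variable {M : Type*} [TopologicalSpace M] [ChartedSpace E3 M]
  {S : Type*} [TopologicalSpace S] [ChartedSpace E2 S]

/-- The derivative of a map into `M`, as a map into `ℝ³`. -/
noncomputable def surfaceDeriv (ι : S → M) (x : S) : E2 →L[ℝ] E3 := mfderiv (𝓡 2) (𝓡 3) ι x

lemma surfaceDeriv_eq {ι : S → M} {x : S} (h : MDifferentiableAt (𝓡 2) (𝓡 3) ι x) :
    surfaceDeriv ι x = fderiv ℝ (localRep ι x) (extChartAt (𝓡 2) x x) := by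
  have h1 : surfaceDeriv ι x =
      fderivWithin ℝ (localRep ι x) (range (𝓡 2)) (extChartAt (𝓡 2) x x) := h.mfderiv
  rw [h1, modelWithCornersSelf_coe, range_id, fderivWithin_univ]

end

variable {M : Type*} [TopologicalSpace M] [ChartedSpace E3 M]
  [Bundle.RiemannianBundle (fun x : M ↦ TangentSpace (𝓡 3) x)]

/-- The Riemannian metric at `p`, on the tangent space identified with `ℝ³` by the preferred
chart. -/
noncomputable def metricAt (p : M) : E3 →L[ℝ] E3 →L[ℝ] ℝ :=
  innerSL ℝ (E := TangentSpace (𝓡 3) p)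

lemma pullMetric_eq (Θ : E3 → M) (y v w : E3) :
    pullMetric Θ y v w = metricAt (Θ y) (chartDeriv Θ y v) (chartDeriv Θ y w) := rfl

lemma pullMetric_congr {Θ Θ' : E3 → M} {y : E3} (h : Θ =ᶠ[𝓝 y] Θ') (v w : E3) :
    pullMetric Θ y v w = pullMetric Θ' y v w := by
  have h1 : chartDeriv Θ y = chartDeriv Θ' y := h.mfderiv_eq
  rw [pullMetric_eq, pullMetric_eq, h1, h.self_of_nhds]

lemma pullMetric_comp {Θ : E3 → M} {g : E3 → E3} {y : E3}
    (hΘ : MDifferentiableAt (𝓡 3) (𝓡 3) Θ (g y)) (hg : DifferentiableAt ℝ g y) (v w : E3) :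
    pullMetric (fun z ↦ Θ (g z)) y v w =
      pullMetric Θ (g y) (fderiv ℝ g y v) (fderiv ℝ g y w) := by
  have h1 : ∀ v, chartDeriv (fun z ↦ Θ (g z)) y v = chartDeriv Θ (g y) (fderiv ℝ g y v) := by
    intro v
    have h2 := mfderiv_comp y hΘ hg.mdifferentiableAt
    rw [mfderiv_eq_fderiv] at h2
    exact DFunLike.congr_fun h2 v
  rw [pullMetric_eq, pullMetric_eq, h1, h1]

lemma coordMetric_comm (p : M) (y u v : E3) : coordMetric p y u v = coordMetric p y v u := by
  rw [coordMetric_eq, pullMetric_comm]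

lemma two_le_infty : (2 : ℕ∞ω) ≤ ∞ := WithTop.coe_le_coe.2 (le_top : (2 : ℕ∞) ≤ ⊤)

section Chart

variable [IsManifold (𝓡 3) ∞ M] {Θ : E3 → M} {N : Set E3}

/-- Mean curvature is defined in the preferred chart at p. Writing Θ as the inverse chart after the
coordinate map provides the hypothesis of `christoffel_pullback`, which moves the computation to Θ.
-/
lemma eventually_pullMetric_eq_coordMetric (h : IsParam Θ N) {y : E3} (hy : y ∈ N) {p : M}
    (hp : Θ y = p) : ∀ᶠ z in 𝓝 y, ∀ u v, pullMetric Θ z u v =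
      coordMetric p (extChartAt (𝓡 3) p (Θ z))
        (fderiv ℝ (fun z ↦ extChartAt (𝓡 3) p (Θ z)) z u)
        (fderiv ℝ (fun z ↦ extChartAt (𝓡 3) p (Θ z)) z v) := by
  have h1 : ∀ᶠ z in 𝓝 y, Θ z ∈ (extChartAt (𝓡 3) p).source :=
    (h.contMDiffAt hy).continuousAt.eventually_mem (hp ▸ extChartAt_source_mem_nhds (Θ y))
  filter_upwards [h1.eventually_nhds, h.isOpen.mem_nhds hy] with z hz hzN u v
  have hz0 := hz.self_of_nhds
  have h2 : Θ =ᶠ[𝓝 z] fun z ↦ (extChartAt (𝓡 3) p).symm (extChartAt (𝓡 3) p (Θ z)) := by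
    filter_upwards [hz] with z hz using ((extChartAt (𝓡 3) p).left_inv hz).symm
  rw [pullMetric_congr h2, coordMetric_eq]
  refine pullMetric_comp (g := fun z ↦ extChartAt (𝓡 3) p (Θ z)) ?_ ?_ u v
  · exact ((contMDiffOn_extChartAt_symm (n := ∞) p).contMDiffAt
      (extChartAt_target_mem_nhds' ((extChartAt (𝓡 3) p).map_source hz0))).mdifferentiableAt
      (by simp)
  · have h3 : ContMDiffAt (𝓡 3) 𝓘(ℝ, E3) ∞ (extChartAt (𝓡 3) p) (Θ z) :=
      contMDiffAt_extChartAt' (by rwa [← extChartAt_source (𝓡 3)])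
    exact (h3.comp z (h.contMDiffAt hzN)).contDiffAt.differentiableAt (by simp)

lemma differentiableAt_coordMetric
    [IsContMDiffRiemannianBundle (𝓡 3) ∞ E3 (fun x : M ↦ TangentSpace (𝓡 3) x)] (p : M) :
    DifferentiableAt ℝ (coordMetric p) (extChartAt (𝓡 3) p p) := by
  rw [coordMetric_eq]
  exact ((contDiffOn_pullMetric (isOpen_extChartAt_target p)
    (contMDiffOn_extChartAt_symm p)).contDiffAt (extChartAt_target_mem_nhds p)).differentiableAt
    (by simp)

end Chart

section Surface

variable {S : Type*} [TopologicalSpace S] [ChartedSpace E2 S]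

lemma firstFund_eq_metricAt (ι : S → M) (x : S) (i j : Fin 2) :
    firstFund ι x i j =
      metricAt (ι x) (surfaceDeriv ι x (basisVec i)) (surfaceDeriv ι x (basisVec j)) := rfl

lemma firstFund_eq {ι : S → M} {x : S} (h : MDifferentiableAt (𝓡 2) (𝓡 3) ι x) (i j : Fin 2) :
    firstFund ι x i j = metricAt (ι x) (coordDeriv ι x i) (coordDeriv ι x j) := by
  rw [firstFund_eq_metricAt, surfaceDeriv_eq h]; rfl

end Surface

section MeanCurvature

variable [IsManifold (𝓡 3) ∞ M]
  [IsContMDiffRiemannianBundle (𝓡 3) ∞ E3 (fun x : M ↦ TangentSpace (𝓡 3) x)]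
  {Θ : E3 → M} {N : Set E3} {f : M → ℝ} {S : Type*} [TopologicalSpace S] [ChartedSpace E2 S]

/-- The form whose value at vectors orthogonal to `y` is the logarithmic radial derivative of the
metric. -/
noncomputable def radialForm (H : E3 → E3 →L[ℝ] E3 →L[ℝ] ℝ) (y : E3) : E3 →L[ℝ] E3 →L[ℝ] ℝ :=
  (2 : ℝ) • H y + fderiv ℝ H y y

lemma radialForm_apply (H : E3 → E3 →L[ℝ] E3 →L[ℝ] ℝ) (y u v : E3) :
    radialForm H y u v = 2 * H y u v + fderiv ℝ H y y u v := by
  simp [radialForm]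

/-- A level surface of `f`, in a parametrization in which `f` is `log ‖y‖` and the radial direction
is orthogonal to the spheres: the coordinates `κ`, and the normal part of the covariant
derivatives. -/
lemma exists_surface_coords (h : IsParam Θ N) (hN : ∀ y ∈ N, y ≠ 0)
    (hf : ∀ y ∈ N, f (Θ y) = Real.log ‖y‖)
    (hX : ∀ y ∈ N, mfderiv (𝓡 3) (𝓡 3) Θ y y = normalField f (Θ y))
    (hrad : ∀ y ∈ N, ∀ w, inner ℝ y w = 0 → pullMetric Θ y y w = 0)
    {ι : S → M} {x : S} (hι : ContMDiffAt (𝓡 2) (𝓡 3) ∞ ι x) {s : ℝ} (hs : ∀ x', f (ι x') = s)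
    {y : E3} (hy : y ∈ N) (hp : Θ y = ι x) :
    ∃ k : E2 →L[ℝ] E3, (∀ v, inner ℝ y (k v) = 0) ∧
      (∀ v, inner ℝ (normalField f (ι x)) (mfderiv (𝓡 2) (𝓡 3) ι x v) = 0) ∧
      (∀ i j, firstFund ι x i j = pullMetric Θ y (k (basisVec i)) (k (basisVec j))) ∧
      ∀ i j, inner ℝ (normalField f (ι x)) (covDeriv ι x i j) =
        -(1 / 2) * radialForm (pullMetric Θ) y (k (basisVec i)) (k (basisVec j)) := by
  obtain ⟨Ξ, hΞ, hΞs⟩ := h.exists_inverse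
  have himg : Θ '' N ∈ 𝓝 (ι x) :=
    (h.isOpen_image h.isOpen subset_rfl).mem_nhds (hp ▸ mem_image_of_mem _ hy)
  set u₀ := extChartAt (𝓡 2) x x with hu₀
  -- The surface in the Θ-coordinates. As f is constant on it, κ stays on a sphere about the origin,
  -- so its tangent vectors are orthogonal to κ.
  let κ : E2 → E3 := fun u ↦ Ξ (ι ((extChartAt (𝓡 2) x).symm u))
  have hκ : ContDiffAt ℝ ∞ κ u₀ := by
    have h1 : ContMDiffAt (𝓡 2) (𝓡 3) ∞ (fun x' ↦ Ξ (ι x')) x :=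
      (hΞs.contMDiffAt himg).comp x hι
    have h2 := (contMDiffAt_iff.1 h1).2
    rw [modelWithCornersSelf_coe, range_id, contDiffWithinAt_univ] at h2
    exact h2
  have hsymm0 : (extChartAt (𝓡 2) x).symm u₀ = x := extChartAt_to_inv x
  have hκ0 : κ u₀ = y := by simp only [κ, hsymm0, ← hp, hΞ hy]
  have hev : ∀ᶠ u in 𝓝 u₀, ι ((extChartAt (𝓡 2) x).symm u) ∈ Θ '' N := by
    have h1 : ContinuousAt (fun u ↦ ι ((extChartAt (𝓡 2) x).symm u)) u₀ := by
      refine ContinuousAt.comp (g := ι) ?_ (continuousAt_extChartAt_symm x)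
      rw [hsymm0]; exact hι.continuousAt
    exact h1.eventually_mem (by rwa [hsymm0])
  have hev' : ∀ᶠ u in 𝓝 u₀, κ u ∈ N ∧ Θ (κ u) = ι ((extChartAt (𝓡 2) x).symm u) := by
    filter_upwards [hev] with u hu
    obtain ⟨z, hz, hz'⟩ := hu
    simp only [κ, ← hz', hΞ hz]
    exact ⟨hz, trivial⟩
  have hnorm : ∀ᶠ u in 𝓝 u₀, ‖κ u‖ ^ 2 = Real.exp s ^ 2 := by
    filter_upwards [hev'] with u hu
    have h1 := hf _ hu.1
    rw [hu.2, hs] at h1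
    rw [h1, Real.exp_log (norm_pos_iff.2 (hN _ hu.1))]
  have hκd : ∀ᶠ u in 𝓝 u₀, ContDiffAt ℝ 2 κ u :=
    (hκ.of_le two_le_infty).eventually (by simp)
  have horth : ∀ᶠ u in 𝓝 u₀, ∀ v, inner ℝ (κ u) (fderiv ℝ κ u v) = 0 := by
    filter_upwards [hnorm.eventually_nhds, hκd] with u hu hu' v
    have h1 := (hu'.differentiableAt (by simp)).hasFDerivAt.norm_sq
    have h2 : (fun u ↦ ‖κ u‖ ^ 2) =ᶠ[𝓝 u] fun _ ↦ Real.exp s ^ 2 := hu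
    have h3 := DFunLike.congr_fun
      ((h1.congr_of_eventuallyEq h2.symm).unique (hasFDerivAt_const _ u)) v
    simpa using h3
  set p := ι x with hpdef
  let g : E3 → E3 := fun z ↦ extChartAt (𝓡 3) p (Θ z)
  have hg : ContDiffAt ℝ ∞ g y := by
    have := h.contDiffAt_extChartAt_comp hy
    rwa [hp] at this
  have hg2 : ContDiffAt ℝ 2 g y := hg.of_le two_le_infty
  have hDg : fderiv ℝ g y = chartDeriv Θ y := by
    have := hasFDerivAt_extChartAt_comp (h.mdifferentiableAt hy)
    rw [hp] at this
    exact this.fderiv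
  have hgy : g y = extChartAt (𝓡 3) p p := by simp only [g, hp]
  have hHG := eventually_pullMetric_eq_coordMetric h hy hp
  have hmet : ∀ q, Θ y = q → ∀ u v, metricAt q (chartDeriv Θ y u) (chartDeriv Θ y v) =
      pullMetric Θ y u v := by
    rintro _ rfl u v; rfl
  have hmet' := hmet p hp
  have hXq : ∀ q, Θ y = q → (normalField f q : E3) = chartDeriv Θ y y := by
    rintro _ rfl; exact (hX y hy).symm
  have hX' := hXq p hp
  have hsurj : Function.Surjective (chartDeriv Θ y) := h.surjective_mfderiv hy
  have hmetG : ∀ a b, metricAt p a b = coordMetric p (g y) a b := by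
    intro a b
    obtain ⟨a, rfl⟩ := hsurj a
    obtain ⟨b, rfl⟩ := hsurj b
    rw [hmet', hHG.self_of_nhds, ← hDg]
  have hrep : localRep ι x =ᶠ[𝓝 u₀] fun u ↦ g (κ u) := by
    filter_upwards [hev'] with u hu
    simp only [g, hu.2]
    rfl
  have hκ2 : ContDiffAt ℝ 2 κ u₀ := hκ.of_le two_le_infty
  have hD1 : fderiv ℝ (localRep ι x) u₀ = (chartDeriv Θ y).comp (fderiv ℝ κ u₀) := by
    rw [hrep.fderiv_eq, ← hDg]
    have h1 : DifferentiableAt ℝ g (κ u₀) := by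
      rw [hκ0]; exact hg.differentiableAt (by simp)
    have := fderiv_comp u₀ h1 (hκ.differentiableAt (by simp))
    rw [hκ0] at this
    exact this
  have hcoord : ∀ i, coordDeriv ι x i = chartDeriv Θ y (fderiv ℝ κ u₀ (basisVec i)) := by
    intro i
    rw [coordDeriv, ← hu₀, hD1]; rfl
  have hmd : MDifferentiableAt (𝓡 2) (𝓡 3) ι x := hι.mdifferentiableAt (by simp)
  have horth0 : ∀ v, inner ℝ y (fderiv ℝ κ u₀ v) = 0 := by
    intro v
    have := horth.self_of_nhds v
    rwa [hκ0] at this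
  have hHd : DifferentiableAt ℝ (pullMetric Θ) y :=
    ((contDiffOn_pullMetric h.isOpen h.contMDiffOn).contDiffAt
      (h.isOpen.mem_nhds hy)).differentiableAt (by simp)
  refine ⟨fderiv ℝ κ u₀, horth0, fun v ↦ ?_, fun i j ↦ ?_, fun i j ↦ ?_⟩
  · have h1 : metricAt p (normalField f p) (surfaceDeriv ι x v) = 0 := by
      rw [surfaceDeriv_eq hmd, ← hu₀, hD1, hX']
      exact (hmet' _ _).trans (hrad y hy _ (horth0 v))
    exact h1
  · rw [firstFund_eq hmd, hcoord, hcoord]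
    exact hmet' _ _
  · have h1 : inner ℝ (normalField f p) (covDeriv ι x i j) =
        coordMetric p (g y) (chartDeriv Θ y y) (coordDeriv₂ ι x i j) +
          christoffelTerm ι x i j (chartDeriv Θ y y) := by
      have e1 : metricAt p (normalField f p) (coordDeriv₂ ι x i j) =
          coordMetric p (g y) (chartDeriv Θ y y) (coordDeriv₂ ι x i j) := by
        rw [← hX']; exact hmetG _ _
      have e2 : inner ℝ (normalField f p) ((InnerProductSpace.toDual ℝ
          (TangentSpace (𝓡 3) p)).symm (christoffelTerm ι x i j)) =
          christoffelTerm ι x i j (normalField f p) := by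
        rw [real_inner_comm, InnerProductSpace.toDual_symm_apply]
      have e3 : christoffelTerm ι x i j (normalField f p) =
          christoffelTerm ι x i j (chartDeriv Θ y y) :=
        congrArg (fun z : E3 ↦ christoffelTerm ι x i j z) hX'
      rw [← e1, ← e3, ← e2]
      exact inner_add_right _ _ _
    have h2 : (coordDeriv₂ ι x i j : E3) =
        fderiv ℝ (fderiv ℝ g) y (fderiv ℝ κ u₀ (basisVec i)) (fderiv ℝ κ u₀ (basisVec j)) +
        chartDeriv Θ y (fderiv ℝ (fderiv ℝ κ) u₀ (basisVec i) (basisVec j)) := by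
      have h3 := fderiv_fderiv_comp (g := g) (κ := κ) (x := u₀) (by rwa [hκ0]) hκ2
        (basisVec i) (basisVec j)
      rw [hκ0, hDg] at h3
      rw [← h3, ← hrep.fderiv.fderiv_eq]
      rfl
    have h4 : christoffelTerm ι x i j (chartDeriv Θ y y) =
        christoffel (coordMetric p) (g y) (fderiv ℝ g y (fderiv ℝ κ u₀ (basisVec i)))
          (fderiv ℝ g y (fderiv ℝ κ u₀ (basisVec j))) (fderiv ℝ g y y) := by
      rw [christoffelTerm, hcoord, hcoord, hDg, hgy]
      rfl
    have h5 := christoffel_pullback (G := coordMetric p) (H := pullMetric Θ) hg2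
      (by rw [hgy]; exact differentiableAt_coordMetric p) (coordMetric_comm p _) hHd hHG
      (fderiv ℝ κ u₀ (basisVec i)) (fderiv ℝ κ u₀ (basisVec j)) y
    have h6 := covariant_radial (H := pullMetric Θ) (κ := κ) (x := u₀) hκ2 (by rwa [hκ0])
      (pullMetric_comm Θ) (by
        filter_upwards [horth, hev'] with u hu hu' a using hrad _ hu'.1 _ (hu a))
      (basisVec i) (basisVec j)
    rw [hκ0, ← radialForm_apply] at h6
    have h7 : coordMetric p (g y) (chartDeriv Θ y y)
        (chartDeriv Θ y (fderiv ℝ (fderiv ℝ κ) u₀ (basisVec i) (basisVec j))) =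
        pullMetric Θ y (fderiv ℝ (fderiv ℝ κ) u₀ (basisVec i) (basisVec j)) y := by
      rw [← hmetG, hmet', pullMetric_comm]
    -- The chain-rule term D²g in ∂_i∂_j ι cancels against the inhomogeneous term of the Christoffel
    -- transformation law; what is left is the covariant derivative in Θ-coordinates, given by
    -- `covariant_radial`.
    rw [h1, h2, map_add, h7, h4, ← h6, h5, coordMetric_comm p (g y) (chartDeriv Θ y y), hDg]
    ring

/-- If the mean curvature vector of a level surface of `f` points against the gradient, then the
area element of the level surfaces increases in the radial direction. -/
theorem mixedDisc_radialForm_pos (h : IsParam Θ N) (hN : ∀ y ∈ N, y ≠ 0)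
    (hf : ∀ y ∈ N, f (Θ y) = Real.log ‖y‖)
    (hX : ∀ y ∈ N, mfderiv (𝓡 3) (𝓡 3) Θ y y = normalField f (Θ y))
    (hrad : ∀ y ∈ N, ∀ w, inner ℝ y w = 0 → pullMetric Θ y y w = 0)
    {ι : S → M} {x : S} (hι : ContMDiffAt (𝓡 2) (𝓡 3) ∞ ι x) {s : ℝ} (hs : ∀ x', f (ι x') = s)
    {y : E3} (hy : y ∈ N) (hp : Θ y = ι x)
    (hneg : inner ℝ (gradient f (ι x)) (meanCurvatureVector ι x) < 0) {v w : E3}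
    (hv : inner ℝ y v = 0) (hw : inner ℝ y w = 0) (hvw : LinearIndependent ℝ ![v, w]) :
    0 < mixedDisc (radialForm (pullMetric Θ) y) (pullMetric Θ y) v w := by
  obtain ⟨k, hk, hnor, hfund, hcov⟩ := exists_surface_coords h hN hf hX hrad hι hs hy hp
  set H := pullMetric Θ y with hH
  set B := radialForm (pullMetric Θ) y with hB
  set a := k (basisVec 0)
  set b := k (basisVec 1)
  have hHsymm : ∀ u v, H u v = H v u := pullMetric_comm Θ y
  have hHd : DifferentiableAt ℝ (pullMetric Θ) y :=
    ((contDiffOn_pullMetric h.isOpen h.contMDiffOn).contDiffAt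
      (h.isOpen.mem_nhds hy)).differentiableAt (by simp)
  have hBsymm : ∀ u v, B u v = B v u := by
    intro u v
    rw [hB, radialForm_apply, radialForm_apply, fderiv_metric_apply hHd, fderiv_metric_apply hHd,
      pullMetric_comm]
    simp_rw [pullMetric_comm Θ _ u v]
  have hgrad : 0 < ‖gradient f (ι x)‖ ^ 2 := by
    have : gradient f (ι x) ≠ 0 := by
      intro h0
      rw [h0, inner_zero_left] at hneg
      exact lt_irrefl _ hneg
    have := norm_pos_iff.2 this
    positivity
  have hneg' : inner ℝ (normalField f (ι x))
      (∑ i, ∑ j, (firstFund ι x)⁻¹ i j • covDeriv ι x i j) < 0 := by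
    -- X is normal to the surface, so the normal projection in the mean curvature vector can be
    -- moved onto X and disappears.
    have hmem : normalField f (ι x) ∈ ((mfderiv (𝓡 2) (𝓡 3) ι x).range)ᗮ := by
      rw [Submodule.mem_orthogonal]
      rintro _ ⟨u, rfl⟩
      rw [real_inner_comm]
      exact hnor u
    have h1 : inner ℝ (normalField f (ι x)) (meanCurvatureVector ι x) < 0 := by
      rw [normalField, real_inner_smul_left]
      exact mul_neg_of_pos_of_neg (inv_pos.2 hgrad) hneg
    rw [meanCurvatureVector, ← Submodule.inner_starProjection_left_eq_right,
      Submodule.starProjection_eq_self_iff.2 hmem] at h1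
    exact h1
  -- By the adjugate formula, the trace of B with respect to a 2 × 2 metric is the mixed
  -- discriminant divided by the Gram determinant.
  have hsum : inner ℝ (normalField f (ι x))
      (∑ i, ∑ j, (firstFund ι x)⁻¹ i j • covDeriv ι x i j) =
      -(1 / 2) * ((H a a * H b b - H a b * H a b)⁻¹ * mixedDisc B H a b) := by
    have hinv : (firstFund ι x)⁻¹ =
        (H a a * H b b - H a b * H a b)⁻¹ • !![H b b, -H a b; -H a b, H a a] := by
      have : firstFund ι x = !![H a a, H a b; H a b, H b b] := by
        ext i j
        rw [hfund]
        fin_cases i <;> fin_cases j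
        · rfl
        · rfl
        · exact hHsymm _ _
        · rfl
      rw [this, Matrix.inv_def, Matrix.det_fin_two_of, Matrix.adjugate_fin_two_of,
        Ring.inverse_eq_inv']
    have hℓ : inner ℝ (normalField f (ι x))
        (∑ i, ∑ j, (firstFund ι x)⁻¹ i j • covDeriv ι x i j) =
        ∑ i, ∑ j, (firstFund ι x)⁻¹ i j *
          (-(1 / 2) * B (k (basisVec i)) (k (basisVec j))) := by
      rw [← innerSL_apply_apply ℝ, map_sum]
      refine Finset.sum_congr rfl fun i _ ↦ ?_
      rw [map_sum]
      refine Finset.sum_congr rfl fun j _ ↦ ?_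
      rw [map_smul, innerSL_apply_apply, hcov, smul_eq_mul]
    rw [hℓ]
    simp only [Fin.sum_univ_two, hinv, Matrix.smul_apply,
      Matrix.of_apply, Matrix.cons_val', Matrix.cons_val_zero, Matrix.cons_val_one,
      smul_eq_mul, mixedDisc, Matrix.cons_val_fin_one]
    rw [hBsymm (k (basisVec 1)) (k (basisVec 0))]
    ring
  rw [hsum] at hneg'
  -- With a zero determinant the inverse is zero by convention and so is the trace, against its
  -- negativity. Thus the strict curvature inequality itself forces ι to be an immersion at x.
  have hdet : H a a * H b b - H a b * H a b ≠ 0 := by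
    intro h0
    rw [h0] at hneg'
    simp at hneg'
  have hdet' : 0 < H a a * H b b - H a b * H a b := by
    refine lt_of_le_of_ne ?_ hdet.symm
    have := real_inner_mul_inner_self_le (F := TangentSpace (𝓡 3) (Θ y))
      (mfderiv (𝓡 3) (𝓡 3) Θ y a) (mfderiv (𝓡 3) (𝓡 3) Θ y b)
    rw [sub_nonneg]
    exact this
  have hpos : 0 < mixedDisc B H a b := by
    by_contra hle
    have : (H a a * H b b - H a b * H a b)⁻¹ * mixedDisc B H a b ≤ 0 :=
      mul_nonpos_of_nonneg_of_nonpos (inv_pos.2 hdet').le (not_lt.1 hle)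
    linarith
  have hab : LinearIndependent ℝ ![a, b] := by
    rw [LinearIndependent.pair_iff]
    intro c d hcd
    have h1 : H a (c • a + d • b) = 0 := by rw [hcd, map_zero]
    have h2 : H b (c • a + d • b) = 0 := by rw [hcd, map_zero]
    simp only [map_add, map_smul, smul_eq_mul, hHsymm b a] at h1 h2
    constructor
    · have : c * (H a a * H b b - H a b * H a b) = 0 := by linear_combination H b b * h1 - H a b * h2
      exact (mul_eq_zero.1 this).resolve_right hdet
    · have : d * (H a a * H b b - H a b * H a b) = 0 := by linear_combination H a a * h2 - H a b * h1
      exact (mul_eq_zero.1 this).resolve_right hdet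
  -- Both planes have dimension 2, so positivity on the coordinate vectors a, b passes to every
  -- independent pair orthogonal to y.
  have hspan : Submodule.span ℝ (range ![a, b]) = (Submodule.span ℝ {y})ᗮ := by
    refine Submodule.eq_of_le_of_finrank_eq ?_ ?_
    · rw [Submodule.span_le]
      rintro _ ⟨i, rfl⟩
      rw [SetLike.mem_coe, Submodule.mem_orthogonal_singleton_iff_inner_right]
      fin_cases i
      · exact hk _
      · exact hk _
    · rw [finrank_span_eq_card hab, Fintype.card_fin]
      have : Fact (Module.finrank ℝ E3 = 2 + 1) := ⟨finrank_euclideanSpace_fin⟩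
      exact (Submodule.finrank_orthogonal_span_singleton (hN y hy)).symm
  have hmemspan : ∀ v, inner ℝ y v = 0 → ∃ c d : ℝ, c • a + d • b = v := by
    intro v hv
    have h1 : v ∈ Submodule.span ℝ (range ![a, b]) := by
      rw [hspan, Submodule.mem_orthogonal_singleton_iff_inner_right]; exact hv
    rw [Matrix.range_cons, Matrix.range_cons, Matrix.range_empty, union_empty,
      Set.singleton_union, Submodule.mem_span_pair] at h1
    exact h1
  obtain ⟨c, d, rfl⟩ := hmemspan v hv
  obtain ⟨c', d', rfl⟩ := hmemspan w hw
  rw [mixedDisc_basis_change hBsymm hHsymm]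
  have : c * d' - d * c' ≠ 0 := by
    intro h0
    rw [LinearIndependent.pair_iff] at hvw
    have h1 := hvw d' (-d) (by
      rw [smul_add, smul_add, smul_smul, smul_smul, smul_smul, smul_smul]
      have e1 : d' * c + -d * c' = 0 := by linarith
      have e2 : d' * d + -d * d' = 0 := by ring
      calc _ = (d' * c + -d * c') • a + (d' * d + -d * d') • b := by module
        _ = 0 := by rw [e1, e2]; simp)
    have h2 := hvw c' (-c) (by
      have e1 : c' * c + -c * c' = 0 := by ring
      have e2 : c' * d + -c * d' = 0 := by linarith
      calc _ = (c' * c + -c * c') • a + (c' * d + -c * d') • b := by module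
        _ = 0 := by rw [e1, e2]; simp)
    have h3 : c = 0 := by linarith [h2.2]
    have h4 : d = 0 := by linarith [h1.2]
    have h5 := hvw 1 0 (by rw [h3, h4]; simp)
    exact one_ne_zero h5.1
  positivity

end MeanCurvature

end

/-! ### Coordinates adapted to a contracting foliation -/

section

variable {M : Type*} [TopologicalSpace M] [ChartedSpace E3 M]
  [Bundle.RiemannianBundle (fun x : M ↦ TangentSpace (𝓡 3) x)]

/-- The radial direction is orthogonal to the spheres. -/
lemma IsParam.pullMetric_radial {Θ : E3 → M} {N : Set E3} (h : IsParam Θ N) {f : M → ℝ}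
    (hN : ∀ y ∈ N, y ≠ 0) (hf : ∀ y ∈ N, f (Θ y) = Real.log ‖y‖)
    (hX : ∀ y ∈ N, mfderiv (𝓡 3) (𝓡 3) Θ y y = normalField f (Θ y))
    {y : E3} (hy : y ∈ N) {w : E3} (hw : inner ℝ y w = 0) : pullMetric Θ y y w = 0 := by
  have h1 : pullMetric Θ y y w =
      inner ℝ (normalField f (Θ y)) (mfderiv (𝓡 3) (𝓡 3) Θ y w) :=
    congrArg (fun z : E3 ↦ metricAt (Θ y) z (chartDeriv Θ y w)) (hX y hy)
  rw [h1, normalField, real_inner_smul_left, h.inner_gradient hN hf hy, logNormDeriv_apply, hw,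
    mul_zero, mul_zero]

variable [IsManifold (𝓡 3) ∞ M]
  [IsContMDiffRiemannianBundle (𝓡 3) ∞ E3 (fun x : M ↦ TangentSpace (𝓡 3) x)]

/-- Flow coordinates for a contracting foliation: the metric splits orthogonally in the radial and
the spherical directions, and the area elements of the spheres increase with the radius. -/
theorem exists_contracting_coords {F : S2 × ℝ → M} (hF : IsSphereFoliation F) {f : M → ℝ}
    (hf : ∀ x, ∀ s ∈ Ioo (-1 : ℝ) 1, f (F (x, s)) = s) (hcontr : IsContractingHalf F f) :
    ∃ (ϕ : S2 → ℝ → M) (Θ : E3 → M) (δ : ℝ), 0 < δ ∧ δ < 1 ∧ (∀ x, ϕ x 0 = F (x, 0)) ∧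
      (∀ x, IsMIntegralCurveOn (I := 𝓡 3) (ϕ x) (normalField f) (Ioo (-1) 1)) ∧
      (∀ s ∈ Ioo (-1 : ℝ) 1, range (fun x ↦ ϕ x s) = leaf F s) ∧
      (∀ x x', ∀ s ∈ Ioo (-1 : ℝ) 1, ϕ x s = ϕ x' s → x = x') ∧
      (∀ y, Θ y = ϕ (toSphere y) (Real.log ‖y‖)) ∧ IsParam Θ (annulus E3 δ) ∧
      (∀ y ∈ annulus E3 δ, ∀ w, inner ℝ y w = 0 → pullMetric Θ y y w = 0) ∧
      ∀ y ∈ annulus E3 δ, 1 < ‖y‖ → ∀ v w, inner ℝ y v = 0 → inner ℝ y w = 0 →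
        LinearIndependent ℝ ![v, w] →
        0 < mixedDisc (radialForm (pullMetric Θ) y) (pullMetric Θ y) v w := by
  obtain ⟨ϕ, δ, hδ0, hδ1, h0, hint, hleaf, hinj, hP, hX⟩ := exists_flow_foliation hF hf
  have hlog : ∀ y ∈ annulus E3 δ, Real.log ‖y‖ ∈ Ioo (-1 : ℝ) 1 := fun y hy ↦
    (mem_annulus_iff.1 (annulus_mono hδ1.le hy)).2
  have hmem : ∀ y ∈ annulus E3 δ, ∃ x, F (x, Real.log ‖y‖) = ϕ (toSphere y) (Real.log ‖y‖) := by
    intro y hy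
    have : ϕ (toSphere y) (Real.log ‖y‖) ∈ leaf F (Real.log ‖y‖) := by
      rw [← hleaf _ (hlog y hy)]; exact mem_range_self _
    exact this
  have hfΘ : ∀ y ∈ annulus E3 δ, f (ϕ (toSphere y) (Real.log ‖y‖)) = Real.log ‖y‖ := by
    intro y hy
    obtain ⟨x, hx⟩ := hmem y hy
    rw [← hx, hf _ _ (hlog y hy)]
  have hne : ∀ y ∈ annulus E3 δ, y ≠ 0 := fun y hy ↦ ne_zero_of_mem_annulus hy
  have hrad : ∀ y ∈ annulus E3 δ, ∀ w, inner ℝ y w = 0 →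
      pullMetric (fun y ↦ ϕ (toSphere y) (Real.log ‖y‖)) y y w = 0 := fun y hy w hw ↦
    hP.pullMetric_radial hne hfΘ hX hy hw
  refine ⟨ϕ, _, δ, hδ0, hδ1, h0, hint, hleaf, hinj, fun _ ↦ rfl, hP, hrad, ?_⟩
  intro y hy hy1 v w hv hw hvw
  -- The curvature hypothesis concerns the parametrization F of the leaf. The point of S² that F
  -- sends to this position is in general not `toSphere y`, since flow lines need not follow the
  -- fibres of F.
  obtain ⟨x, hx⟩ := hmem y hy
  have hs : Real.log ‖y‖ ∈ Ioo (0 : ℝ) 1 := ⟨Real.log_pos hy1, (hlog y hy).2⟩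
  have hι : ContMDiffAt (𝓡 2) (𝓡 3) ∞ (fun x' ↦ F (x', Real.log ‖y‖)) x := by
    have h1 : ContMDiffAt ((𝓡 2).prod 𝓘(ℝ, ℝ)) (𝓡 3) ∞ F (x, Real.log ‖y‖) :=
      hF.contMDiffOn.contMDiffAt
        ((isOpen_univ.prod isOpen_Ioo).mem_nhds ⟨mem_univ _, hlog y hy⟩)
    exact h1.comp x (contMDiffAt_id.prodMk contMDiffAt_const)
  exact mixedDisc_radialForm_pos hP hne hfΘ hX hrad hι (fun x' ↦ hf _ _ (hlog y hy)) hy hx.symm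
    (hcontr _ hs x) hv hw hvw

end

/-! ### Gram determinants and change of surface patch -/

section

/-- The Gram determinant of two vectors. -/
noncomputable def gram (B : E3 →L[ℝ] E3 →L[ℝ] ℝ) (v w : E3) : ℝ := B v v * B w w - B v w * B v w

lemma gram_basis_change {B : E3 →L[ℝ] E3 →L[ℝ] ℝ} (hB : ∀ a b, B a b = B b a) (a b : E3)
    (p q r s : ℝ) :
    gram B (p • a + q • b) (r • a + s • b) = (p * s - q * r) ^ 2 * gram B a b := by
  simp only [gram, map_add, map_smul, add_apply, smul_apply, smul_eq_mul, hB b a]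
  ring

lemma gram_nonneg {B : E3 →L[ℝ] E3 →L[ℝ] ℝ} (hB : ∀ a b, B a b = B b a) (hB0 : ∀ a, 0 ≤ B a a)
    (v w : E3) : 0 ≤ gram B v w := by
  have h1 : ∀ t : ℝ, 0 ≤ B w w * (t * t) + (2 * B v w) * t + B v v := by
    intro t
    have := hB0 (v + t • w)
    simp only [map_add, map_smul, add_apply, smul_apply, smul_eq_mul, hB w v] at this
    linarith
  have := discrim_le_zero h1
  rw [discrim] at this
  rw [gram]
  nlinarith

lemma gram_pos {B : E3 →L[ℝ] E3 →L[ℝ] ℝ} (hB : ∀ a b, B a b = B b a)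
    (hB0 : ∀ a, a ≠ 0 → 0 < B a a) {v w : E3} (hvw : LinearIndependent ℝ ![v, w]) :
    0 < gram B v w := by
  have hw : 0 < B w w := hB0 w (hvw.ne_zero 1)
  -- Up to the factor B(w, w), this is the component of v orthogonal to w; its square length is B(w,
  -- w) times the Gram determinant.
  have h1 : B w w • v - B v w • w ≠ 0 := by
    intro h0
    have := LinearIndependent.pair_iff.1 hvw (B w w) (-(B v w)) (by rw [← h0]; module)
    exact hw.ne' this.1
  have h2 := hB0 _ h1
  simp only [map_sub, map_smul, sub_apply, smul_apply, smul_eq_mul, hB w v] at h2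
  have h3 : 0 < B w w * gram B v w := by rw [gram]; linarith
  exact pos_of_mul_pos_right h3 hw.le

/-- The Gram determinant of the coordinate vectors of a parametrized surface in `ℝ³`. -/
noncomputable def gramDensity (H : E3 → E3 →L[ℝ] E3 →L[ℝ] ℝ) (ψ : E2 → E3) (u : E2) : ℝ :=
  gram (H (ψ u)) (fderiv ℝ ψ u (basisVec 0)) (fderiv ℝ ψ u (basisVec 1))

lemma linearIndependent_basisVec : LinearIndependent ℝ ![basisVec 0, basisVec 1] := by
  rw [LinearIndependent.pair_iff]
  intro a b hab
  have h0 := congrFun (congrArg WithLp.ofLp hab) 0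
  have h1 := congrFun (congrArg WithLp.ofLp hab) 1
  simp [basisVec] at h0 h1
  exact ⟨h0, h1⟩

lemma eq_basisVec_combination (v : E2) : v = v 0 • basisVec 0 + v 1 • basisVec 1 := by
  ext i
  fin_cases i <;> simp [basisVec]

lemma linearIndependent_map_basisVec {D : E2 →L[ℝ] E3} (hD : Function.Injective D) :
    LinearIndependent ℝ ![D (basisVec 0), D (basisVec 1)] := by
  have := linearIndependent_basisVec.map' D.toLinearMap (LinearMap.ker_eq_bot.2 hD)
  have h2 : ![D (basisVec 0), D (basisVec 1)] = D.toLinearMap ∘ ![basisVec 0, basisVec 1] := by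
    ext1 i
    fin_cases i <;> rfl
  rwa [h2]

lemma det_eq_basisVec (T : E2 →L[ℝ] E2) :
    T.det = T (basisVec 0) 0 * T (basisVec 1) 1 - T (basisVec 0) 1 * T (basisVec 1) 0 := by
  have h : T.det = LinearMap.det (T : E2 →ₗ[ℝ] E2) := rfl
  rw [h, ← LinearMap.det_toMatrix (EuclideanSpace.basisFun (Fin 2) ℝ).toBasis,
    Matrix.det_fin_two]
  simp only [LinearMap.toMatrix_apply, OrthonormalBasis.coe_toBasis, EuclideanSpace.basisFun_apply,
    OrthonormalBasis.coe_toBasis_repr_apply, EuclideanSpace.basisFun_repr, basisVec]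
  change _ * _ - _ * _ = _ * _ - _ * _
  simp only [ContinuousLinearMap.coe_coe]
  ring

lemma gram_comp {B : E3 →L[ℝ] E3 →L[ℝ] ℝ} (hB : ∀ a b, B a b = B b a) (D : E2 →L[ℝ] E3)
    (T : E2 →L[ℝ] E2) :
    gram B (D (T (basisVec 0))) (D (T (basisVec 1))) =
      T.det ^ 2 * gram B (D (basisVec 0)) (D (basisVec 1)) := by
  rw [det_eq_basisVec, ← gram_basis_change hB, ← map_smul, ← map_smul, ← map_smul, ← map_smul,
    ← map_add, ← map_add, ← eq_basisVec_combination, ← eq_basisVec_combination]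

/-- A regular parametrized patch of a surface in `ℝ³`. -/
structure IsRegularPatch (ψ : E2 → E3) (U : Set E2) : Prop where
  isOpen : IsOpen U
  contDiffOn : ContDiffOn ℝ ∞ ψ U
  injOn : InjOn ψ U
  immersion : ∀ u ∈ U, Function.Injective (fderiv ℝ ψ u)

namespace IsRegularPatch

variable {ψ ψ' : E2 → E3} {U U' : Set E2}

lemma contDiffAt (h : IsRegularPatch ψ U) {u : E2} (hu : u ∈ U) : ContDiffAt ℝ ∞ ψ u :=
  h.contDiffOn.contDiffAt (h.isOpen.mem_nhds hu)

lemma differentiableAt (h : IsRegularPatch ψ U) {u : E2} (hu : u ∈ U) : DifferentiableAt ℝ ψ u :=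
  (h.contDiffAt hu).differentiableAt (by simp)

lemma continuousOn_gramDensity {H : E3 → E3 →L[ℝ] E3 →L[ℝ] ℝ} {N : Set E3}
    (hH : ContinuousOn H N) (h : IsRegularPatch ψ U) (hψ : MapsTo ψ U N) :
    ContinuousOn (gramDensity H ψ) U := by
  have h1 : ContinuousOn (fun u ↦ H (ψ u)) U := hH.comp h.contDiffOn.continuousOn hψ
  have h2 : ContinuousOn (fderiv ℝ ψ) U :=
    h.contDiffOn.continuousOn_fderiv_of_isOpen h.isOpen (by simp)
  have h3 : ∀ i j, ContinuousOn
      (fun u ↦ H (ψ u) (fderiv ℝ ψ u (basisVec i)) (fderiv ℝ ψ u (basisVec j))) U := fun i j ↦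
    (h1.clm_apply (h2.clm_apply continuousOn_const)).clm_apply (h2.clm_apply continuousOn_const)
  exact ((h3 0 0).mul (h3 1 1)).sub ((h3 0 1).mul (h3 0 1))

lemma gramDensity_pos {H : E3 → E3 →L[ℝ] E3 →L[ℝ] ℝ} (h : IsRegularPatch ψ U) {u : E2}
    (hu : u ∈ U) (hH : ∀ a b, H (ψ u) a b = H (ψ u) b a) (hH0 : ∀ a, a ≠ 0 → 0 < H (ψ u) a a) :
    0 < gramDensity H ψ u :=
  gram_pos hH hH0 (linearIndependent_map_basisVec (h.immersion u hu))

/-- A continuous map between the domains of two patches, compatible with the patches, is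
differentiable. -/
lemma differentiableAt_transition (h : IsRegularPatch ψ U) (h' : IsRegularPatch ψ' U')
    {τ : E2 → E2} {u : E2} (hu : u ∈ U') (hτu : τ u ∈ U) (hτ : ContinuousAt τ u)
    (heq : ∀ᶠ z in 𝓝 u, ψ (τ z) = ψ' z) : DifferentiableAt ℝ τ u := by
  have hker : (fderiv ℝ ψ (τ u)).ker = ⊥ :=
    LinearMap.ker_eq_bot.2 (h.immersion _ hτu)
  -- Composing ψ with a linear left inverse of its derivative gives a local diffeomorphism of the
  -- plane; τ is its local inverse applied to l ∘ ψ'.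
  obtain ⟨l, hl⟩ := (fderiv ℝ ψ (τ u)).toLinearMap.exists_leftInverse_of_injective hker
  let l' : E3 →L[ℝ] E2 := l.toContinuousLinearMap
  have hs : HasStrictFDerivAt (fun z ↦ l' (ψ z))
      ((ContinuousLinearEquiv.refl ℝ E2 : E2 ≃L[ℝ] E2) : E2 →L[ℝ] E2) (τ u) := by
    have h1 : HasStrictFDerivAt (fun z ↦ l' (ψ z)) (l'.comp (fderiv ℝ ψ (τ u))) (τ u) :=
      l'.hasStrictFDerivAt.comp (τ u) ((h.contDiffAt hτu).hasStrictFDerivAt (by simp))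
    refine h1.congr_fderiv ?_
    ext v : 1
    exact LinearMap.congr_fun hl v
  have hg := hs.to_localInverse.hasFDerivAt.differentiableAt
  have hev : τ =ᶠ[𝓝 u] fun z ↦ hs.localInverse _ _ _ (l' (ψ' z)) := by
    filter_upwards [hτ.eventually hs.eventually_left_inverse, heq] with z hz hz'
    rw [← hz', hz]
  refine DifferentiableAt.congr_of_eventuallyEq ?_ hev
  refine DifferentiableAt.comp u (g := hs.localInverse _ _ _) (f := fun z ↦ l' (ψ' z)) ?_ ?_
  · rwa [← heq.self_of_nhds]
  · exact l'.differentiableAt.comp u (h'.differentiableAt hu)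

/-- Change of parametrization for the area integral. -/
lemma lintegral_transition (h : IsRegularPatch ψ U) (h' : IsRegularPatch ψ' U')
    (hU : IsEmbedding (U.domRestrict ψ)) {H : E3 → E3 →L[ℝ] E3 →L[ℝ] ℝ}
    (hH : ∀ y a b, H y a b = H y b a) {O A : Set E2} (hO : IsOpen O) (hOU : O ⊆ U')
    (hmaps : MapsTo ψ' O (ψ '' U)) (hA : MeasurableSet A) (hAO : A ⊆ O) :
    ∃ A', MeasurableSet A' ∧ A' ⊆ U ∧ ψ '' A' = ψ' '' A ∧
      ∫⁻ u in A', ENNReal.ofReal (Real.sqrt (gramDensity H ψ u)) =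
        ∫⁻ u in A, ENNReal.ofReal (Real.sqrt (gramDensity H ψ' u)) := by
  classical
  have hmaps' : ∀ u : E2, ∃ v, u ∈ O → v ∈ U ∧ ψ v = ψ' u := by
    intro u
    by_cases hu : u ∈ O
    · obtain ⟨v, hv, hv'⟩ := hmaps hu
      exact ⟨v, fun _ ↦ ⟨hv, hv'⟩⟩
    · exact ⟨u, fun h ↦ absurd h hu⟩
  choose τ hτ0 using hmaps'
  have hτU : ∀ {u}, u ∈ O → τ u ∈ U := fun hu ↦ (hτ0 _ hu).1
  have hτ : ∀ {u}, u ∈ O → ψ (τ u) = ψ' u := fun hu ↦ (hτ0 _ hu).2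
  -- This is where the embedding hypothesis enters: an injective immersion alone would not make the
  -- transition map continuous.
  have hcont : ContinuousOn τ O := by
    have h1 : Continuous fun z : O ↦ (⟨τ z, hτU z.2⟩ : U) := by
      rw [hU.continuous_iff]
      have h2 : (U.domRestrict ψ ∘ fun z : O ↦ (⟨τ z, hτU z.2⟩ : U)) = O.domRestrict ψ' := by
        ext1 z
        exact hτ z.2
      rw [h2]
      exact (h'.contDiffOn.continuousOn.mono hOU).domRestrict
    rw [continuousOn_iff_continuous_domRestrict]
    exact continuous_subtype_val.comp h1
  have hev : ∀ u ∈ O, ∀ᶠ z in 𝓝 u, ψ (τ z) = ψ' z := fun u hu ↦ by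
    filter_upwards [hO.mem_nhds hu] with z hz using hτ hz
  have hdiff : ∀ u ∈ O, DifferentiableAt ℝ τ u := fun u hu ↦
    h.differentiableAt_transition h' (hOU hu) (hτU hu) (hcont.continuousAt (hO.mem_nhds hu))
      (hev u hu)
  have hinj : InjOn τ A := by
    intro a ha b hb hab
    refine h'.injOn (hOU (hAO ha)) (hOU (hAO hb)) ?_
    rw [← hτ (hAO ha), ← hτ (hAO hb), hab]
  have hder : ∀ u ∈ A, HasFDerivWithinAt τ (fderiv ℝ τ u) A u := fun u hu ↦
    (hdiff u (hAO hu)).hasFDerivAt.hasFDerivWithinAt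
  refine ⟨τ '' A, measurable_image_of_fderivWithin hA hder hinj, ?_, ?_, ?_⟩
  · rintro _ ⟨a, ha, rfl⟩
    exact hτU (hAO ha)
  · rw [image_image]
    exact image_congr fun a ha ↦ hτ (hAO ha)
  · rw [lintegral_image_eq_lintegral_abs_det_fderiv_mul volume hA hder hinj]
    refine setLIntegral_congr_fun hA fun u hu ↦ ?_
    have huO := hAO hu
    have h1 : fderiv ℝ ψ' u = (fderiv ℝ ψ (τ u)).comp (fderiv ℝ τ u) := by
      rw [← fderiv_comp u (h.differentiableAt (hτU huO)) (hdiff u huO)]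
      exact Filter.EventuallyEq.fderiv_eq ((hev u huO).mono fun z hz ↦ hz.symm)
    have h2 : gramDensity H ψ' u = (fderiv ℝ τ u).det ^ 2 * gramDensity H ψ (τ u) := by
      rw [gramDensity, gramDensity, h1, ← hτ huO]
      exact gram_comp (hH _) _ _
    simp only [h2]
    rw [Real.sqrt_mul (sq_nonneg _), Real.sqrt_sq_eq_abs, ENNReal.ofReal_mul (abs_nonneg _)]

end IsRegularPatch

end

/-! ### Area of a surface as a sum over a countable atlas -/

section

/-- A countable atlas of a surface `V` in `ℝ³` by embedded patches `V ∩ W i`, with a decomposition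
of `V` into disjoint measurable pieces `V ∩ Z i` of the patches. -/
structure IsAtlas (V : Set E3) (ψ : ℕ → E2 → E3) (U : ℕ → Set E2) (W Z : ℕ → Set E3) : Prop where
  patch : ∀ i, IsRegularPatch (ψ i) (U i)
  isOpen : ∀ i, IsOpen (W i)
  image : ∀ i, ψ i '' U i = V ∩ W i
  isEmbedding : ∀ i, IsEmbedding ((U i).domRestrict (ψ i))
  subset : ∀ i, Z i ⊆ W i
  measurableSet : ∀ i, MeasurableSet (Z i)
  disjoint : Pairwise fun i j ↦ Disjoint (Z i) (Z j)
  cover : V ⊆ ⋃ i, Z i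

lemma _root_.ContinuousOn.measurableSet_inter_preimage' {α β : Type*} [TopologicalSpace α]
    [MeasurableSpace α] [BorelSpace α] [TopologicalSpace β] [MeasurableSpace β] [BorelSpace β]
    {g : α → β} {U : Set α} (hU : MeasurableSet U) (hg : ContinuousOn g U) {Z : Set β}
    (hZ : MeasurableSet Z) : MeasurableSet (U ∩ g ⁻¹' Z) := by
  have h1 : Measurable (U.domRestrict g) := hg.domRestrict.measurable
  have h2 := (MeasurableEmbedding.subtype_coe hU).measurableSet_image.2 (h1 hZ)
  convert h2 using 1
  ext x
  simp [domRestrict, and_comm]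

lemma surfaceDeriv_comp {M : Type*} [TopologicalSpace M] [ChartedSpace E3 M] {Θ : E3 → M}
    {ψ : E2 → E3} {u : E2} (hΘ : MDifferentiableAt (𝓡 3) (𝓡 3) Θ (ψ u))
    (hψ : DifferentiableAt ℝ ψ u) (v : E2) :
    surfaceDeriv (fun z ↦ Θ (ψ z)) u v = chartDeriv Θ (ψ u) (fderiv ℝ ψ u v) := by
  have h2 := mfderiv_comp u hΘ hψ.mdifferentiableAt
  rw [mfderiv_eq_fderiv] at h2
  exact DFunLike.congr_fun h2 v

lemma IsRegularPatch.isPatch {V : Set E3} {M : Type*} [TopologicalSpace M]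
    [ChartedSpace E3 M] {Θ : E3 → M} {N : Set E3} (h : IsParam Θ N) {ψ : E2 → E3} {U : Set E2}
    (hψ : IsRegularPatch ψ U) (hV : V ⊆ N) (hm : MapsTo ψ U V) :
    IsPatch (Θ '' V) (fun z ↦ Θ (ψ z)) U where
  isOpen := hψ.isOpen
  contMDiffOn := h.contMDiffOn.comp hψ.contDiffOn.contMDiffOn fun _ hu ↦ hV (hm hu)
  injOn := h.injOn.comp hψ.injOn fun _ hu ↦ hV (hm hu)
  immersion u hu := by
    intro (a : E2) (b : E2) hab
    have h1 : ∀ v, surfaceDeriv (fun z ↦ Θ (ψ z)) u v = chartDeriv Θ (ψ u) (fderiv ℝ ψ u v) :=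
      surfaceDeriv_comp (h.mdifferentiableAt (hV (hm hu))) (hψ.differentiableAt hu)
    have h2 : surfaceDeriv (fun z ↦ Θ (ψ z)) u a = surfaceDeriv (fun z ↦ Θ (ψ z)) u b := hab
    rw [h1, h1] at h2
    exact hψ.immersion u hu (h.immersion _ (hV (hm hu)) h2)
  mapsTo u hu := mem_image_of_mem _ (hm hu)

/-- A patch in the image of a parametrization, in the coordinates of the parametrization. -/
lemma IsPatch.exists_lift {V : Set E3} {M : Type*} [TopologicalSpace M]
    [ChartedSpace E3 M] {Θ : E3 → M} {N : Set E3} (h : IsParam Θ N) (hV : V ⊆ N) {ψ : E2 → M} {U : Set E2}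
    (hψ : IsPatch (Θ '' V) ψ U) :
    ∃ ψ' : E2 → E3, IsRegularPatch ψ' U ∧ MapsTo ψ' U V ∧ EqOn (fun z ↦ Θ (ψ' z)) ψ U := by
  obtain ⟨Ξ, hΞ, hΞs⟩ := h.exists_inverse
  have hm : MapsTo (fun z ↦ Ξ (ψ z)) U V := by
    intro u hu
    obtain ⟨y, hy, hy'⟩ := hψ.mapsTo hu
    simp only [← hy', hΞ (hV hy)]
    exact hy
  have heq : EqOn (fun z ↦ Θ (Ξ (ψ z))) ψ U := by
    intro u hu
    obtain ⟨y, hy, hy'⟩ := hψ.mapsTo hu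
    simp only [← hy', hΞ (hV hy)]
  have hsm : ContDiffOn ℝ ∞ (fun z ↦ Ξ (ψ z)) U :=
    (hΞs.comp hψ.contMDiffOn fun u hu ↦ image_mono hV (hψ.mapsTo hu)).contDiffOn
  refine ⟨fun z ↦ Ξ (ψ z), ⟨hψ.isOpen, hsm, ?_, ?_⟩, hm, heq⟩
  · intro a ha b hb hab
    refine hψ.injOn ha hb ?_
    rw [← heq ha, ← heq hb]
    exact congrArg Θ hab
  · intro u hu (a : E2) (b : E2) hab
    have hd : DifferentiableAt ℝ (fun z ↦ Ξ (ψ z)) u :=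
      (hsm.contDiffAt (hψ.isOpen.mem_nhds hu)).differentiableAt (by simp)
    have h1 := surfaceDeriv_comp (h.mdifferentiableAt (hV (hm hu))) hd
    have h2 : surfaceDeriv ψ u = surfaceDeriv (fun z ↦ Θ (Ξ (ψ z))) u := by
      have h3 : (fun z ↦ Θ (Ξ (ψ z))) =ᶠ[𝓝 u] ψ :=
        heq.eventuallyEq_of_mem (hψ.isOpen.mem_nhds hu)
      exact h3.symm.mfderiv_eq
    have h3 : surfaceDeriv ψ u a = surfaceDeriv ψ u b := by rw [h2, h1, h1, hab]
    exact hψ.immersion u hu h3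

section

variable {V : Set E3} {ψ : ℕ → E2 → E3} {U : ℕ → Set E2} {W Z : ℕ → Set E3}

lemma IsAtlas.measurableSet_piece (h : IsAtlas V ψ U W Z) (i : ℕ) :
    MeasurableSet (U i ∩ ψ i ⁻¹' Z i) :=
  ContinuousOn.measurableSet_inter_preimage' (h.patch i).isOpen.measurableSet
    (h.patch i).contDiffOn.continuousOn (h.measurableSet i)

variable {M : Type*} [TopologicalSpace M] [ChartedSpace E3 M]
  [Bundle.RiemannianBundle (fun x : M ↦ TangentSpace (𝓡 3) x)] {Θ : E3 → M} {N : Set E3}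

lemma firstFund_congr {ψ ψ' : E2 → M} {u : E2} (h : ψ =ᶠ[𝓝 u] ψ') :
    firstFund ψ u = firstFund ψ' u := by
  have h1 : surfaceDeriv ψ u = surfaceDeriv ψ' u := h.mfderiv_eq
  ext i j
  rw [firstFund_eq_metricAt, firstFund_eq_metricAt, h1, h.self_of_nhds]

lemma det_firstFund_comp (h : IsParam Θ N) {ψ : E2 → E3} {u : E2} (hψ : DifferentiableAt ℝ ψ u)
    (hu : ψ u ∈ N) :
    (firstFund (fun z ↦ Θ (ψ z)) u).det = gramDensity (pullMetric Θ) ψ u := by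
  have h1 : ∀ i j, firstFund (fun z ↦ Θ (ψ z)) u i j = pullMetric Θ (ψ u)
      (fderiv ℝ ψ u (basisVec i)) (fderiv ℝ ψ u (basisVec j)) := by
    intro i j
    rw [firstFund_eq_metricAt, surfaceDeriv_comp (h.mdifferentiableAt hu) hψ,
      surfaceDeriv_comp (h.mdifferentiableAt hu) hψ, pullMetric_eq]
  rw [Matrix.det_fin_two, h1, h1, h1, h1, gramDensity, gram,
    pullMetric_comm Θ (ψ u) (fderiv ℝ ψ u (basisVec 1)) (fderiv ℝ ψ u (basisVec 0))]

/-- The area of the image of a surface with a countable atlas. -/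
theorem area_image_eq_tsum (h : IsParam Θ N) (hV : V ⊆ N) (ha : IsAtlas V ψ U W Z) :
    area (Θ '' V) = ∑' i, ∫⁻ u in U i ∩ ψ i ⁻¹' Z i,
      ENNReal.ofReal (Real.sqrt (gramDensity (pullMetric Θ) (ψ i) u)) := by
  have hm : ∀ i, MapsTo (ψ i) (U i) V := fun i u hu ↦
    ((ha.image i).subset (mem_image_of_mem _ hu)).1
  have hdet : ∀ {ψ' : E2 → E3} {U' : Set E2}, IsRegularPatch ψ' U' → MapsTo ψ' U' V → ∀ u ∈ U',
      (firstFund (fun z ↦ Θ (ψ' z)) u).det = gramDensity (pullMetric Θ) ψ' u :=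
    fun hp hm u hu ↦ det_firstFund_comp h (hp.differentiableAt hu) (hV (hm hu))
  apply le_antisymm
  -- Upper bound: cut each piece of a packing by the sets Z i and transport the parts to the patches
  -- ψ i. Disjoint images become disjoint subsets of the parameter domains.
  · refine iSup_le fun n ↦ iSup_le fun χ ↦ iSup_le fun O ↦ iSup_le fun K ↦ iSup_le fun hpack ↦ ?_
    choose χ' hχ hχm hχeq using fun j ↦ (hpack.1 j).1.exists_lift h hV
    have hint : ∀ j, ∫⁻ u in K j, ENNReal.ofReal (Real.sqrt (firstFund (χ j) u).det) =
        ∫⁻ u in K j, ENNReal.ofReal (Real.sqrt (gramDensity (pullMetric Θ) (χ' j) u)) := by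
      intro j
      refine setLIntegral_congr_fun (hpack.1 j).2.2 fun u hu ↦ ?_
      have hu' := (hpack.1 j).2.1 hu
      rw [← hdet (hχ j) (hχm j) u hu', firstFund_congr
        ((hχeq j).eventuallyEq_of_mem ((hχ j).isOpen.mem_nhds hu'))]
    have hmeas : ∀ j i, MeasurableSet (K j ∩ χ' j ⁻¹' Z i) := fun j i ↦
      ContinuousOn.measurableSet_inter_preimage' (hpack.1 j).2.2
        ((hχ j).contDiffOn.continuousOn.mono (hpack.1 j).2.1) (ha.measurableSet i)
    have hsplit : ∀ j, ∫⁻ u in K j,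
        ENNReal.ofReal (Real.sqrt (gramDensity (pullMetric Θ) (χ' j) u)) =
        ∑' i, ∫⁻ u in K j ∩ χ' j ⁻¹' Z i,
          ENNReal.ofReal (Real.sqrt (gramDensity (pullMetric Θ) (χ' j) u)) := by
      intro j
      rw [← lintegral_iUnion (hmeas j)]
      · congr 2
        rw [← inter_iUnion, ← preimage_iUnion, left_eq_inter]
        exact fun u hu ↦ ha.cover (hχm j ((hpack.1 j).2.1 hu))
      · intro i i' hii'
        exact ((ha.disjoint hii').preimage (χ' j)).mono inter_subset_right inter_subset_right
    have htrans : ∀ j i, ∃ A', MeasurableSet A' ∧ A' ⊆ U i ∧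
        ψ i '' A' = χ' j '' (K j ∩ χ' j ⁻¹' Z i) ∧
        ∫⁻ u in A', ENNReal.ofReal (Real.sqrt (gramDensity (pullMetric Θ) (ψ i) u)) =
          ∫⁻ u in K j ∩ χ' j ⁻¹' Z i,
            ENNReal.ofReal (Real.sqrt (gramDensity (pullMetric Θ) (χ' j) u)) := by
      intro j i
      refine (ha.patch i).lintegral_transition (hχ j) (ha.isEmbedding i) (pullMetric_comm Θ)
        (O := O j ∩ χ' j ⁻¹' W i)
        ((hχ j).contDiffOn.continuousOn.isOpen_inter_preimage (hχ j).isOpen (ha.isOpen i))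
        inter_subset_left ?_ (hmeas j i) ?_
      · intro u hu
        rw [ha.image i]
        exact ⟨hχm j hu.1, hu.2⟩
      · exact fun u hu ↦ ⟨(hpack.1 j).2.1 hu.1, ha.subset i hu.2⟩
    choose A hA hAU hAim hAint using htrans
    calc ∑ j, ∫⁻ u in K j, ENNReal.ofReal (Real.sqrt (firstFund (χ j) u).det)
    _ = ∑ j, ∑' i, ∫⁻ u in A j i,
          ENNReal.ofReal (Real.sqrt (gramDensity (pullMetric Θ) (ψ i) u)) := by
        simp only [hint, hsplit, hAint]
    _ = ∑' i, ∑ j, ∫⁻ u in A j i,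
          ENNReal.ofReal (Real.sqrt (gramDensity (pullMetric Θ) (ψ i) u)) :=
        (Summable.tsum_finsetSum fun _ _ ↦ ENNReal.summable).symm
    _ ≤ _ := by
        refine ENNReal.tsum_le_tsum fun i ↦ ?_
        have hdisj : Pairwise fun j j' ↦ Disjoint (A j i) (A j' i) := by
          intro j j' hjj'
          rw [Set.disjoint_left]
          intro u hu hu'
          have h1 : ψ i u ∈ χ' j '' (K j ∩ χ' j ⁻¹' Z i) := hAim j i ▸ mem_image_of_mem _ hu
          have h2 : ψ i u ∈ χ' j' '' (K j' ∩ χ' j' ⁻¹' Z i) := hAim j' i ▸ mem_image_of_mem _ hu'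
          obtain ⟨a, ha1, ha2⟩ := h1
          obtain ⟨b, hb1, hb2⟩ := h2
          refine Set.disjoint_left.1 (hpack.2 hjj') (mem_image_of_mem _ ha1.1) ⟨b, hb1.1, ?_⟩
          rw [← hχeq j ((hpack.1 j).2.1 ha1.1), ← hχeq j' ((hpack.1 j').2.1 hb1.1)]
          simp only [ha2, hb2]
        rw [← tsum_fintype (L := .unconditional _), ← lintegral_iUnion (fun j ↦ hA j i) hdisj]
        refine lintegral_mono_set (iUnion_subset fun j u hu ↦ ⟨hAU j i hu, ?_⟩)
        have h1 : ψ i u ∈ χ' j '' (K j ∩ χ' j ⁻¹' Z i) := hAim j i ▸ mem_image_of_mem _ hu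
        obtain ⟨a, ha1, ha2⟩ := h1
        rw [mem_preimage, ← ha2]
        exact ha1.2
  -- Lower bound: the first n pieces of the atlas are themselves a packing.
  · rw [ENNReal.tsum_eq_iSup_nat]
    refine iSup_le fun n ↦ ?_
    rw [Finset.sum_range]
    have hpack : IsPacking (Θ '' V) (fun (i : Fin n) z ↦ Θ (ψ i z)) (fun i ↦ U i)
        (fun i ↦ U i ∩ ψ i ⁻¹' Z i) := by
      refine ⟨fun i ↦ ⟨(ha.patch i).isPatch h hV (hm i), inter_subset_left,
        ha.measurableSet_piece i⟩, fun i j hij ↦ ?_⟩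
      refine Set.disjoint_left.2 ?_
      rintro _ ⟨a, ha1, rfl⟩ ⟨b, hb1, hb2⟩
      have h1 : ψ j b = ψ i a := h.injOn (hV (hm j hb1.1)) (hV (hm i ha1.1)) hb2
      refine Set.disjoint_left.1 (ha.disjoint fun hh ↦ hij (Fin.ext hh)) ha1.2 ?_
      rw [← h1]; exact hb1.2
    refine le_trans (le_of_eq ?_) (le_iSup_of_le n <| le_iSup_of_le _ <| le_iSup_of_le _ <|
      le_iSup_of_le _ <| le_iSup_of_le hpack le_rfl)
    refine Finset.sum_congr rfl fun i _ ↦ setLIntegral_congr_fun (ha.measurableSet_piece i)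
      fun u hu ↦ ?_
    rw [hdet (ha.patch i) (hm i) u hu.1]

end

end

/-! ### Existence of countable atlases; the squeezing map -/

section

lemma isEmbedding_domRestrict_of_comp {X Y Z : Type*} [TopologicalSpace X] [TopologicalSpace Y]
    [TopologicalSpace Z] {ψ : X → Y} {g : Y → Z} {U : Set X} {N : Set Y} (hψ : ContinuousOn ψ U)
    (hm : MapsTo ψ U N) (hg : ContinuousOn g N)
    (h : IsEmbedding (U.domRestrict fun x ↦ g (ψ x))) : IsEmbedding (U.domRestrict ψ) := by
  have h1 : Continuous fun x : U ↦ (⟨ψ x, hm x.2⟩ : N) :=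
    Continuous.subtype_mk hψ.domRestrict _
  have h2 : IsEmbedding fun x : U ↦ (⟨ψ x, hm x.2⟩ : N) :=
    IsEmbedding.of_comp (g := N.domRestrict g) h1 hg.domRestrict h
  exact IsEmbedding.subtypeVal.comp h2

section Atlas

variable {M : Type*} [TopologicalSpace M] [ChartedSpace E3 M] {Θ : E3 → M} {N : Set E3}

/-- An embedded surface in the image of a parametrization has a countable atlas, with any given
point in its first patch. -/
theorem IsSurface.exists_atlas (h : IsParam Θ N) {V : Set E3} (hV : V ⊆ N)
    (hs : IsSurface (Θ '' V)) {p : E3} (hp : p ∈ V) :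
    ∃ ψ U W Z, IsAtlas V ψ U W Z ∧ p ∈ W 0 ∧ Z 0 = W 0 := by
  have hloc : ∀ y : E3, ∃ (W : Set E3) (U : Set E2) (ψ : E2 → E3), y ∈ V → IsOpen W ∧ y ∈ W ∧
      IsRegularPatch ψ U ∧ ψ '' U = V ∩ W ∧ IsEmbedding (U.domRestrict ψ) := by
    intro y
    by_cases hy : y ∈ V
    · obtain ⟨W, U, ψ, hW, hyW, hψ, him, hemb⟩ := hs _ (mem_image_of_mem Θ hy)
      obtain ⟨ψ', hψ', hm, heq⟩ := hψ.exists_lift h hV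
      refine ⟨N ∩ Θ ⁻¹' W, U, ψ', fun _ ↦
        ⟨h.contMDiffOn.continuousOn.isOpen_inter_preimage h.isOpen hW, ⟨hV hy, hyW⟩, hψ', ?_, ?_⟩⟩
      · ext z
        constructor
        · rintro ⟨u, hu, rfl⟩
          refine ⟨hm hu, hV (hm hu), ?_⟩
          rw [mem_preimage, show Θ (ψ' u) = ψ u from heq hu]
          exact (him.subset (mem_image_of_mem _ hu)).2
        · rintro ⟨hzV, hzN, hzW⟩
          obtain ⟨u, hu, hu'⟩ := him.superset ⟨mem_image_of_mem Θ hzV, hzW⟩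
          refine ⟨u, hu, h.injOn (hV (hm hu)) hzN ?_⟩
          rw [← hu', ← heq hu]
      · refine isEmbedding_domRestrict_of_comp (N := N) hψ'.contDiffOn.continuousOn
          (fun u hu ↦ hV (hm hu)) h.contMDiffOn.continuousOn ?_
        rwa [domRestrict_eq_domRestrict_iff.2 heq]
    · exact ⟨∅, ∅, fun _ ↦ 0, fun h ↦ absurd h hy⟩
  choose W U ψ hall using hloc
  -- Second countability of ℝ³ reduces the cover to countably many patches.
  obtain ⟨T, hTV, hTc, hT⟩ := TopologicalSpace.countable_cover_nhdsWithin (f := W) (s := V)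
    fun y hy ↦ mem_nhdsWithin_of_mem_nhds ((hall y hy).1.mem_nhds (hall y hy).2.1)
  obtain ⟨e, he⟩ := (hTc.insert p).exists_eq_range (insert_nonempty _ _)
  -- Placing p at index 0 leaves its patch uncut by the disjointification, so a full neighbourhood
  -- of p in V lies in a single piece.
  let q : ℕ → E3 := fun n ↦ Nat.casesOn n p e
  have hqV : ∀ n, q n ∈ V := by
    rintro (_ | n)
    · exact hp
    · have : e n ∈ insert p T := he ▸ mem_range_self n
      rcases this with h | h
      · exact (show e n ∈ V by rwa [h])
      · exact hTV h
  refine ⟨fun n ↦ ψ (q n), fun n ↦ U (q n), fun n ↦ W (q n), disjointed fun n ↦ W (q n),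
    ⟨fun i ↦ (hall _ (hqV i)).2.2.1, fun i ↦ (hall _ (hqV i)).1, fun i ↦ (hall _ (hqV i)).2.2.2.1,
      fun i ↦ (hall _ (hqV i)).2.2.2.2, disjointed_subset _, fun i ↦ ?_, disjoint_disjointed _, ?_⟩,
    (hall p hp).2.1, disjointed_zero _⟩
  · exact MeasurableSet.disjointed (fun i ↦ (hall _ (hqV i)).1.measurableSet) i
  · rw [iUnion_disjointed]
    intro y hy
    obtain ⟨z, hz, hyz⟩ := mem_iUnion₂.1 (hT hy)
    obtain ⟨n, hn⟩ : z ∈ range e := he ▸ mem_insert_of_mem _ hz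
    exact mem_iUnion.2 ⟨n + 1, by simpa only [q, hn] using hyz⟩

end Atlas

/-- The radial squeezing map of `ℝ³`, which multiplies `log ‖y‖` by `1 - t`. -/
noncomputable def squeeze (t : ℝ) (y : E3) : E3 := Real.exp (-t * Real.log ‖y‖) • y

section Squeeze

variable {t : ℝ} {y : E3}

lemma squeeze_ne_zero (hy : y ≠ 0) : squeeze t y ≠ 0 := smul_ne_zero (Real.exp_pos _).ne' hy

lemma log_norm_squeeze (hy : y ≠ 0) : Real.log ‖squeeze t y‖ = (1 - t) * Real.log ‖y‖ := by
  rw [squeeze, norm_smul, Real.norm_of_nonneg (Real.exp_pos _).le,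
    Real.log_mul (Real.exp_pos _).ne' (norm_ne_zero_iff.2 hy), Real.log_exp]
  ring

lemma toSphere_squeeze (hy : y ≠ 0) : toSphere (squeeze t y) = toSphere y :=
  toSphere_smul (Real.exp_pos _) hy

lemma squeeze_zero (y : E3) : squeeze 0 y = y := by simp [squeeze]

lemma squeeze_squeeze (t' : ℝ) (hy : y ≠ 0) :
    squeeze t' (squeeze t y) = squeeze (1 - (1 - t') * (1 - t)) y := by
  rw [squeeze, log_norm_squeeze hy, squeeze, squeeze, smul_smul, ← Real.exp_add]
  ring_nf

/-- The factors 1 - t multiply under composition. For 0 ≤ t < 1 the inverse has parameter at most 0,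
so `squeeze` is needed beyond [0, 1]. -/
lemma squeeze_inverse (ht : t < 1) (hy : y ≠ 0) : squeeze (1 - (1 - t)⁻¹) (squeeze t y) = y := by
  rw [squeeze_squeeze _ hy, sub_sub_cancel, inv_mul_cancel₀ (by linarith), sub_self, squeeze_zero]

lemma contDiffAt_squeeze (t : ℝ) (hy : y ≠ 0) : ContDiffAt ℝ ∞ (squeeze t) y := by
  have : ContDiffAt ℝ ∞ (fun z : E3 ↦ Real.log ‖z‖) y :=
    (contDiffAt_norm ℝ hy).log (norm_ne_zero_iff.2 hy)
  exact (contDiffAt_const.mul this).exp.smul contDiffAt_id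

lemma continuousOn_squeeze (t : ℝ) : ContinuousOn (squeeze t) {0}ᶜ := fun _ hy ↦
  (contDiffAt_squeeze t hy).continuousAt.continuousWithinAt

lemma fderiv_squeeze (t : ℝ) (hy : y ≠ 0) (v : E3) :
    fderiv ℝ (squeeze t) y v =
      Real.exp (-t * Real.log ‖y‖) • (v - (t * logNormDeriv y v) • y) := by
  have h1 : HasFDerivAt (fun z : E3 ↦ Real.exp (-t * Real.log ‖z‖)) _ y :=
    ((hasFDerivAt_log_norm hy).const_mul (-t)).exp
  have h2 : HasFDerivAt (squeeze t) _ y := h1.smul (hasFDerivAt_id y)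
  rw [h2.fderiv]
  simp only [add_apply, smul_apply, ContinuousLinearMap.smulRight_apply, id_eq,
    ContinuousLinearMap.coe_id', smul_eq_mul]
  module

lemma injective_fderiv_squeeze (ht : t < 1) (hy : y ≠ 0) :
    Function.Injective (fderiv ℝ (squeeze t) y) := by
  have h1 : (fun z ↦ squeeze (1 - (1 - t)⁻¹) (squeeze t z)) =ᶠ[𝓝 y] id := by
    filter_upwards [isOpen_compl_singleton.mem_nhds hy] with z hz using squeeze_inverse ht hz
  have h2 := fderiv_comp y
    ((contDiffAt_squeeze (1 - (1 - t)⁻¹) (squeeze_ne_zero (t := t) hy)).differentiableAt (by simp))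
    ((contDiffAt_squeeze t hy).differentiableAt (by simp))
  have h3 : fderiv ℝ (squeeze (1 - (1 - t)⁻¹) ∘ squeeze t) y = .id ℝ E3 :=
    h1.fderiv_eq.trans fderiv_id
  rw [h3] at h2
  intro a b hab
  have h4 := DFunLike.congr_fun h2 a
  have h5 := DFunLike.congr_fun h2 b
  simp only [ContinuousLinearMap.comp_apply, ContinuousLinearMap.id_apply, hab] at h4 h5
  exact h4.trans h5.symm

lemma IsRegularPatch.squeeze {ψ : E2 → E3} {U : Set E2} (h : IsRegularPatch ψ U)
    (hm : ∀ u ∈ U, ψ u ≠ 0) (ht : t < 1) : IsRegularPatch (fun u ↦ squeeze t (ψ u)) U where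
  isOpen := h.isOpen
  contDiffOn u hu := ((contDiffAt_squeeze t (hm u hu)).comp u (h.contDiffAt hu)).contDiffWithinAt
  injOn a ha b hb hab := by
    refine h.injOn ha hb ?_
    rw [← squeeze_inverse ht (hm a ha), ← squeeze_inverse ht (hm b hb)]
    exact congrArg _ hab
  immersion u hu := by
    have h1 := fderiv_comp u
      ((contDiffAt_squeeze t (hm u hu)).differentiableAt (by simp)) (h.differentiableAt hu)
    have h2 : fderiv ℝ (fun u ↦ Squeezing.squeeze t (ψ u)) u =
      (fderiv ℝ (Squeezing.squeeze t) (ψ u)).comp (fderiv ℝ ψ u) := h1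
    rw [h2]
    exact (injective_fderiv_squeeze ht (hm u hu)).comp (h.immersion u hu)

variable {V : Set E3} {ψ : ℕ → E2 → E3} {U : ℕ → Set E2} {W Z : ℕ → Set E3}

lemma IsAtlas.mapsTo (h : IsAtlas V ψ U W Z) (i : ℕ) : MapsTo (ψ i) (U i) V := fun _ hu ↦
  ((h.image i).subset (mem_image_of_mem _ hu)).1

/-- The image of an atlas under a squeezing map. -/
lemma IsAtlas.squeeze (h : IsAtlas V ψ U W Z) (hV : ∀ y ∈ V, y ≠ 0) (ht : t < 1) :
    IsAtlas (squeeze t '' V) (fun i u ↦ squeeze t (ψ i u)) U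
      (fun i ↦ {0}ᶜ ∩ squeeze (1 - (1 - t)⁻¹) ⁻¹' W i)
      (fun i ↦ {0}ᶜ ∩ squeeze (1 - (1 - t)⁻¹) ⁻¹' Z i) where
  patch i := (h.patch i).squeeze (fun u hu ↦ hV _ (h.mapsTo i hu)) ht
  isOpen i := (continuousOn_squeeze _).isOpen_inter_preimage isOpen_compl_singleton (h.isOpen i)
  image i := by
    ext z
    constructor
    · rintro ⟨u, hu, rfl⟩
      have hu' := (h.image i).subset (mem_image_of_mem _ hu)
      refine ⟨mem_image_of_mem _ hu'.1, squeeze_ne_zero (hV _ hu'.1), ?_⟩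
      rw [mem_preimage, squeeze_inverse ht (hV _ hu'.1)]
      exact hu'.2
    · rintro ⟨⟨y, hy, rfl⟩, -, hz⟩
      rw [mem_preimage, squeeze_inverse ht (hV _ hy)] at hz
      obtain ⟨u, hu, rfl⟩ := (h.image i).superset ⟨hy, hz⟩
      exact ⟨u, hu, rfl⟩
  isEmbedding i := by
    have hp := (h.patch i).squeeze (fun u hu ↦ hV _ (h.mapsTo i hu)) ht
    refine isEmbedding_domRestrict_of_comp (N := {0}ᶜ) hp.contDiffOn.continuousOn
      (fun u hu ↦ squeeze_ne_zero (hV _ (h.mapsTo i hu)))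
      (continuousOn_squeeze (1 - (1 - t)⁻¹)) ?_
    have h1 : EqOn (fun u ↦ Squeezing.squeeze (1 - (1 - t)⁻¹) (Squeezing.squeeze t (ψ i u)))
        (ψ i) (U i) := fun u hu ↦ squeeze_inverse ht (hV _ (h.mapsTo i hu))
    rw [domRestrict_eq_domRestrict_iff.2 h1]
    exact h.isEmbedding i
  subset i := inter_subset_inter_right _ (preimage_mono (h.subset i))
  measurableSet i := ContinuousOn.measurableSet_inter_preimage'
    isOpen_compl_singleton.measurableSet (continuousOn_squeeze _) (h.measurableSet i)
  disjoint i j hij := ((h.disjoint hij).preimage _).mono inter_subset_right inter_subset_right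
  cover := by
    rintro _ ⟨y, hy, rfl⟩
    obtain ⟨i, hi⟩ := mem_iUnion.1 (h.cover hy)
    refine mem_iUnion.2 ⟨i, squeeze_ne_zero (hV _ hy), ?_⟩
    rwa [mem_preimage, squeeze_inverse ht (hV _ hy)]

/-- Transporting the atlas along the squeezing puts all dependence on t into the integrand; the
domains of integration stay fixed, ready for differentiation under the integral. -/
theorem area_squeeze_eq_tsum {M : Type*} [TopologicalSpace M] [ChartedSpace E3 M]
    [Bundle.RiemannianBundle (fun x : M ↦ TangentSpace (𝓡 3) x)] {Θ : E3 → M} {N : Set E3}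
    (h : IsParam Θ N) (ha : IsAtlas V ψ U W Z) (hV : ∀ y ∈ V, y ≠ 0) (ht : t < 1)
    (hVN : squeeze t '' V ⊆ N) :
    area (Θ '' (squeeze t '' V)) = ∑' i, ∫⁻ u in U i ∩ ψ i ⁻¹' Z i,
      ENNReal.ofReal (Real.sqrt (gramDensity (pullMetric Θ) (fun u ↦ squeeze t (ψ i u)) u)) := by
  rw [area_image_eq_tsum h hVN (ha.squeeze hV ht)]
  refine tsum_congr fun i ↦ ?_
  congr 2
  ext u
  refine and_congr_right fun hu ↦ ?_
  have h1 := hV _ (ha.mapsTo i hu)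
  simp only [mem_preimage, mem_inter_iff, squeeze_inverse ht h1, mem_compl_iff, mem_singleton_iff,
    squeeze_ne_zero h1, not_false_eq_true, true_and]

end Squeeze

end

/-! ### Bounds on Gram determinants along the squeezing -/

section

/-- A shortcut for instance search. -/
noncomputable instance instNormedAddCommGroupForm : NormedAddCommGroup (E3 →L[ℝ] E3 →L[ℝ] ℝ) :=
  ContinuousLinearMap.toNormedAddCommGroup

/-- A shortcut for instance search. -/
noncomputable instance instSeminormedAddCommGroupForm :
    SeminormedAddCommGroup (E3 →L[ℝ] E3 →L[ℝ] ℝ) := ContinuousLinearMap.toSeminormedAddCommGroup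

section Forms

variable {B H P : E3 →L[ℝ] E3 →L[ℝ] ℝ}

/-- Cauchy–Schwarz for each form bounds the cross term by a geometric mean, and the
arithmetic–geometric mean inequality does the rest. -/
lemma mixedDisc_nonneg (hP : ∀ a b, P a b = P b a) (hP0 : ∀ a, 0 ≤ P a a)
    (hH : ∀ a b, H a b = H b a) (hH0 : ∀ a, 0 ≤ H a a) (v w : E3) : 0 ≤ mixedDisc P H v w := by
  have h1 := gram_nonneg hP hP0 v w
  have h2 := gram_nonneg hH hH0 v w
  rw [gram] at h1 h2
  have h3 : (2 * (P v w * H v w)) ^ 2 ≤ (P v v * H w w + P w w * H v v) ^ 2 := by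
    have h4 : (P v w * P v w) * (H v w * H v w) ≤ (P v v * P w w) * (H v v * H w w) :=
      mul_le_mul (by linarith) (by linarith) (mul_self_nonneg _) (mul_nonneg (hP0 _) (hP0 _))
    nlinarith [sq_nonneg (P v v * H w w - P w w * H v v)]
  have h5 := abs_le_of_sq_le_sq' h3
    (add_nonneg (mul_nonneg (hP0 _) (hH0 _)) (mul_nonneg (hP0 _) (hH0 _)))
  rw [mixedDisc]
  linarith [h5.2]

/-- Nonnegativity is applied to the form C H - B; the mixed discriminant of H with itself is twice
its Gram determinant. -/
lemma mixedDisc_le (hB : ∀ a b, B a b = B b a) (hH : ∀ a b, H a b = H b a) (hH0 : ∀ a, 0 ≤ H a a)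
    {C : ℝ} (hC : ∀ a, B a a ≤ C * H a a) (v w : E3) : mixedDisc B H v w ≤ 2 * C * gram H v w := by
  have h1 := mixedDisc_nonneg (P := C • H - B) (H := H)
    (fun a b ↦ by simp [hB a b, hH a b]) (fun a ↦ by simpa using hC a) hH hH0 v w
  simp only [mixedDisc, sub_apply, smul_apply, smul_eq_mul] at h1
  rw [mixedDisc, gram]
  linarith

lemma mixedDisc_smul_smul (a b : ℝ) (v w : E3) :
    mixedDisc (a • B) (b • H) v w = a * b * mixedDisc B H v w := by
  simp only [mixedDisc, smul_apply, smul_eq_mul]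
  ring

lemma mixedDisc_eq_zero (B H : E3 →L[ℝ] E3 →L[ℝ] ℝ) {v w : E3}
    (h : ¬LinearIndependent ℝ ![v, w]) : mixedDisc B H v w = 0 := by
  rw [LinearIndependent.pair_iff] at h
  push Not at h
  obtain ⟨a, b, hab, h0⟩ := h
  by_cases hb : b = 0
  · have ha : a ≠ 0 := fun ha ↦ h0 ha hb
    have hv : v = 0 := by simpa [hb, ha] using hab
    simp [mixedDisc, hv]
  · have hw : w = (-(a / b)) • v := by
      have h1 : b • w = (-a) • v := by
        rw [neg_smul]; exact eq_neg_of_add_eq_zero_right hab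
      rw [← neg_div, div_eq_inv_mul, mul_smul, ← h1, smul_smul, inv_mul_cancel₀ hb, one_smul]
    rw [hw]
    simp only [mixedDisc, map_smul, smul_apply, smul_eq_mul]
    ring

/-- The squared area splits over orthogonal coordinate planes: one contribution from the directions
orthogonal to y, one from the planes containing y. -/
lemma gram_add_radial (hH : ∀ a b, H a b = H b a) {y : E3} {v w : E3} (hv : H y v = 0)
    (hw : H y w = 0) (a b : ℝ) :
    gram H (v + a • y) (w + b • y) =
      gram H v w + H y y * H (b • v - a • w) (b • v - a • w) := by
  have hv' : H v y = 0 := by rw [hH, hv]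
  have hw' : H w y = 0 := by rw [hH, hw]
  simp only [gram, map_add, map_sub, map_smul, add_apply, sub_apply, smul_apply, smul_eq_mul, hv,
    hw, hv', hw', hH w v]
  ring

end Forms

section Curve

variable {G R : ℝ → E3 →L[ℝ] E3 →L[ℝ] ℝ} {s t : ℝ}

lemma hasDerivAt_gram_curve (hG : ∀ v w, HasDerivAt (fun r ↦ G r v w) (-s * R t v w) t)
    (v w : E3) :
    HasDerivAt (fun r ↦ gram (G r) v w) (-s * mixedDisc (R t) (G t) v w) t := by
  refine (((hG v v).mul (hG w w)).sub ((hG v w).mul (hG v w))).congr_deriv ?_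
  rw [mixedDisc]
  ring

/-- The derivative of the area element under squeezing, in a metric that splits orthogonally. -/
lemma hasDerivAt_squeezed_gram (hG : ∀ v w, HasDerivAt (fun r ↦ G r v w) (-s * R t v w) t)
    (v w y u : E3) :
    HasDerivAt (fun r ↦ gram (G r) v w + (1 - r) ^ 2 * (G r y y * G r u u))
      (-s * mixedDisc (R t) (G t) v w + (-(2 * (1 - t)) * (G t y y * G t u u) +
        (1 - t) ^ 2 * (-s * R t y y * G t u u + G t y y * (-s * R t u u)))) t := by
  have h1 : HasDerivAt (fun r : ℝ ↦ (1 - r) ^ 2) (-(2 * (1 - t))) t := by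
    refine (((hasDerivAt_id t).const_sub 1).pow 2).congr_deriv ?_
    simp
  exact (hasDerivAt_gram_curve hG v w).add (h1.mul ((hG y y).mul (hG u u)))

/-- Bounds for the derivative of the area element under squeezing. -/
lemma squeezed_gram_bounds {G R : E3 →L[ℝ] E3 →L[ℝ] ℝ} {s t C : ℝ} {v w y u : E3}
    (hG : ∀ a b, G a b = G b a) (hG0 : ∀ a, 0 ≤ G a a) (hR : ∀ a b, R a b = R b a)
    (hC : ∀ a, |R a a| ≤ C * G a a) (hs : 0 ≤ s) (hsC : s * C ≤ 1 / 4) (ht : -1 < t) (ht1 : t < 1) {D' : ℝ}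
    (hD' : D' = -s * mixedDisc R G v w + (-(2 * (1 - t)) * (G y y * G u u) +
        (1 - t) ^ 2 * (-s * R y y * G u u + G y y * (-s * R u u)))) :
    D' ≤ -(s * mixedDisc R G v w) - (1 - t) * (G y y * G u u) ∧
      -D' ≤ (1 / 2 + 2 / (1 - t)) * (gram G v w + (1 - t) ^ 2 * (G y y * G u u)) := by
  have hQ : 0 ≤ G y y * G u u := mul_nonneg (hG0 _) (hG0 _)
  have hgram := gram_nonneg hG hG0 v w
  have h1 : |R y y * G u u + G y y * R u u| ≤ 2 * C * (G y y * G u u) := by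
    refine (abs_add_le _ _).trans ?_
    rw [abs_mul, abs_mul, abs_of_nonneg (hG0 u), abs_of_nonneg (hG0 y)]
    have e1 := mul_le_mul_of_nonneg_right (hC y) (hG0 u)
    have e2 := mul_le_mul_of_nonneg_left (hC u) (hG0 y)
    linarith
  have h2 := mixedDisc_le hR hG hG0 (fun a ↦ (le_abs_self _).trans (hC a)) v w
  have h3 := abs_le.1 h1
  set E := R y y * G u u + G y y * R u u with hE
  set Q := G y y * G u u with hQdef
  have hD : D' = -(s * mixedDisc R G v w) - 2 * (1 - t) * Q - (1 - t) ^ 2 * (s * E) := by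
    rw [hD', hE]; ring
  have h4 : |s * E| ≤ 1 / 2 * Q := by
    rw [abs_mul, abs_of_nonneg hs]
    have e1 := mul_le_mul_of_nonneg_left h1 hs
    have e2 := mul_le_mul_of_nonneg_right hsC hQ
    linarith
  obtain ⟨h5, h6⟩ := abs_le.1 h4
  have h7 : (0 : ℝ) < 1 - t := by linarith
  constructor
  · have e1 : (1 - t) ^ 2 * (-(1 / 2 * Q)) ≤ (1 - t) ^ 2 * (s * E) :=
      mul_le_mul_of_nonneg_left h5 (sq_nonneg _)
    -- Since t > -1, (1 - t)² ≤ 2(1 - t). Hence the error (1 - t)² Q/2 uses up at most half of the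
    -- decrease 2(1 - t)Q.
    have e2 : (1 - t) ^ 2 * Q ≤ 2 * (1 - t) * Q :=
      mul_le_mul_of_nonneg_right (by nlinarith) hQ
    rw [hD]; linarith
  · have e1 : (1 - t) ^ 2 * (s * E) ≤ (1 - t) ^ 2 * (1 / 2 * Q) :=
      mul_le_mul_of_nonneg_left h6 (sq_nonneg _)
    have e2 : s * mixedDisc R G v w ≤ 1 / 2 * gram G v w := by
      have e3 := mul_le_mul_of_nonneg_left h2 hs
      have e4 := mul_le_mul_of_nonneg_right hsC hgram
      linarith
    -- The term (1 - t)² Q has logarithmic derivative -2/(1 - t), which accounts for the blow-up of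
    -- the bound at t = 1.
    have e5 : 2 / (1 - t) * ((1 - t) ^ 2 * Q) = 2 * (1 - t) * Q := by field_simp
    have e6 : 0 ≤ 2 / (1 - t) * gram G v w := by positivity
    rw [hD]; linarith

end Curve

/-- A smooth metric near the unit sphere for which the radial direction is orthogonal to the
spheres. -/
structure IsRadialMetric (H : E3 → E3 →L[ℝ] E3 →L[ℝ] ℝ) (δ : ℝ) : Prop where
  contDiffOn : ContDiffOn ℝ ∞ H (annulus E3 δ)
  symm : ∀ y a b, H y a b = H y b a
  pos : ∀ y ∈ annulus E3 δ, ∀ a, a ≠ 0 → 0 < H y a a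
  radial : ∀ y ∈ annulus E3 δ, ∀ w, inner ℝ y w = 0 → H y y w = 0

namespace IsRadialMetric

variable {H : E3 → E3 →L[ℝ] E3 →L[ℝ] ℝ} {δ : ℝ} {y : E3}

lemma differentiableAt (h : IsRadialMetric H δ) (hy : y ∈ annulus E3 δ) :
    DifferentiableAt ℝ H y :=
  (h.contDiffOn.contDiffAt ((isOpen_annulus δ).mem_nhds hy)).differentiableAt (by simp)

lemma nonneg (h : IsRadialMetric H δ) (hy : y ∈ annulus E3 δ) (a : E3) : 0 ≤ H y a a := by
  by_cases ha : a = 0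
  · simp [ha]
  · exact (h.pos y hy a ha).le

lemma radialForm_symm (h : IsRadialMetric H δ) (hy : y ∈ annulus E3 δ) (a b : E3) :
    radialForm H y a b = radialForm H y b a := by
  rw [radialForm_apply, radialForm_apply, fderiv_metric_apply (h.differentiableAt hy),
    fderiv_metric_apply (h.differentiableAt hy), h.symm]
  simp_rw [h.symm _ a b]

lemma continuousOn_radialForm (h : IsRadialMetric H δ) :
    ContinuousOn (fun q : E3 × E3 ↦ radialForm H q.1 q.2 q.2) (annulus E3 δ ×ˢ univ) := by
  have h1 : ContinuousOn (fun q : E3 × E3 ↦ H q.1 q.2 q.2) (annulus E3 δ ×ˢ univ) :=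
    ((h.contDiffOn.continuousOn.comp continuousOn_fst fun q hq ↦ hq.1).clm_apply
      continuousOn_snd).clm_apply continuousOn_snd
  have h2 : ContinuousOn (fun y ↦ fderiv ℝ H y y) (annulus E3 δ) :=
    (h.contDiffOn.continuousOn_fderiv_of_isOpen (isOpen_annulus δ) (by simp)).clm_apply
      continuousOn_id
  have h3 : ContinuousOn (fun q : E3 × E3 ↦ fderiv ℝ H q.1 q.1 q.2 q.2) (annulus E3 δ ×ˢ univ) :=
    ((h2.comp continuousOn_fst fun q hq ↦ hq.1).clm_apply continuousOn_snd).clm_apply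
      continuousOn_snd
  simp only [radialForm_apply]
  exact (continuousOn_const.mul h1).add h3

/-- The radial derivative of the metric is bounded by the metric. -/
lemma exists_bound (h : IsRadialMetric H δ) {r : ℝ} (hr : r < δ) :
    ∃ C, 0 < C ∧ ∀ y : E3, y ≠ 0 → |Real.log ‖y‖| ≤ r →
      ∀ a, |radialForm H y a a| ≤ C * H y a a := by
  set K : Set E3 := {y | Real.exp (-r) ≤ ‖y‖ ∧ ‖y‖ ≤ Real.exp r} with hKdef
  have hK : IsCompact K := by
    refine (isCompact_closedBall (0 : E3) (Real.exp r)).of_isClosed_subset ?_ ?_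
    · exact (isClosed_le continuous_const continuous_norm).inter
        (isClosed_le continuous_norm continuous_const)
    · intro y hy
      simpa using hy.2
  have hKN : K ⊆ annulus E3 δ := fun y hy ↦
    ⟨(Real.exp_lt_exp.2 (by linarith)).trans_le hy.1, hy.2.trans_lt (Real.exp_lt_exp.2 hr)⟩
  -- The quotient is homogeneous of degree 0 in the vector, so it suffices to bound it over the
  -- compact set of points in K and unit vectors.
  have hcont : ContinuousOn (fun q : E3 × E3 ↦ radialForm H q.1 q.2 q.2 / H q.1 q.2 q.2)
      (K ×ˢ sphere (0 : E3) 1) := by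
    have h1 : ContinuousOn (fun q : E3 × E3 ↦ H q.1) (K ×ˢ sphere (0 : E3) 1) :=
      h.contDiffOn.continuousOn.comp continuousOn_fst fun q hq ↦ hKN hq.1
    refine (h.continuousOn_radialForm.mono fun q hq ↦ ⟨hKN hq.1, mem_univ _⟩).div
      ((h1.clm_apply continuousOn_snd).clm_apply continuousOn_snd) fun q hq ↦ ?_
    exact (h.pos _ (hKN hq.1) _ (ne_zero_of_mem_unit_sphere ⟨q.2, hq.2⟩)).ne'
  obtain ⟨C, hC⟩ := (hK.prod (isCompact_sphere (0 : E3) 1)).exists_bound_of_continuousOn hcont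
  refine ⟨max C 1, by positivity, fun y hy0 hyr a ↦ ?_⟩
  have hyK : y ∈ K := by
    have hpos := norm_pos_iff.2 hy0
    have := abs_le.1 hyr
    exact ⟨(Real.le_log_iff_exp_le hpos).1 this.1, (Real.log_le_iff_le_exp hpos).1 this.2⟩
  by_cases ha : a = 0
  · simp [ha]
  have ha' : ‖a‖ ≠ 0 := norm_ne_zero_iff.2 ha
  have hpos := h.pos y (hKN hyK) a ha
  have h1 := hC (y, ‖a‖⁻¹ • a) ⟨hyK, by simp [norm_smul, ha']⟩
  simp only [map_smul, smul_apply, smul_eq_mul, Real.norm_eq_abs] at h1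
  rw [mul_div_mul_left _ _ (inv_ne_zero ha'), mul_div_mul_left _ _ (inv_ne_zero ha'), abs_div,
    abs_of_pos hpos, div_le_iff₀ hpos] at h1
  exact h1.trans (mul_le_mul_of_nonneg_right (le_max_left _ _) hpos.le)

end IsRadialMetric

end

/-! ### The area element at a point under squeezing -/

section

section Pointwise

variable {H : E3 → E3 →L[ℝ] E3 →L[ℝ] ℝ} {δ : ℝ} {y : E3}

/-- The metric along the squeezing of `y`, rescaled. -/
noncomputable def squeezedForm (H : E3 → E3 →L[ℝ] E3 →L[ℝ] ℝ) (y : E3) (t : ℝ) :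
    E3 →L[ℝ] E3 →L[ℝ] ℝ :=
  Real.exp (-t * Real.log ‖y‖) ^ 2 • H (squeeze t y)

lemma hasDerivAt_squeeze (y : E3) (t : ℝ) :
    HasDerivAt (fun r ↦ squeeze r y) (-Real.log ‖y‖ • squeeze t y) t := by
  have h1 : HasDerivAt (fun r : ℝ ↦ Real.exp (-r * Real.log ‖y‖)) _ t :=
    (((hasDerivAt_id t).neg).mul_const (Real.log ‖y‖)).exp
  refine (h1.smul_const y).congr_deriv ?_
  rw [squeeze, smul_smul]
  congr 1
  simp
  ring

/-- Squeezing moves y radially with logarithmic speed -log ‖y‖. The derivative of the squared scale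
factor supplies the term 2H of `radialForm`, the motion of the base point supplies the other. -/
lemma hasDerivAt_squeezedForm {t : ℝ} (hH : DifferentiableAt ℝ H (squeeze t y)) (v w : E3) :
    HasDerivAt (fun r ↦ squeezedForm H y r v w)
      (-Real.log ‖y‖ * squeezedForm (radialForm H) y t v w) t := by
  have h1 : HasDerivAt (fun r : ℝ ↦ Real.exp (-r * Real.log ‖y‖) ^ 2) _ t :=
    (((hasDerivAt_id t).neg).mul_const (Real.log ‖y‖)).exp.pow 2
  have h2 : HasFDerivAt (fun z ↦ H z v w) (fderiv ℝ (fun z ↦ H z v w) (squeeze t y))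
      (squeeze t y) :=
    ((hH.clm_apply (differentiableAt_const v)).clm_apply
      (differentiableAt_const w)).hasFDerivAt
  have h3 := h2.comp_hasDerivAt t (hasDerivAt_squeeze y t)
  refine (h1.mul h3).congr_deriv ?_
  rw [map_smul, ← fderiv_metric_apply hH]
  simp only [squeezedForm, radialForm_apply, smul_apply, smul_eq_mul]
  simp
  ring

lemma squeeze_mem_annulus {t : ℝ} (hy : y ≠ 0) (h : |(1 - t) * Real.log ‖y‖| < δ) :
    squeeze t y ∈ annulus E3 δ :=
  mem_annulus_iff.2 ⟨squeeze_ne_zero hy, by rw [log_norm_squeeze hy]; exact abs_lt.1 h⟩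

lemma fderiv_squeeze_add (hy : y ≠ 0) (t : ℝ) {w : E3} (hw : inner ℝ y w = 0) (a : ℝ) :
    fderiv ℝ (squeeze t) y (w + a • y) =
      Real.exp (-t * Real.log ‖y‖) • (w + ((1 - t) * a) • y) := by
  rw [fderiv_squeeze t hy, logNormDeriv_apply, inner_add_right, inner_smul_right, hw,
    real_inner_self_eq_norm_sq, zero_add]
  have : (‖y‖ ^ 2)⁻¹ * (a * ‖y‖ ^ 2) = a := by
    have := norm_ne_zero_iff.2 hy
    field_simp
  rw [this]
  congr 1
  module

lemma exists_radial_decomposition (hy : y ≠ 0) (a : E3) :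
    ∃ (w : E3) (c : ℝ), inner ℝ y w = 0 ∧ w + c • y = a := by
  refine ⟨a - (inner ℝ y a / ‖y‖ ^ 2) • y, inner ℝ y a / ‖y‖ ^ 2, ?_, by module⟩
  have := norm_ne_zero_iff.2 hy
  rw [inner_sub_right, inner_smul_right, real_inner_self_eq_norm_sq]
  field_simp
  ring

/-- The derivative of the area element under squeezing. -/
theorem exists_deriv_gram_squeeze (h : IsRadialMetric H δ)
    (hpos : ∀ z ∈ annulus E3 δ, 1 < ‖z‖ → ∀ v w, inner ℝ z v = 0 → inner ℝ z w = 0 →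
      LinearIndependent ℝ ![v, w] → 0 < mixedDisc (radialForm H z) (H z) v w)
    {r C : ℝ} (hr : r < δ) (hrC : r * C ≤ 1 / 2)
    (hC : ∀ z : E3, z ≠ 0 → |Real.log ‖z‖| ≤ r → ∀ a, |radialForm H z a a| ≤ C * H z a a)
    (hC0 : 0 < C) (hy : y ≠ 0) (hs : 0 ≤ Real.log ‖y‖) (hsr : 2 * Real.log ‖y‖ ≤ r) {a b : E3}
    (hab : LinearIndependent ℝ ![a, b]) :
    ∃ D' : ℝ → ℝ, ∀ t ∈ Ioo (-1 : ℝ) 1,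
      HasDerivAt (fun r ↦ gram (H (squeeze r y)) (fderiv ℝ (squeeze r) y a)
        (fderiv ℝ (squeeze r) y b)) (D' t) t ∧ D' t ≤ 0 ∧ (0 < Real.log ‖y‖ → D' t < 0) ∧
      -D' t ≤ (1 / 2 + 2 / (1 - t)) * gram (H (squeeze t y)) (fderiv ℝ (squeeze t) y a)
        (fderiv ℝ (squeeze t) y b) := by
  obtain ⟨v, α, hv, rfl⟩ := exists_radial_decomposition hy a
  obtain ⟨w, β, hw, rfl⟩ := exists_radial_decomposition hy b
  set s := Real.log ‖y‖ with hsdef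
  -- Negative t are admitted so that the derivative at t = 0 is two-sided. They can double the
  -- logarithmic radius, whence the hypothesis 2 log ‖y‖ ≤ r.
  have hlog : ∀ t ∈ Ioo (-1 : ℝ) 1, 0 ≤ (1 - t) * s ∧ (1 - t) * s ≤ r := fun t ht ↦
    ⟨mul_nonneg (by linarith [ht.2]) hs, by nlinarith [ht.1, ht.2]⟩
  have hmem : ∀ t ∈ Ioo (-1 : ℝ) 1, squeeze t y ∈ annulus E3 δ := fun t ht ↦
    squeeze_mem_annulus hy (by
      rw [← hsdef, abs_of_nonneg (hlog t ht).1]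
      exact (hlog t ht).2.trans_lt hr)
  have hsymm : ∀ t u u', squeezedForm H y t u u' = squeezedForm H y t u' u := fun t u u' ↦ by
    simp only [squeezedForm, smul_apply, h.symm _ u u']
  -- The derivative of `squeeze t` scales all directions by a common factor, absorbed in
  -- `squeezedForm`, and radial components by an additional 1 - t.
  have hform : ∀ t ∈ Ioo (-1 : ℝ) 1,
      gram (H (squeeze t y)) (fderiv ℝ (squeeze t) y (v + α • y))
        (fderiv ℝ (squeeze t) y (w + β • y)) =
      gram (squeezedForm H y t) v w + (1 - t) ^ 2 *
        (squeezedForm H y t y y * squeezedForm H y t (β • v - α • w) (β • v - α • w)) := by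
    intro t ht
    have hrad : ∀ u, inner ℝ y u = 0 → squeezedForm H y t y u = 0 := by
      intro u hu
      have h1 := h.radial _ (hmem t ht) u (by rw [squeeze, inner_smul_left, hu, mul_zero])
      rw [squeeze, map_smul, ← squeeze, smul_apply] at h1
      rw [squeezedForm, smul_apply, smul_apply,
        (smul_eq_zero.1 h1).resolve_left (Real.exp_pos _).ne', smul_zero]
    rw [fderiv_squeeze_add hy t hv, fderiv_squeeze_add hy t hw]
    have h2 : gram (H (squeeze t y))
        (Real.exp (-t * Real.log ‖y‖) • (v + ((1 - t) * α) • y))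
        (Real.exp (-t * Real.log ‖y‖) • (w + ((1 - t) * β) • y)) =
        gram (squeezedForm H y t) (v + ((1 - t) * α) • y) (w + ((1 - t) * β) • y) := by
      simp only [gram, squeezedForm, map_smul, smul_apply, smul_eq_mul]
      ring
    rw [h2, gram_add_radial (hsymm t) (hrad v hv) (hrad w hw)]
    have h3 : ((1 - t) * β) • v - ((1 - t) * α) • w = (1 - t) • (β • v - α • w) := by module
    rw [h3, map_smul, map_smul, smul_apply, smul_eq_mul, smul_eq_mul]
    ring
  set Q : ℝ → ℝ := fun t ↦
    squeezedForm H y t y y * squeezedForm H y t (β • v - α • w) (β • v - α • w)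
  set m : ℝ → ℝ := fun t ↦ mixedDisc (squeezedForm (radialForm H) y t) (squeezedForm H y t) v w
  have hexp : ∀ t, 0 < Real.exp (-t * Real.log ‖y‖) ^ 2 := fun t ↦ by positivity
  have hmscale : ∀ t, m t = Real.exp (-t * Real.log ‖y‖) ^ 2 *
      Real.exp (-t * Real.log ‖y‖) ^ 2 *
      mixedDisc (radialForm H (squeeze t y)) (H (squeeze t y)) v w := fun t ↦
    mixedDisc_smul_smul _ _ _ _
  have hm_pos : ∀ t ∈ Ioo (-1 : ℝ) 1, 0 < s → LinearIndependent ℝ ![v, w] → 0 < m t := by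
    intro t ht hs0 hvw
    rw [hmscale]
    refine mul_pos (mul_pos (hexp t) (hexp t)) (hpos _ (hmem t ht) ?_ v w ?_ ?_ hvw)
    · rw [← Real.log_pos_iff (norm_nonneg _), log_norm_squeeze hy]
      exact mul_pos (by linarith [ht.2]) hs0
    · rw [squeeze, inner_smul_left, hv, mul_zero]
    · rw [squeeze, inner_smul_left, hw, mul_zero]
  have hm_zero : ∀ t, ¬LinearIndependent ℝ ![v, w] → m t = 0 := fun t hvw ↦
    mixedDisc_eq_zero _ _ hvw
  have hm_nonneg : ∀ t ∈ Ioo (-1 : ℝ) 1, 0 ≤ s * m t := by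
    intro t ht
    by_cases hvw : LinearIndependent ℝ ![v, w]
    · rcases hs.eq_or_lt with h0 | h0
      · rw [← h0, zero_mul]
      · exact mul_nonneg hs (hm_pos t ht h0 hvw).le
    · rw [hm_zero t hvw, mul_zero]
  have hnonneg : ∀ t ∈ Ioo (-1 : ℝ) 1, ∀ u, 0 ≤ squeezedForm H y t u u := fun t ht u ↦
    mul_nonneg (hexp t).le (h.nonneg (hmem t ht) u)
  have hQ0 : ∀ t ∈ Ioo (-1 : ℝ) 1, 0 ≤ Q t := fun t ht ↦
    mul_nonneg (hnonneg t ht _) (hnonneg t ht _)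
  -- If βv - αw were 0, then βa - αb = 0 for the original vectors, so α = β = 0 and v, w would be
  -- those independent vectors themselves.
  have hQ_pos : ∀ t ∈ Ioo (-1 : ℝ) 1, ¬LinearIndependent ℝ ![v, w] → 0 < Q t := by
    intro t ht hvw
    refine mul_pos (mul_pos (hexp t) (h.pos _ (hmem t ht) _ hy))
      (mul_pos (hexp t) (h.pos _ (hmem t ht) _ fun h0 ↦ hvw ?_))
    rw [LinearIndependent.pair_iff] at hab ⊢
    intro c d hcd
    have h1 := hab β (-α) (by
      calc β • (v + α • y) + (-α) • (w + β • y) = β • v - α • w := by module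
        _ = 0 := h0)
    refine hab c d ?_
    rw [h1.1, neg_eq_zero.1 h1.2]
    simpa using hcd
  refine ⟨fun t ↦ -s * m t + (-(2 * (1 - t)) * Q t + (1 - t) ^ 2 *
    (-s * squeezedForm (radialForm H) y t y y *
        squeezedForm H y t (β • v - α • w) (β • v - α • w) +
      squeezedForm H y t y y *
        (-s * squeezedForm (radialForm H) y t (β • v - α • w) (β • v - α • w)))),
    fun t ht ↦ ?_⟩
  have hderiv := hasDerivAt_squeezed_gram (G := squeezedForm H y)
    (R := squeezedForm (radialForm H) y) (s := s) (t := t)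
    (hasDerivAt_squeezedForm (h.differentiableAt (hmem t ht))) v w y (β • v - α • w)
  have hb := squeezed_gram_bounds (G := squeezedForm H y t)
    (R := squeezedForm (radialForm H) y t) (s := s) (t := t) (C := C) (v := v) (w := w) (y := y)
    (u := β • v - α • w) (hsymm t) (hnonneg t ht)
    (fun u u' ↦ by simp only [squeezedForm, smul_apply, h.radialForm_symm (hmem t ht) u u'])
    (fun u ↦ by
      simp only [squeezedForm, smul_apply, smul_eq_mul]
      rw [abs_mul, abs_of_pos (hexp t), mul_left_comm]
      refine mul_le_mul_of_nonneg_left (hC _ (squeeze_ne_zero hy) ?_ u) (hexp t).le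
      rw [log_norm_squeeze hy, ← hsdef, abs_of_nonneg (hlog t ht).1]
      exact (hlog t ht).2) hs (by nlinarith) ht.1 ht.2 rfl
  have h1t : (0 : ℝ) < 1 - t := by linarith [ht.2]
  refine ⟨hderiv.congr_of_eventuallyEq ?_, ?_, ?_, ?_⟩
  · filter_upwards [isOpen_Ioo.mem_nhds ht] with t' ht' using hform t' ht'
  · exact hb.1.trans (by
      have := mul_nonneg h1t.le (hQ0 t ht)
      have := hm_nonneg t ht
      simp only [m, Q] at *
      linarith)
  · intro hs0
    refine hb.1.trans_lt ?_
    have e1 := mul_nonneg h1t.le (hQ0 t ht)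
    have e2 := hm_nonneg t ht
    by_cases hvw : LinearIndependent ℝ ![v, w]
    · have e3 := mul_pos hs0 (hm_pos t ht hs0 hvw)
      simp only [m, Q] at *
      linarith
    · have e3 := mul_pos h1t (hQ_pos t ht hvw)
      simp only [m, Q] at *
      linarith
  · rw [hform t ht]
    exact hb.2

end Pointwise

/-- Differentiation of the square root of a decreasing function of bounded logarithmic
derivative. -/
lemma hasDerivAt_sqrt_of_decreasing {D D' : ℝ → ℝ} {t₁ C : ℝ} (ht₁ : 0 < t₁) (ht₁' : t₁ < 1)
    (hD : ∀ t ∈ Ioo (-1 : ℝ) 1, HasDerivAt D (D' t) t ∧ D' t ≤ 0 ∧ 0 < D t) (hC0 : 0 ≤ C)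
    (hC : ∀ t ∈ Ioo (-1 : ℝ) t₁, -D' t ≤ C * D t) {t : ℝ} (ht : t ∈ Ioo (-1 / 2 : ℝ) t₁) :
    HasDerivAt (fun r ↦ √(D r)) (D' t / (2 * √(D t))) t ∧
      |D' t / (2 * √(D t))| ≤ C / 2 * Real.exp (C / 4) * √(D 0) := by
  have ht' : t ∈ Ioo (-1 : ℝ) 1 := ⟨by linarith [ht.1], by linarith [ht.2]⟩
  obtain ⟨hd, hneg, hpos⟩ := hD t ht'
  refine ⟨(hd.sqrt hpos.ne').congr_deriv rfl, ?_⟩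
  have hsq : 0 < √(D t) := Real.sqrt_pos.2 hpos
  have h1 : |D' t / (2 * √(D t))| ≤ C / 2 * √(D t) := by
    rw [abs_div, abs_of_nonpos hneg, abs_of_pos (by positivity), div_le_iff₀ (by positivity)]
    have := hC t ⟨ht'.1, ht.2⟩
    nlinarith [Real.mul_self_sqrt hpos.le]
  -- For t ≥ 0 because D decreases; for -1/2 < t < 0 because D e^{Ct} increases, which costs a
  -- factor e^{C/2}.
  have h2 : D t ≤ Real.exp (C / 4) ^ 2 * D 0 := by
    have hexp : Real.exp (C / 4) ^ 2 = Real.exp (C / 2) := by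
      rw [← Real.exp_nat_mul]; congr 1; push_cast; ring
    have hD0 : 0 < D 0 := (hD 0 (by norm_num)).2.2
    rw [hexp]
    rcases le_total 0 t with h0 | h0
    · have hanti : AntitoneOn D (Icc 0 t) := by
        have hsub : ∀ x ∈ Icc 0 t, x ∈ Ioo (-1 : ℝ) 1 := fun x hx ↦
          ⟨by linarith [hx.1], by linarith [hx.2, ht'.2]⟩
        refine antitoneOn_of_deriv_nonpos (convex_Icc 0 t)
          (fun x hx ↦ (hD x (hsub x hx)).1.continuousAt.continuousWithinAt)
          (fun x hx ↦ (hD x (hsub x (interior_subset hx))).1.differentiableAt.differentiableWithinAt)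
          fun x hx ↦ ?_
        rw [(hD x (hsub x (interior_subset hx))).1.deriv]
        exact (hD x (hsub x (interior_subset hx))).2.1
      have h3 := hanti ⟨le_rfl, h0⟩ ⟨h0, le_rfl⟩ h0
      have h4 : 1 ≤ Real.exp (C / 2) := Real.one_le_exp (by positivity)
      nlinarith
    · have hsub : ∀ x ∈ Icc t 0, x ∈ Ioo (-1 : ℝ) t₁ ∧ x ∈ Ioo (-1 : ℝ) 1 := fun x hx ↦
        ⟨⟨by linarith [hx.1, ht'.1], by linarith [hx.2]⟩,
          by linarith [hx.1, ht'.1], by linarith [hx.2]⟩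
      have hder : ∀ x ∈ Icc t 0, HasDerivAt (fun x ↦ D x * Real.exp (C * x))
          (D' x * Real.exp (C * x) + D x * (Real.exp (C * x) * C)) x := by
        intro x hx
        have e1 : HasDerivAt (fun x : ℝ ↦ Real.exp (C * x)) (Real.exp (C * x) * C) x := by
          simpa using ((hasDerivAt_id x).const_mul C).exp
        exact (hD x (hsub x hx).2).1.mul e1
      have hmono : MonotoneOn (fun x ↦ D x * Real.exp (C * x)) (Icc t 0) := by
        refine monotoneOn_of_deriv_nonneg (convex_Icc t 0)
          (fun x hx ↦ (hder x hx).continuousAt.continuousWithinAt)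
          (fun x hx ↦ (hder x (interior_subset hx)).differentiableAt.differentiableWithinAt)
          fun x hx ↦ ?_
        rw [(hder x (interior_subset hx)).deriv]
        have e1 := hC x (hsub x (interior_subset hx)).1
        have e2 := Real.exp_pos (C * x)
        nlinarith
      have h3 := hmono ⟨le_rfl, h0⟩ ⟨h0, le_rfl⟩ h0
      simp only [mul_zero, Real.exp_zero, mul_one] at h3
      have h4 : 1 ≤ Real.exp (C / 2) * Real.exp (C * t) := by
        rw [← Real.exp_add]
        refine Real.one_le_exp ?_
        nlinarith [ht.1]
      have h5 := (hD t ht').2.2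
      have h6 : Real.exp (C / 2) * (D t * Real.exp (C * t)) ≤ Real.exp (C / 2) * D 0 :=
        mul_le_mul_of_nonneg_left h3 (Real.exp_pos _).le
      nlinarith
  have h3 : √(D t) ≤ Real.exp (C / 4) * √(D 0) := by
    refine (Real.sqrt_le_sqrt h2).trans ?_
    rw [Real.sqrt_mul (by positivity), Real.sqrt_sq (Real.exp_pos _).le]
  calc _ ≤ C / 2 * √(D t) := h1
    _ ≤ C / 2 * (Real.exp (C / 4) * √(D 0)) := by gcongr
    _ = _ := by ring

end

/-! ### Differentiation of the area under the integral sign -/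

section

/-- Differentiation under the integral sign, with a negative derivative. -/
lemma exists_neg_hasDerivAt_integral {α : Type*} [MeasurableSpace α] {μ : Measure α}
    {F F' : ℝ → α → ℝ} {t : ℝ} {s : Set ℝ} (hs : s ∈ 𝓝 t)
    (hmeas : ∀ r ∈ s, AEStronglyMeasurable (F r) μ) (hint : Integrable (F t) μ) {b : α → ℝ}
    (hb : Integrable b μ)
    (hF : ∀ᵐ a ∂μ, ∀ r ∈ s, HasDerivAt (fun r ↦ F r a) (F' r a) r ∧ |F' r a| ≤ b a)
    (hneg : ∀ᵐ a ∂μ, F' t a ≤ 0) {S : Set α} (hS : μ S ≠ 0) (hSneg : ∀ᵐ a ∂μ, a ∈ S → F' t a < 0) :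
    ∃ D < 0, HasDerivAt (fun r ↦ ∫ a, F r a ∂μ) D t := by
  -- The derivative is an almost everywhere limit of a sequence of measurable difference quotients.
  have hF'meas : AEStronglyMeasurable (F' t) μ := by
    obtain ⟨ε, hε, hball⟩ := Metric.mem_nhds_iff.1 hs
    let q : ℕ → ℝ := fun n ↦ ε / (n + 2)
    have hq0 : ∀ n, 0 < q n := fun n ↦ by positivity
    have hqs : ∀ n, t + q n ∈ s := fun n ↦ hball (by
      rw [mem_ball_iff_norm, add_sub_cancel_left, Real.norm_of_nonneg (hq0 n).le,
        div_lt_iff₀ (by positivity)]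
      nlinarith [(Nat.cast_nonneg n : (0 : ℝ) ≤ n)])
    have hq : Filter.Tendsto q Filter.atTop (𝓝[≠] 0) := by
      refine tendsto_nhdsWithin_iff.2 ⟨?_, .of_forall fun n ↦ (hq0 n).ne'⟩
      exact Filter.Tendsto.div_atTop tendsto_const_nhds
        (Filter.tendsto_atTop_add_const_right _ _ tendsto_natCast_atTop_atTop)
    refine aestronglyMeasurable_of_tendsto_ae Filter.atTop
      (f := fun n a ↦ (q n)⁻¹ • (F (t + q n) a - F t a))
      (fun n ↦ ((hmeas _ (hqs n)).sub (hmeas t (mem_of_mem_nhds hs))).const_smul (q n)⁻¹) ?_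
    filter_upwards [hF] with a ha
    exact ((ha t (mem_of_mem_nhds hs)).1.tendsto_slope_zero).comp hq
  obtain ⟨hint', hder⟩ := hasDerivAt_integral_of_dominated_loc_of_deriv_le hs
    (Filter.eventually_of_mem hs hmeas) hint hF'meas
    (hF.mono fun a ha r hr ↦ (ha r hr).2) hb (hF.mono fun a ha r hr ↦ (ha r hr).1)
  refine ⟨_, ?_, hder⟩
  have hpos : 0 < ∫ a, -F' t a ∂μ := by
    rw [integral_pos_iff_support_of_nonneg_ae (hneg.mono fun a ha ↦ neg_nonneg.2 ha) hint'.neg]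
    refine (pos_iff_ne_zero.2 hS).trans_le (measure_mono_ae ?_)
    filter_upwards [hSneg] with a ha haS
    exact neg_ne_zero.2 (ha haS).ne
  rw [integral_neg] at hpos
  linarith

/-- The disjoint union of the measures on the pieces `K i` of the parameter domains. -/
noncomputable def piecesMeasure (K : ℕ → Set E2) : Measure (ℕ × E2) :=
  Measure.sum fun i ↦ ((volume : Measure E2).restrict (K i)).map (Prod.mk i)

section Pieces

variable {K : ℕ → Set E2}

lemma lintegral_piecesMeasure (K : ℕ → Set E2) (g : ℕ × E2 → ENNReal) :
    ∫⁻ x, g x ∂(piecesMeasure K) = ∑' i, ∫⁻ u in K i, g (i, u) := by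
  rw [piecesMeasure, lintegral_sum_measure]
  exact tsum_congr fun i ↦ (measurableEmbedding_prodMk_left i).lintegral_map _

lemma ae_piecesMeasure (hK : ∀ i, MeasurableSet (K i)) :
    ∀ᵐ x ∂(piecesMeasure K), x.2 ∈ K x.1 := by
  rw [piecesMeasure, Measure.ae_sum_iff]
  intro i
  rw [(measurableEmbedding_prodMk_left i).ae_map_iff]
  exact ae_restrict_mem (hK i)

lemma aestronglyMeasurable_piecesMeasure (hK : ∀ i, MeasurableSet (K i)) {g : ℕ × E2 → ℝ}
    (hg : ∀ i, ContinuousOn (fun u ↦ g (i, u)) (K i)) :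
    AEStronglyMeasurable g (piecesMeasure K) := by
  rw [piecesMeasure, aestronglyMeasurable_sum_measure_iff]
  intro i
  rw [(measurableEmbedding_prodMk_left i).aestronglyMeasurable_map_iff]
  exact (hg i).aestronglyMeasurable (hK i)

lemma piecesMeasure_ne_zero {O : Set E2} (i : ℕ) (hO : IsOpen O) (hne : O.Nonempty)
    (hOK : O ⊆ K i) : piecesMeasure K (Prod.mk i '' O) ≠ 0 := by
  have h1 : ((volume : Measure E2).restrict (K i)).map (Prod.mk i) (Prod.mk i '' O) ≤
      piecesMeasure K (Prod.mk i '' O) := Measure.le_sum _ i _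
  rw [(measurableEmbedding_prodMk_left i).map_apply,
    preimage_image_eq _ (measurableEmbedding_prodMk_left i).injective,
    Measure.restrict_eq_self _ hOK] at h1
  exact ((hO.measure_pos volume hne).trans_le h1).ne'

end Pieces

section Area

variable {M : Type*} [TopologicalSpace M] [ChartedSpace E3 M]
  [Bundle.RiemannianBundle (fun x : M ↦ TangentSpace (𝓡 3) x)] {Θ : E3 → M} {δ : ℝ}
  {V : Set E3} {ψ : ℕ → E2 → E3} {U : ℕ → Set E2} {W Z : ℕ → Set E3}

lemma gramDensity_squeeze {H : E3 → E3 →L[ℝ] E3 →L[ℝ] ℝ} {ψ : E2 → E3} {u : E2}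
    (hψ : DifferentiableAt ℝ ψ u) (h0 : ψ u ≠ 0) (t : ℝ) :
    gramDensity H (fun u ↦ squeeze t (ψ u)) u =
      gram (H (squeeze t (ψ u))) (fderiv ℝ (squeeze t) (ψ u) (fderiv ℝ ψ u (basisVec 0)))
        (fderiv ℝ (squeeze t) (ψ u) (fderiv ℝ ψ u (basisVec 1))) := by
  have h1 : fderiv ℝ (fun u ↦ squeeze t (ψ u)) u =
      (fderiv ℝ (squeeze t) (ψ u)).comp (fderiv ℝ ψ u) :=
    fderiv_comp u ((contDiffAt_squeeze t h0).differentiableAt (by simp)) hψ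
  rw [gramDensity, h1]
  rfl

/-- The area of a surface, not contained in the unit sphere, decreases under squeezing. -/
theorem hasDerivWithinAt_area_squeeze (h : IsParam Θ (annulus E3 δ))
    (hH : IsRadialMetric (pullMetric Θ) δ)
    (hpos : ∀ z ∈ annulus E3 δ, 1 < ‖z‖ → ∀ v w, inner ℝ z v = 0 → inner ℝ z w = 0 →
      LinearIndependent ℝ ![v, w] →
      0 < mixedDisc (radialForm (pullMetric Θ) z) (pullMetric Θ z) v w)
    {r C : ℝ} (hr : r < δ) (hrC : r * C ≤ 1 / 2)
    (hC : ∀ z : E3, z ≠ 0 → |Real.log ‖z‖| ≤ r → ∀ a,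
      |radialForm (pullMetric Θ) z a a| ≤ C * pullMetric Θ z a a)
    (hC0 : 0 < C) (hV : ∀ y ∈ V, y ≠ 0 ∧ 0 ≤ Real.log ‖y‖ ∧ 2 * Real.log ‖y‖ ≤ r)
    (hs : IsSurface (Θ '' V)) (hfin : area (Θ '' V) ≠ ⊤) {p : E3} (hp : p ∈ V)
    (hp0 : 0 < Real.log ‖p‖) {t : ℝ} (ht : t ∈ Ico (0 : ℝ) 1) :
    area (Θ '' (squeeze t '' V)) ≠ ⊤ ∧
      ∃ D < 0, HasDerivWithinAt (fun τ ↦ (area (Θ '' (squeeze τ '' V))).toReal) D (Icc 0 1) t := by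
  have hVne : ∀ y ∈ V, y ≠ 0 := fun y hy ↦ (hV y hy).1
  have hVt : ∀ τ ∈ Ioo (-1 : ℝ) 1, squeeze τ '' V ⊆ annulus E3 δ := by
    rintro τ hτ _ ⟨y, hy, rfl⟩
    obtain ⟨h0, h1, h2⟩ := hV y hy
    refine squeeze_mem_annulus h0 ?_
    rw [abs_of_nonneg (mul_nonneg (by linarith [hτ.2]) h1)]
    nlinarith [hτ.1]
  have hV0 : squeeze 0 '' V = V := by simp [squeeze_zero]
  have hVN : V ⊆ annulus E3 δ := hV0 ▸ hVt 0 (by norm_num)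
  obtain ⟨ψ, U, W, Z, ha, hpW, hZW⟩ := hs.exists_atlas h hVN hp
  set K : ℕ → Set E2 := fun i ↦ U i ∩ ψ i ⁻¹' Z i with hKdef
  have hK : ∀ i, MeasurableSet (K i) := ha.measurableSet_piece
  have hne : ∀ i, ∀ u ∈ U i, ψ i u ≠ 0 := fun i u hu ↦ hVne _ (ha.mapsTo i hu)
  set μ := piecesMeasure K
  set G : ℝ → ℕ × E2 → ℝ := fun τ x ↦
    gramDensity (pullMetric Θ) (fun u ↦ squeeze τ (ψ x.1 u)) x.2 with hG
  set A : ℝ → ℕ × E2 → ℝ := fun τ x ↦ √(G τ x) with hA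
  have harea : ∀ τ ∈ Ioo (-1 : ℝ) 1, area (Θ '' (squeeze τ '' V)) =
      ∫⁻ x, ENNReal.ofReal (A τ x) ∂μ := by
    intro τ hτ
    rw [area_squeeze_eq_tsum h ha hVne hτ.2 (hVt τ hτ), lintegral_piecesMeasure]
  have hAmeas : ∀ τ ∈ Ioo (-1 : ℝ) 1, AEStronglyMeasurable (A τ) μ := by
    intro τ hτ
    refine aestronglyMeasurable_piecesMeasure hK fun i ↦ ?_
    refine ContinuousOn.mono ?_ (inter_subset_left : K i ⊆ U i)
    exact (((ha.patch i).squeeze (hne i) hτ.2).continuousOn_gramDensity hH.contDiffOn.continuousOn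
      fun u hu ↦ hVt τ hτ (mem_image_of_mem _ (ha.mapsTo i hu))).sqrt
  have hA0 : ∀ τ x, 0 ≤ A τ x := fun τ x ↦ Real.sqrt_nonneg _
  have hAint : Integrable (A 0) μ := by
    refine ⟨hAmeas 0 (by norm_num), ?_⟩
    rw [hasFiniteIntegral_iff_ofReal (.of_forall (hA0 0)), ← harea 0 (by norm_num), hV0]
    exact hfin.lt_top
  have hpt : ∀ x : ℕ × E2, ∃ D' : ℝ → ℝ, x.2 ∈ U x.1 → ∀ τ ∈ Ioo (-1 : ℝ) 1,
      HasDerivAt (fun τ ↦ G τ x) (D' τ) τ ∧ D' τ ≤ 0 ∧ 0 < G τ x ∧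
      (0 < Real.log ‖ψ x.1 x.2‖ → D' τ < 0) ∧ -D' τ ≤ (1 / 2 + 2 / (1 - τ)) * G τ x := by
    rintro ⟨i, u⟩
    by_cases hu : u ∈ U i
    · obtain ⟨h0, h1, h2⟩ := hV _ (ha.mapsTo i hu)
      obtain ⟨D', hD'⟩ := exists_deriv_gram_squeeze hH hpos hr hrC hC hC0 h0 h1 h2
        (linearIndependent_map_basisVec ((ha.patch i).immersion u hu))
      have hGeq : ∀ τ, G τ (i, u) = _ := fun τ ↦
        gramDensity_squeeze (H := pullMetric Θ) ((ha.patch i).differentiableAt hu) h0 τ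
      refine ⟨D', fun _ τ hτ ↦ ?_⟩
      obtain ⟨e1, e2, e3, e4⟩ := hD' τ hτ
      refine ⟨?_, e2, ?_, e3, ?_⟩
      · simp only [hGeq]
        exact e1
      · exact ((ha.patch i).squeeze (hne i) hτ.2).gramDensity_pos hu (hH.symm _)
          (hH.pos _ (hVt τ hτ (mem_image_of_mem _ (ha.mapsTo i hu))))
      · rw [hGeq]
        exact e4
    · exact ⟨0, fun h ↦ absurd h hu⟩
  choose D' hD' using hpt
  -- The midpoint of t and 1 bounds a neighbourhood of t on which 2/(1 - τ), hence the logarithmic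
  -- derivative of the area element, is uniformly bounded. The dominating function is then a
  -- constant times the area element at time 0, integrable by finiteness of the area.
  set t₁ := (1 + t) / 2 with ht₁
  have ht₁0 : 0 < t₁ := by linarith [ht.1]
  have ht₁1 : t₁ < 1 := by linarith [ht.2]
  set C' := 1 / 2 + 2 / (1 - t₁) with hC'
  have hC'0 : 0 ≤ C' := by
    have : 0 < 1 - t₁ := by linarith
    positivity
  have hder : ∀ x : ℕ × E2, x.2 ∈ U x.1 → ∀ τ ∈ Ioo (-1 / 2 : ℝ) t₁,
      HasDerivAt (fun τ ↦ A τ x) (D' x τ / (2 * √(G τ x))) τ ∧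
        |D' x τ / (2 * √(G τ x))| ≤ C' / 2 * Real.exp (C' / 4) * A 0 x := by
    intro x hx τ hτ
    refine hasDerivAt_sqrt_of_decreasing ht₁0 ht₁1
      (fun τ hτ ↦ ⟨(hD' x hx τ hτ).1, (hD' x hx τ hτ).2.1, (hD' x hx τ hτ).2.2.1⟩) hC'0
      (fun τ hτ ↦ ?_) hτ
    have hτ' : τ ∈ Ioo (-1 : ℝ) 1 := ⟨hτ.1, hτ.2.trans ht₁1⟩
    refine (hD' x hx τ hτ').2.2.2.2.trans ?_
    refine mul_le_mul_of_nonneg_right ?_ (hD' x hx τ hτ').2.2.1.le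
    have e1 : 0 < 1 - t₁ := by linarith
    have e2 : 1 - t₁ ≤ 1 - τ := by linarith [hτ.2]
    rw [hC']
    gcongr
  have hKae : ∀ᵐ x ∂μ, x.2 ∈ U x.1 := (ae_piecesMeasure hK).mono fun x hx ↦ hx.1
  have ht' : t ∈ Ioo (-1 : ℝ) 1 := ⟨by linarith [ht.1], ht.2⟩
  have hmono : ∀ x : ℕ × E2, x.2 ∈ U x.1 → A t x ≤ A 0 x := by
    intro x hx
    refine Real.sqrt_le_sqrt ?_
    have hsub : ∀ τ ∈ Icc 0 t, τ ∈ Ioo (-1 : ℝ) 1 := fun τ hτ ↦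
      ⟨by linarith [hτ.1], by linarith [hτ.2, ht.2]⟩
    have hanti : AntitoneOn (fun τ ↦ G τ x) (Icc 0 t) := by
      refine antitoneOn_of_deriv_nonpos (convex_Icc 0 t)
        (fun τ hτ ↦ (hD' x hx τ (hsub τ hτ)).1.continuousAt.continuousWithinAt)
        (fun τ hτ ↦
          (hD' x hx τ (hsub τ (interior_subset hτ))).1.differentiableAt.differentiableWithinAt)
        fun τ hτ ↦ ?_
      rw [(hD' x hx τ (hsub τ (interior_subset hτ))).1.deriv]
      exact (hD' x hx τ (hsub τ (interior_subset hτ))).2.1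
    exact hanti ⟨le_rfl, ht.1⟩ ⟨ht.1, le_rfl⟩ ht.1
  have hAtint : Integrable (A t) μ := by
    refine hAint.mono (hAmeas t ht') ?_
    filter_upwards [hKae] with x hx
    rw [Real.norm_of_nonneg (hA0 t x), Real.norm_of_nonneg (hA0 0 x)]
    exact hmono x hx
  constructor
  · rw [harea t ht', ← ofReal_integral_eq_lintegral_ofReal hAtint (.of_forall (hA0 t))]
    exact ENNReal.ofReal_ne_top
  have hpU : ∃ u ∈ U 0, ψ 0 u = p := (ha.image 0).superset ⟨hp, hpW⟩
  -- Parameters of the part of the first patch strictly above the central leaf; it is open and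
  -- contains a preimage of p, so it has positive measure and makes the derivative strictly
  -- negative.
  set O : Set E2 := U 0 ∩ ψ 0 ⁻¹' {z | z ≠ 0 ∧ 0 < Real.log ‖z‖} with hO
  have hOopen : IsOpen O := by
    refine (ha.patch 0).contDiffOn.continuousOn.isOpen_inter_preimage (ha.patch 0).isOpen ?_
    have h1 : {z : E3 | z ≠ 0 ∧ 0 < Real.log ‖z‖} = {z | 1 < ‖z‖} := by
      ext z
      simp only [mem_ofPred_eq, Real.log_pos_iff (norm_nonneg z)]
      exact ⟨fun h ↦ h.2, fun h ↦ ⟨norm_pos_iff.1 (one_pos.trans h), h⟩⟩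
    rw [h1]
    exact isOpen_lt continuous_const continuous_norm
  have hOne : O.Nonempty := by
    obtain ⟨u, hu, hu'⟩ := hpU
    exact ⟨u, hu, by rw [mem_preimage, hu']; exact ⟨hVne p hp, hp0⟩⟩
  have hOK : O ⊆ K 0 := fun u hu ↦ ⟨hu.1, by
    rw [mem_preimage, hZW]
    exact ((ha.image 0).subset (mem_image_of_mem _ hu.1)).2⟩
  obtain ⟨D, hD, hderiv⟩ := exists_neg_hasDerivAt_integral (μ := μ) (F := A)
    (F' := fun τ x ↦ D' x τ / (2 * √(G τ x))) (s := Ioo (-1 / 2) t₁) (t := t)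
    (isOpen_Ioo.mem_nhds ⟨by linarith [ht.1], by linarith [ht.2]⟩)
    (fun τ hτ ↦ hAmeas τ ⟨by linarith [hτ.1], by linarith [hτ.2]⟩) hAtint
    (hAint.const_mul (C' / 2 * Real.exp (C' / 4)))
    (hKae.mono fun x hx ↦ hder x hx)
    (hKae.mono fun x hx ↦ div_nonpos_of_nonpos_of_nonneg (hD' x hx t ht').2.1 (by positivity))
    (piecesMeasure_ne_zero 0 hOopen hOne hOK) (.of_forall (by
      rintro _ ⟨u, hu, rfl⟩
      obtain ⟨e1, e2, e3, e4, e5⟩ := hD' (0, u) hu.1 t ht'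
      have := Real.sqrt_pos.2 e3
      exact div_neg_of_neg_of_pos (e4 hu.2.2) (by positivity)))
  refine ⟨D, hD, (hderiv.hasDerivWithinAt (s := Icc 0 1)).congr_of_eventuallyEq ?_ ?_⟩
  · have h1 : ∀ᶠ τ in 𝓝[Icc 0 1] t, τ ∈ Ioo (-1 : ℝ) 1 :=
      mem_nhdsWithin_of_mem_nhds (isOpen_Ioo.mem_nhds ht')
    filter_upwards [h1] with τ hτ
    rw [harea τ hτ, integral_eq_lintegral_of_nonneg_ae (.of_forall (hA0 τ)) (hAmeas τ hτ)]
  · rw [harea t ht', integral_eq_lintegral_of_nonneg_ae (.of_forall (hA0 t)) (hAmeas t ht')]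

end Area

end

/-! ### The collar and the embedding property -/

section

/-- The half-open annulus `1 ≤ ‖y‖ < e^r`. -/
def collar (r : ℝ) : Set E3 := {y | y ≠ 0 ∧ Real.log ‖y‖ ∈ Ico 0 r}

section Collar

variable {r δ t : ℝ} {y : E3}

lemma collar_subset_annulus (hr : r ≤ δ) : collar r ⊆ annulus E3 δ := fun _ hy ↦
  mem_annulus_iff.2 ⟨hy.1, by linarith [hy.2.1, hy.2.2], hy.2.2.trans_le hr⟩

lemma squeeze_mem_collar (ht : t ∈ Ico (0 : ℝ) 1) (hy : y ∈ collar r) :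
    squeeze t y ∈ collar r := by
  refine ⟨squeeze_ne_zero hy.1, ?_⟩
  rw [log_norm_squeeze hy.1]
  exact ⟨mul_nonneg (by linarith [ht.2]) hy.2.1, by nlinarith [ht.1, ht.2, hy.2.1, hy.2.2]⟩

/-- Near y the collar contains the half-space ⟨y, z⟩ ≥ ‖y‖², which lies outside the open ball of
radius ‖y‖. Its intersection with a small ball is convex with nonempty interior; this covers the
boundary sphere too. -/
lemma uniqueDiffWithinAt_collar (hy : y ∈ collar r) : UniqueDiffWithinAt ℝ (collar r) y := by
  have hy0 := hy.1
  have hpos := norm_pos_iff.2 hy0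
  obtain ⟨ε, hε, hball⟩ : ∃ ε > 0, ball y ε ⊆ {z : E3 | ‖z‖ < Real.exp r} := by
    refine Metric.isOpen_iff.1 (isOpen_lt continuous_norm continuous_const) y ?_
    exact (Real.log_lt_iff_lt_exp hpos).1 hy.2.2
  have hinner : Continuous fun z : E3 ↦ inner ℝ y z := continuous_const.inner continuous_id
  have hsub : {z : E3 | ‖y‖ ^ 2 ≤ inner ℝ y z} ∩ ball y ε ⊆ collar r := by
    rintro z ⟨hz, hzb⟩
    have h1 : ‖y‖ ≤ ‖z‖ := by
      have h2 : ‖y‖ ^ 2 ≤ ‖y‖ * ‖z‖ := hz.trans (real_inner_le_norm y z)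
      nlinarith
    have h3 : 0 < ‖z‖ := hpos.trans_le h1
    exact ⟨norm_pos_iff.1 h3, hy.2.1.trans (Real.log_le_log hpos h1),
      (Real.log_lt_iff_lt_exp h3).2 (hball hzb)⟩
  refine UniqueDiffWithinAt.mono ?_ hsub
  refine uniqueDiffWithinAt_convex ?_ ?_ (subset_closure ⟨?_, mem_ball_self hε⟩)
  · refine Convex.inter ?_ (convex_ball y ε)
    exact convex_halfSpace_ge (innerSL ℝ y).isLinear _
  · have hopen : IsOpen ({z : E3 | ‖y‖ ^ 2 < inner ℝ y z} ∩ ball y ε) :=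
      (isOpen_lt continuous_const hinner).inter isOpen_ball
    have hle : {z : E3 | ‖y‖ ^ 2 < inner ℝ y z} ∩ ball y ε ⊆
        {z : E3 | ‖y‖ ^ 2 ≤ inner ℝ y z} ∩ ball y ε :=
      inter_subset_inter_left _ fun z (hz : ‖y‖ ^ 2 < inner ℝ y z) ↦ hz.le
    refine Set.Nonempty.mono (interior_maximal hle hopen) ?_
    refine ⟨y + (ε / (2 * ‖y‖)) • y, ?_, ?_⟩
    · change ‖y‖ ^ 2 < inner ℝ y (y + (ε / (2 * ‖y‖)) • y)
      rw [inner_add_right, inner_smul_right, real_inner_self_eq_norm_sq]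
      have : 0 < ε / (2 * ‖y‖) * ‖y‖ ^ 2 := by positivity
      linarith
    · rw [mem_ball_iff_norm, add_sub_cancel_left, norm_smul, Real.norm_of_nonneg (by positivity)]
      have : ε / (2 * ‖y‖) * ‖y‖ = ε / 2 := by field_simp
      linarith
  · exact (real_inner_self_eq_norm_sq y).ge

end Collar

section Embedding

variable {M : Type*} [TopologicalSpace M] [ChartedSpace E3 M]
  {Θ : E3 → M} {δ r t : ℝ}

/-- The maps induced by squeezing are smooth embeddings. -/
theorem isSmoothEmbeddingOn_squeeze (h : IsParam Θ (annulus E3 δ)) (hr : r ≤ δ) {Q : M → M}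
    (ht : t ∈ Ico (0 : ℝ) 1) (hQ : ∀ y ∈ annulus E3 δ, Q (Θ y) = Θ (squeeze t y)) :
    IsSmoothEmbeddingOn Q (Θ '' collar r) := by
  obtain ⟨Ξ, hΞ, hΞs⟩ := h.exists_inverse
  have hsub : collar r ⊆ annulus E3 δ := collar_subset_annulus hr
  -- The formula for Q holds on both sides of the central leaf, so Q is smooth on full
  -- neighbourhoods, and its derivative within the collar is the ordinary one.
  have hQsm : ∀ y ∈ collar r, ContMDiffAt (𝓡 3) (𝓡 3) ∞ Q (Θ y) := by
    intro y hy
    have himg : Θ '' annulus E3 δ ∈ 𝓝 (Θ y) :=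
      (h.isOpen_image h.isOpen subset_rfl).mem_nhds (mem_image_of_mem _ (hsub hy))
    have h1 : ContMDiffAt (𝓡 3) (𝓡 3) ∞ Ξ (Θ y) := hΞs.contMDiffAt himg
    have hΞy : Ξ (Θ y) = y := hΞ (hsub hy)
    have h2 : ContMDiffAt (𝓡 3) (𝓡 3) ∞ (fun p ↦ squeeze t (Ξ p)) (Θ y) := by
      refine ContMDiffAt.comp (Θ y) (g := squeeze t) ?_ h1
      rw [hΞy]
      exact (contDiffAt_squeeze t hy.1).contMDiffAt
    have h3 : ContMDiffAt (𝓡 3) (𝓡 3) ∞ (fun p ↦ Θ (squeeze t (Ξ p))) (Θ y) := by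
      refine ContMDiffAt.comp (Θ y) (g := Θ) ?_ h2
      rw [hΞy]
      exact h.contMDiffAt (hsub (squeeze_mem_collar ht hy))
    refine h3.congr_of_eventuallyEq ?_
    filter_upwards [himg] with p hp
    obtain ⟨z, hz, rfl⟩ := hp
    rw [hQ z hz, hΞ hz]
  have hcont : ContMDiffOn (𝓡 3) (𝓡 3) ∞ Q (Θ '' collar r) := by
    rintro _ ⟨y, hy, rfl⟩
    exact (hQsm y hy).contMDiffWithinAt
  refine ⟨hcont, ?_, ?_⟩
  · rintro _ ⟨y, hy, rfl⟩
    have huniq : UniqueMDiffWithinAt (𝓡 3) (Θ '' collar r) (Θ y) := by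
      refine UniqueMDiffWithinAt.image_denseRange (f' := mfderiv (𝓡 3) (𝓡 3) Θ y)
        (uniqueDiffWithinAt_collar hy).uniqueMDiffWithinAt
        (h.mdifferentiableAt (hsub hy)).hasMFDerivAt.hasMFDerivWithinAt ?_
      exact (h.surjective_mfderiv (hsub hy)).denseRange
    have hQd : MDifferentiableAt (𝓡 3) (𝓡 3) Q (Θ y) := (hQsm y hy).mdifferentiableAt (by simp)
    rw [mfderivWithin_eq_mfderiv huniq hQd]
    have hsd : DifferentiableAt ℝ (squeeze t) y :=
      (contDiffAt_squeeze t hy.1).differentiableAt (by simp)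
    have hev : (fun z ↦ Q (Θ z)) =ᶠ[𝓝 y] fun z ↦ Θ (squeeze t z) := by
      filter_upwards [h.isOpen.mem_nhds (hsub hy)] with z hz using hQ z hz
    have h1 := mfderiv_comp y hQd (h.mdifferentiableAt (hsub hy))
    have hmem := hsub (squeeze_mem_collar ht hy)
    have h2 := mfderiv_comp y (h.mdifferentiableAt hmem) hsd.mdifferentiableAt
    rw [mfderiv_eq_fderiv] at h2
    have h3 : mfderiv (𝓡 3) (𝓡 3) (Q ∘ Θ) y = mfderiv (𝓡 3) (𝓡 3) (Θ ∘ squeeze t) y :=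
      hev.mfderiv_eq
    intro (a : E3) (b : E3) hab
    obtain ⟨a', ha'⟩ := h.surjective_mfderiv (hsub hy) a
    obtain ⟨b', hb'⟩ := h.surjective_mfderiv (hsub hy) b
    have h4 : ∀ v : E3, mfderiv (𝓡 3) (𝓡 3) Q (Θ y) (mfderiv (𝓡 3) (𝓡 3) Θ y v) =
        chartDeriv Θ (squeeze t y) (fderiv ℝ (squeeze t) y v) := fun v ↦
      (DFunLike.congr_fun h1 v).symm.trans
        ((DFunLike.congr_fun h3 v).trans (DFunLike.congr_fun h2 v))
    have h5 : chartDeriv Θ (squeeze t y) (fderiv ℝ (squeeze t) y a') =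
        chartDeriv Θ (squeeze t y) (fderiv ℝ (squeeze t) y b') :=
      (h4 a').symm.trans ((congrArg _ ha').trans (hab.trans ((congrArg _ hb').symm.trans (h4 b'))))
    have h6 : a' = b' := injective_fderiv_squeeze ht.2 hy.1 (h.immersion _ hmem h5)
    rw [← ha', ← hb', h6]
  -- The expansion inverse to the squeezing is a continuous left inverse on the image.
  · refine isEmbedding_domRestrict_of_comp (N := Q '' (Θ '' collar r))
      (g := fun p ↦ Θ (squeeze (1 - (1 - t)⁻¹) (Ξ p))) hcont.continuousOn (mapsTo_image _ _) ?_ ?_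
    · have hN : ∀ p ∈ Q '' (Θ '' collar r), ∃ y ∈ collar r, p = Θ (squeeze t y) := by
        rintro _ ⟨_, ⟨y, hy, rfl⟩, rfl⟩
        exact ⟨y, hy, hQ y (hsub hy)⟩
      have hsq : ∀ p ∈ Q '' (Θ '' collar r), Ξ p ≠ 0 ∧
          squeeze (1 - (1 - t)⁻¹) (Ξ p) ∈ annulus E3 δ := by
        intro p hp
        obtain ⟨y, hy, rfl⟩ := hN p hp
        rw [hΞ (hsub (squeeze_mem_collar ht hy)), squeeze_inverse ht.2 hy.1]
        exact ⟨squeeze_ne_zero hy.1, hsub hy⟩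
      refine h.contMDiffOn.continuousOn.comp ?_ fun p hp ↦ (hsq p hp).2
      refine (continuousOn_squeeze _).comp (hΞs.continuousOn.mono ?_) fun p hp ↦ (hsq p hp).1
      intro p hp
      obtain ⟨y, hy, rfl⟩ := hN p hp
      exact mem_image_of_mem _ (hsub (squeeze_mem_collar ht hy))
    · have heq : EqOn (fun p ↦ Θ (squeeze (1 - (1 - t)⁻¹) (Ξ (Q p)))) id (Θ '' collar r) := by
        rintro _ ⟨y, hy, rfl⟩
        simp only [id_eq, hQ y (hsub hy), hΞ (hsub (squeeze_mem_collar ht hy)),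
          squeeze_inverse ht.2 hy.1]
      rw [domRestrict_eq_domRestrict_iff.2 heq]
      exact IsEmbedding.subtypeVal

end Embedding

end

end Squeezing

/-! ### The squeezing deformation of the contracting half -/

theorem theorem7
    {M : Type*} [TopologicalSpace M] [ChartedSpace (EuclideanSpace ℝ (Fin 3)) M]
    [IsManifold (𝓡 3) ∞ M]
    [Bundle.RiemannianBundle (fun x : M ↦ TangentSpace (𝓡 3) x)]
    [IsContMDiffRiemannianBundle (𝓡 3) ∞ (EuclideanSpace ℝ (Fin 3))
      (fun x : M ↦ TangentSpace (𝓡 3) x)]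
    -- `M` is a Riemannian 3-sphere
    (hM : Nonempty (Diffeomorph (𝓡 3) (𝓡 3) M Squeezing.S3 ∞))
    -- a foliation `Σ_s`, `-1 < s < 1`, with minimal central leaf `Σ = Σ_0`
    (F : Squeezing.S2 × ℝ → M) (hF : Squeezing.IsSphereFoliation F)
    (hmin : ∀ x, Squeezing.meanCurvatureVector (fun x' ↦ F (x', 0)) x = 0)
    -- the function with level sets `Σ_s`
    (f : M → ℝ) (hf : ∀ x, ∀ s ∈ Ioo (-1 : ℝ) 1, f (F (x, s)) = s)
    -- the half `0 < s < 1` is contracting: `⟨∇f, H(Σ_s)⟩ < 0`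
    (hcontr : Squeezing.IsContractingHalf F f) :
    ∃ φ P : M → ℝ → M,
      -- `φ` is the flow of `X = ∇f / |∇f|²` starting at `Σ`, and `φ(Σ, s) = Σ_s`
      (∀ x ∈ Squeezing.leaf F 0, φ x 0 = x ∧
        IsMIntegralCurveOn (I := 𝓡 3) (φ x) (Squeezing.normalField f) (Ico 0 1)) ∧
      (∀ s ∈ Ico (0 : ℝ) 1, (fun x ↦ φ x s) '' Squeezing.leaf F 0 = Squeezing.leaf F s) ∧
      -- `P_t(φ(x, s)) = φ(x, (1 - t) s)`; here `P y t` is `P_t(y)`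
      (∀ x ∈ Squeezing.leaf F 0, ∀ s ∈ Ico (0 : ℝ) 1, ∀ t ∈ Icc (0 : ℝ) 1,
        P (φ x s) t = φ x ((1 - t) * s)) ∧
      ∃ r₀ : ℝ, 0 < r₀ ∧ r₀ ≤ 1 ∧
        -- (i)
        (∀ p ∈ Squeezing.Omega (Squeezing.leaf F 0) φ r₀, P p 0 = p) ∧
        (∀ p ∈ Squeezing.leaf F 0, ∀ t ∈ Icc (0 : ℝ) 1, P p t = p) ∧
        -- (ii)
        (∀ t ∈ Icc (0 : ℝ) 1, ∀ r ≤ r₀,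
          MapsTo (fun p ↦ P p t) (Squeezing.Omega (Squeezing.leaf F 0) φ r)
            (Squeezing.Omega (Squeezing.leaf F 0) φ r)) ∧
        (fun p ↦ P p 1) '' Squeezing.Omega (Squeezing.leaf F 0) φ r₀ = Squeezing.leaf F 0 ∧
        -- (iii)
        (∀ t ∈ Ico (0 : ℝ) 1,
          Squeezing.IsSmoothEmbeddingOn (fun p ↦ P p t)
            (Squeezing.Omega (Squeezing.leaf F 0) φ r₀)) ∧
        -- (iv)
        (∀ V : Set M, Squeezing.IsSurface V → Squeezing.area V ≠ ⊤ →
          V ⊆ Squeezing.Omega (Squeezing.leaf F 0) φ r₀ →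
          ∀ t ∈ Ico (0 : ℝ) 1,
            Squeezing.area ((fun p ↦ P p t) '' V) ≠ ⊤ ∧
            ∃ D : ℝ,
              HasDerivWithinAt (fun τ ↦ (Squeezing.area ((fun p ↦ P p τ) '' V)).toReal) D
                (Icc 0 1) t ∧
              D ≤ 0 ∧ (D = 0 ↔ V ⊆ Squeezing.leaf F 0)) := by
  obtain ⟨ϕ, Θ, δ, hδ0, hδ1, hϕ0, hϕint, hleaf, hinj, hΘ, hP, hrad, hpos⟩ :=
    Squeezing.exists_contracting_coords hF hf hcontr
  have hfϕ : ∀ x, ∀ s ∈ Ioo (-1 : ℝ) 1, f (ϕ x s) = s := by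
    intro x s hs
    have h1 : ϕ x s ∈ Squeezing.leaf F s := hleaf s hs ▸ mem_range_self x
    obtain ⟨x', hx'⟩ := h1
    rw [← hx']
    exact hf x' s hs
  have hleaf0 : ∀ {p}, p ∈ Squeezing.leaf F 0 ↔ ∃ x, ϕ x 0 = p := by
    intro p
    rw [← hleaf 0 (by norm_num)]
    rfl
  have hIco : ∀ {s : ℝ}, s ∈ Ico (0 : ℝ) 1 → s ∈ Ioo (-1 : ℝ) 1 := fun hs ↦
    ⟨by linarith [hs.1], hs.2⟩
  have : Nonempty Squeezing.S2 := ⟨Squeezing.toSphere 0⟩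
  -- The flow is indexed by S²; ι converts points of Σ to that index.
  obtain ⟨ι, hι⟩ : ∃ ι : M → Squeezing.S2, ∀ x, ι (ϕ x 0) = x :=
    Function.Injective.hasLeftInverse fun x x' h ↦ hinj x x' 0 (by norm_num) h
  -- Well defined: f recovers s from the point, and injectivity at that time recovers x. P is
  -- defined on both sides of Σ, as the smoothness argument requires; elsewhere it is the identity.
  have hPex : ∀ p, ∃ g : ℝ → M, ∀ x, ∀ s ∈ Ioo (-1 : ℝ) 1, ϕ x s = p →
      ∀ t, g t = ϕ x ((1 - t) * s) := by
    intro p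
    by_cases h : ∃ x, ∃ s ∈ Ioo (-1 : ℝ) 1, ϕ x s = p
    · obtain ⟨x, s, hs, rfl⟩ := h
      refine ⟨fun t ↦ ϕ x ((1 - t) * s), fun x' s' hs' heq t ↦ ?_⟩
      have h1 : s' = s := by rw [← hfϕ x s hs, ← hfϕ x' s' hs', heq]
      subst h1
      rw [hinj x' x s' hs' heq]
    · exact ⟨fun _ ↦ p, fun x s hs heq ↦ absurd ⟨x, s, hs, heq⟩ h⟩
  choose P hPϕ using hPex
  have hPϕ' : ∀ x, ∀ s ∈ Ioo (-1 : ℝ) 1, ∀ t, P (ϕ x s) t = ϕ x ((1 - t) * s) :=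
    fun x s hs t ↦ hPϕ _ x s hs rfl t
  have hOmega : ∀ {r p}, p ∈ Squeezing.Omega (Squeezing.leaf F 0) (fun p s ↦ ϕ (ι p) s) r ↔
      ∃ x, ∃ s ∈ Ico 0 r, ϕ x s = p := by
    intro r p
    constructor
    · rintro ⟨x, -, s, hs, hp⟩
      exact ⟨ι x, s, hs, hp⟩
    · rintro ⟨x, s, hs, hp⟩
      exact ⟨ϕ x 0, hleaf0.2 ⟨x, rfl⟩, s, hs, by simpa only [hι] using hp⟩
  have hOmegaΘ : ∀ r, Squeezing.Omega (Squeezing.leaf F 0) (fun p s ↦ ϕ (ι p) s) r =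
      Θ '' Squeezing.collar r := by
    intro r
    ext p
    rw [hOmega]
    constructor
    · rintro ⟨x, s, hs, rfl⟩
      refine ⟨Real.exp s • (x : Squeezing.E3), ⟨Squeezing.exp_smul_sphere_ne_zero x s, ?_⟩, ?_⟩
      · rwa [Squeezing.norm_exp_smul_sphere, Real.log_exp]
      · rw [hΘ, Squeezing.norm_exp_smul_sphere, Real.log_exp, Squeezing.toSphere_exp_smul]
    · rintro ⟨y, hy, rfl⟩
      exact ⟨_, _, hy.2, (hΘ y).symm⟩
  have hPΘ : ∀ t, ∀ y ∈ Squeezing.annulus Squeezing.E3 δ,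
      P (Θ y) t = Θ (Squeezing.squeeze t y) := by
    intro t y hy
    have hy0 := Squeezing.ne_zero_of_mem_annulus hy
    have hs := (Squeezing.mem_annulus_iff.1 (Squeezing.annulus_mono hδ1.le hy)).2
    rw [hΘ, hΘ, hPϕ' _ _ hs, Squeezing.log_norm_squeeze hy0, Squeezing.toSphere_squeeze hy0]
  have hH : Squeezing.IsRadialMetric (Squeezing.pullMetric Θ) δ :=
    ⟨Squeezing.contDiffOn_pullMetric hP.isOpen hP.contMDiffOn, Squeezing.pullMetric_comm Θ,
      fun y hy a ha ↦ Squeezing.pullMetric_pos hP hy ha, hrad⟩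
  obtain ⟨C, hC0, hC⟩ := hH.exists_bound (r := δ / 2) (by linarith)
  -- The first bound keeps squeezed points inside the coordinate annulus; the second makes the
  -- metric variation small enough to be absorbed. Then r₀ = r/2, leaving room for the doubling at
  -- negative times.
  set r := min (δ / 2) (1 / (2 * C)) with hr
  have hr0 : 0 < r := lt_min (by linarith) (by positivity)
  have hrδ : r < δ := (min_le_left _ _).trans_lt (by linarith)
  have hrC : r * C ≤ 1 / 2 := by
    calc r * C ≤ 1 / (2 * C) * C := mul_le_mul_of_nonneg_right (min_le_right _ _) hC0.le
      _ = 1 / 2 := by field_simp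
  have hCr : ∀ z : Squeezing.E3, z ≠ 0 → |Real.log ‖z‖| ≤ r → ∀ a,
      |Squeezing.radialForm (Squeezing.pullMetric Θ) z a a| ≤ C * Squeezing.pullMetric Θ z a a :=
    fun z hz hzr ↦ hC z hz (hzr.trans (min_le_left _ _))
  have hPleaf : ∀ p ∈ Squeezing.leaf F 0, ∀ t, P p t = p := by
    intro p hp t
    obtain ⟨x, rfl⟩ := hleaf0.1 hp
    rw [hPϕ' x 0 (by norm_num), mul_zero]
  have hr1 : r / 2 ≤ 1 := by linarith
  have hr2 : r / 2 ≤ δ := by linarith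
  refine ⟨fun p s ↦ ϕ (ι p) s, P, fun p hp ↦ ?_, fun s hs ↦ ?_, fun p hp s hs t ht ↦ ?_, r / 2,
    by linarith, hr1, fun p hp ↦ ?_, fun p hp t _ ↦ hPleaf p hp t, fun t ht r' hr' p hp ↦ ?_, ?_,
    fun t ht ↦ ?_, fun V hV hVfin hVsub t ht ↦ ?_⟩
  · obtain ⟨x, rfl⟩ := hleaf0.1 hp
    refine ⟨by simp only [hι], (hϕint (ι (ϕ x 0))).mono fun s hs ↦ hIco hs⟩
  · rw [← hleaf s (hIco hs)]
    ext p
    constructor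
    · rintro ⟨q, -, rfl⟩
      exact mem_range_self (ι q)
    · rintro ⟨x, rfl⟩
      exact ⟨ϕ x 0, hleaf0.2 ⟨x, rfl⟩, by simp only [hι]⟩
  · exact hPϕ' _ s (hIco hs) t
  · obtain ⟨x, s, hs, rfl⟩ := hOmega.1 hp
    rw [hPϕ' x s (hIco ⟨hs.1, hs.2.trans_le hr1⟩), sub_zero, one_mul]
  · obtain ⟨x, s, hs, rfl⟩ := hOmega.1 hp
    refine hOmega.2 ⟨x, (1 - t) * s, ⟨mul_nonneg (by linarith [ht.2]) hs.1, ?_⟩,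
      (hPϕ' x s (hIco ⟨hs.1, hs.2.trans_le (hr'.trans hr1)⟩) t).symm⟩
    nlinarith [hs.1, hs.2, ht.1]
  · ext p
    constructor
    · rintro ⟨q, hq, rfl⟩
      obtain ⟨x, s, hs, rfl⟩ := hOmega.1 hq
      refine hleaf0.2 ⟨x, ?_⟩
      simp only
      rw [hPϕ' x s (hIco ⟨hs.1, hs.2.trans_le hr1⟩), sub_self, zero_mul]
    · intro hp
      obtain ⟨x, hx⟩ := hleaf0.1 hp
      exact ⟨p, hOmega.2 ⟨x, 0, ⟨le_rfl, by linarith⟩, hx⟩, hPleaf p hp 1⟩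
  · rw [hOmegaΘ]
    exact Squeezing.isSmoothEmbeddingOn_squeeze hP hr2 ht fun y hy ↦ hPΘ t y hy
  -- Inside Σ the surface does not move and the area is constant; otherwise a point with log ‖y‖ > 0
  -- forces D < 0. Together these give both directions of the equality case.
  · by_cases hVleaf : V ⊆ Squeezing.leaf F 0
    · have himg : ∀ τ, (fun p ↦ P p τ) '' V = V := fun τ ↦ by
        rw [image_congr fun p hp ↦ hPleaf p (hVleaf hp) τ, image_id']
      simp only [himg]
      exact ⟨hVfin, 0, hasDerivWithinAt_const _ _ _, le_rfl, by simpa using hVleaf⟩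
    · obtain ⟨p, hpV, hp⟩ := not_subset.1 hVleaf
      rw [hOmegaΘ] at hVsub
      obtain ⟨V', hV', rfl⟩ := subset_image_iff.1 hVsub
      obtain ⟨y, hyV, rfl⟩ := hpV
      have hylog : 0 < Real.log ‖y‖ := by
        refine lt_of_le_of_ne (hV' hyV).2.1 fun h0 ↦ hp (hleaf0.2 ⟨Squeezing.toSphere y, ?_⟩)
        rw [hΘ, ← h0]
      have himg : ∀ τ, (fun p ↦ P p τ) '' (Θ '' V') = Θ '' (Squeezing.squeeze τ '' V') := fun τ ↦ by
        rw [image_image, image_image]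
        exact image_congr fun z hz ↦ hPΘ τ z (Squeezing.collar_subset_annulus hr2 (hV' hz))
      simp only [himg]
      obtain ⟨h1, D, hD, h2⟩ := Squeezing.hasDerivWithinAt_area_squeeze hP hH hpos hrδ hrC hCr hC0
        (fun z hz ↦ ⟨(hV' hz).1, (hV' hz).2.1, by linarith [(hV' hz).2.2]⟩) hV hVfin hyV hylog ht
      exact ⟨h1, D, h2, hD.le, fun h ↦ absurd h hD.ne, fun h ↦ absurd h hVleaf⟩
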